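/- **Setting.** Let $\lambda(x)=\sum_{k\ge2}\lambda_kx^{k-1}$ and $\rho(x)=\sum_{k\ge2}\rho_kx^{k-1}$ be edge-perspective degree distributions: polynomials with nonnegative coefficients and $\lambda(1)=\rho(1)=1$. Put $$p^*=p^*(\lambda,\rho)=\sup\{p\in(0,1] : p\,\lambda(1-\rho(1-x))<x \text{ for all } x\in(0,1]\},\qquad r(\lambda,\rho)=1-\frac{\sum_k\rho_k/k}{\sum_k\lambda_k/k}$$ (threshold and design rate). The density evolution of list-message-passing decoding with unbounded lists (LMP-$\infty$) at error rate $p$ is $x_0=y_0=1$ and, with $\tilde x_i=1-\rho(1-x_i)$ and $\tilde y_i=1-\rho(1-y_i)$, $$x_{i+1}=p\,\lambda(\tilde x_i),\qquad y_{i+1}=\lambda(\tilde x_i)+p\,(\tilde y_i-\tilde x_i)\,\lambda'(\tilde x_i);$$ here $y_i$ is the probability that a message from a variable node to a check node is not verified. The $q$-ary symmetric channel ($q$-SC) over a field $F$ with $q$ elements delivers each symbol correctly with probability $1-p$ and turns it into each of the $q-1$ other symbols with probability $p/(q-1)$. Its Shannon capacity in $q$-ary symbols per use is denoted $C_q(p)$.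 A random $(\lambda,\rho)$ Tanner graph with $n$ variable nodes is a uniformly random matching of variable-node sockets with check-node sockets, for prescribed node degrees. Along a sequence with $n\to\infty$, only degrees $k$ with $\lambda_k>0$ (resp. $\rho_k>0$) occur, and the fraction of edges at variable (check) nodes of degree $k$ tends to $\lambda_k$ (resp. $\rho_k$). Nonzero weights in $F$ on the edges give a parity-check matrix and a linear code over $F$. LMP-$\infty$ messages are either verified (with one symbol) or unverified (with a list of symbols). A variable node first sends the unverified list consisting of its received symbol. A check node sends along an edge a verified message if all the other incoming messages are verified (with the value satisfying the check), and otherwise the list of all symbols for which the check can be satisfied with symbols from the other incoming lists. A variable node uses its received symbol and the other incoming messages. If there are verified messages which disagree, it sends its received symbol, unverified. If there are verified messages and they agree, it sends their value, verified. If there are none, but some symbol appears more than once among the lists and the received symbol, it sends such a symbol, verified (any rule may choose among several). Otherwise it sends, unverified, the union of the lists and the received symbol. After a fixed number $\ell$ of iterations each variable node applies its rule to all its incoming messages. A symbol is in error unless it is then verified with the transmitted value. The symbol error rate of a code for a transmitted codeword is the expected fraction, over the channel noise, of symbols in error. **Theorem.** (a) Let $0\le p<p^*(\lambda,\rho)$.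 Then $y_i\to0$ as $i\to\infty$. Moreover, for every $\varepsilon>0$ there are $q_0<\infty$ and $\ell$ such that, for every finite field $F$ with at least $q_0$ elements, the following holds with probability tending to $1$ as $n\to\infty$ for the random $(\lambda,\rho)$ graph: for all nonzero edge weights and every transmitted codeword, $\ell$ iterations of LMP-$\infty$ decoding on the $q$-SC with error probability $p$ give a symbol error rate less than $\varepsilon$. (b) Consequently, ensembles that achieve capacity on the binary erasure channel (BEC) achieve capacity on the $q$-SC for large $q$. Precisely, let $(\lambda^{(k)},\rho^{(k)})$ be such that $p^*(\lambda^{(k)},\rho^{(k)})\to\delta$ and $r(\lambda^{(k)},\rho^{(k)})\to1-\delta$, and let $0\le p_k<p^*(\lambda^{(k)},\rho^{(k)})$ with $p_k\to\delta$. Then for every $\varepsilon>0$ and all sufficiently large $k$ there are $q_0$ and $\ell$ such that, for every field $F$ with $q\ge q_0$ elements, with probability tending to $1$ as $n\to\infty$ for the random $(\lambda^{(k)},\rho^{(k)})$ graph and for all nonzero edge weights, the code has rate greater than $C_q(p_k)-\varepsilon$ and, for every transmitted codeword, symbol error rate less than $\varepsilon$ under $\ell$ iterations of LMP-$\infty$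 on the $q$-SC with error probability $p_k$. -/

import Mathlib

open Filter Topology Polynomial

noncomputable section

/-! ### Degree distributions, threshold and density evolution -/

/-- An edge-perspective degree distribution `f(x) = ∑_{k ≥ 2} f_k x^{k-1}` (of bounded degree):
`f_k = f.coeff (k - 1)` is the fraction of the edges attached to nodes of degree `k`. -/
structure IsDegreeDist (f : ℝ[X]) : Prop where
  nonneg : ∀ k, 0 ≤ f.coeff k
  coeff_zero : f.coeff 0 = 0
  eval_one : f.eval 1 = 1

/-- `p* = sup {p ∈ (0,1] | p λ(1 - ρ(1 - x)) < x for all x ∈ (0,1]}`. -/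
def lmpThreshold (lam rho : ℝ[X]) : ℝ :=
  sSup {p : ℝ | p ∈ Set.Ioc (0 : ℝ) 1 ∧
    ∀ x ∈ Set.Ioc (0 : ℝ) 1, p * lam.eval (1 - rho.eval (1 - x)) < x}

/-- Density evolution for unbounded lists. The first component `x_i` is the probability that the
correct symbol is not on the list sent from a variable node to a check node, the second component
`y_i` is the probability that this message is not verified. -/
def densityEvolution (lam rho : ℝ[X]) (p : ℝ) : ℕ → ℝ × ℝ
  | 0 => (1, 1)
  | i + 1 =>
    let x := (densityEvolution lam rho p i).1
    let y := (densityEvolution lam rho p i).2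
    (p * lam.eval (1 - rho.eval (1 - x)),
      lam.eval (1 - rho.eval (1 - x)) +
        p * (rho.eval (1 - x) - rho.eval (1 - y)) * (derivative lam).eval (1 - rho.eval (1 - x)))

/-- The design rate `1 - ∫₀¹ ρ / ∫₀¹ λ = 1 - (∑_k ρ_k / k) / (∑_k λ_k / k)`. -/
def designRate (lam rho : ℝ[X]) : ℝ :=
  1 - (∑ i ∈ rho.support, rho.coeff i / (i + 1)) / (∑ i ∈ lam.support, lam.coeff i / (i + 1))

/-- A sequence of degree distribution pairs that achieves capacity on the binary erasure channel
with erasure probability `δ`: the decoding thresholds tend to `δ` and the design rates tend to the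
capacity `1 - δ`. -/
structure IsBECCapacityAchieving (lam rho : ℕ → ℝ[X]) (δ : ℝ) : Prop where
  lam_dist : ∀ k, IsDegreeDist (lam k)
  rho_dist : ∀ k, IsDegreeDist (rho k)
  threshold : Tendsto (fun k => lmpThreshold (lam k) (rho k)) atTop (𝓝 δ)
  rate : Tendsto (fun k => designRate (lam k) (rho k)) atTop (𝓝 (1 - δ))

/-! ### The `q`-ary symmetric channel -/

open scoped Classical in
/-- Transition probability of the `q`-ary symmetric channel with error probability `p`. -/
def qsc {F : Type} [Fintype F] (p : ℝ) (x y : F) : ℝ :=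
  if x = y then 1 - p else p / (Fintype.card F - 1)

/-- Shannon capacity of the `q`-ary symmetric channel, in `q`-ary symbols per channel use: the
largest mutual information between input and output over all input distributions. -/
def qscCapacity (F : Type) [Fintype F] (p : ℝ) : ℝ :=
  sSup {I : ℝ | ∃ P : F → ℝ, (∀ x, 0 ≤ P x) ∧ ∑ x, P x = 1 ∧
    I = ∑ x, ∑ y, P x * qsc p x y *
      Real.logb (Fintype.card F) (qsc p x y / ∑ x', P x' * qsc p x' y)}

/-! ### List messages and the local decoding rules -/

/-- A list-message: verified with a symbol value, unverified with a list of symbols, or an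
erasure. -/
inductive Msg (F : Type) where
  | verified (a : F) : Msg F
  | unverified (s : Finset F) : Msg F
  | erasure : Msg F

/-- The list of symbols carried by a message. -/
def Msg.symbols {F : Type} : Msg F → Finset F
  | .verified a => {a}
  | .unverified s => s
  | .erasure => ∅

/-- The value of a verified message (`none` if the message is not verified). -/
def Msg.value {F : Type} : Msg F → Option F
  | .verified a => some a
  | .unverified _ => none
  | .erasure => none

open scoped Classical in
/-- Check-node rule with maximum list size `Smax`. The incoming messages are `μ i`, `i ∈ I`, on
edges with weights `w i`; the outgoing message travels on an edge with weight `w₀`. -/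
def checkRule {F ι : Type} [Field F] [Fintype F] (Smax : ℕ∞) (w₀ : F) (w : ι → F)
    (I : Finset ι) (μ : ι → Msg F) : Msg F :=
  if ∀ i ∈ I, ∃ a, μ i = .verified a then
    .verified (-(w₀⁻¹ * ∑ i ∈ I, w i * (μ i).value.getD 0))
  else if ∃ i ∈ I, μ i = .erasure then
    .erasure
  else
    let L : Finset F := Finset.univ.filter fun a =>
      ∃ b : ι → F, (∀ i ∈ I, b i ∈ (μ i).symbols) ∧ w₀ * a + ∑ i ∈ I, w i * b i = 0
    if (L.card : ℕ∞) ≤ Smax then .unverified L else .erasure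

open scoped Classical in
/-- Variable-node rule with maximum list size `Smax` at a node with received value `r` and incoming
messages `μ i`, `i ∈ I`. The received value counts as one appearance of that symbol. If several
symbols appear more than once, `sel` selects one of them. -/
def variableRule {F ι : Type} [Fintype F] (Smax : ℕ∞) (sel : Finset F → F) (r : F)
    (I : Finset ι) (μ : ι → Msg F) : Msg F :=
  let V : Finset F := Finset.univ.filter fun a => ∃ i ∈ I, μ i = .verified a
  let R : Finset F := Finset.univ.filter fun a =>
    2 ≤ (I.filter fun i => a ∈ (μ i).symbols).card + (if a = r then 1 else 0)
  let L : Finset F := {r} ∪ I.biUnion fun i => (μ i).symbols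
  if (∀ i ∈ I, μ i = .erasure) ∨ 1 < V.card then .unverified {r}
  else if V.Nonempty then .verified (sel V)
  else if R.Nonempty then .verified (sel R)
  else if (L.card : ℕ∞) ≤ Smax then .unverified L
  else .unverified {r}

/-! ### Random Tanner graphs and codes -/

/-- Node degrees of a bipartite Tanner graph with `n` variable nodes and `r` check nodes. -/
structure NodeDegrees where
  n : ℕ
  r : ℕ
  dv : Fin n → ℕ
  dc : Fin r → ℕ
  edges_eq : ∑ v, dv v = ∑ c, dc c

/-- The sockets (half-edges) at the variable nodes. They also index the edges of the graph. -/
abbrev NodeDegrees.VSocket (D : NodeDegrees) : Type := Σ v : Fin D.n, Fin (D.dv v)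

/-- The sockets (half-edges) at the check nodes. -/
abbrev NodeDegrees.CSocket (D : NodeDegrees) : Type := Σ c : Fin D.r, Fin (D.dc c)

/-- A Tanner graph: a matching of the variable sockets with the check sockets. The random graph is
a uniformly random such matching. -/
abbrev NodeDegrees.Graph (D : NodeDegrees) : Type := D.VSocket ≃ D.CSocket

/-- Node degrees of longer and longer graphs with degree distribution pair `(λ, ρ)`: all degrees
have positive weight in the pair, and the fraction of the edges attached to nodes of degree `k`
tends to `λ_k` resp. `ρ_k`. -/
structure IsLongEnsemble (lam rho : ℝ[X]) (D : ℕ → NodeDegrees) : Prop where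
  length : Tendsto (fun m => (D m).n) atTop atTop
  dv_mem : ∀ m v, lam.coeff ((D m).dv v - 1) ≠ 0
  dc_mem : ∀ m c, rho.coeff ((D m).dc c - 1) ≠ 0
  dv_frac : ∀ k : ℕ, 1 ≤ k → Tendsto
    (fun m => (k : ℝ) * (Finset.univ.filter fun v => (D m).dv v = k).card / (∑ v, (D m).dv v : ℕ))
    atTop (𝓝 (lam.coeff (k - 1)))
  dc_frac : ∀ k : ℕ, 1 ≤ k → Tendsto
    (fun m => (k : ℝ) * (Finset.univ.filter fun c => (D m).dc c = k).card / (∑ c, (D m).dc c : ℕ))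
    atTop (𝓝 (rho.coeff (k - 1)))

open scoped Classical in
/-- The parity-check matrix of a graph `g` with nonzero edge weights `h`. -/
def parityCheck {F : Type} [Field F] {D : NodeDegrees} (g : D.Graph) (h : D.VSocket → Fˣ) :
    Matrix (Fin D.r) (Fin D.n) F :=
  fun c v => ∑ e ∈ Finset.univ.filter (fun e : D.VSocket => e.1 = v ∧ (g e).1 = c), (h e : F)

/-- The LDPC code of a graph with nonzero edge weights. -/
def ldpcCode {F : Type} [Field F] {D : NodeDegrees} (g : D.Graph) (h : D.VSocket → Fˣ) :
    Submodule F (Fin D.n → F) :=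
  LinearMap.ker (parityCheck g h).mulVecLin

/-- The rate of the code, `dim / n`. -/
def codeRate {F : Type} [Field F] {D : NodeDegrees} (g : D.Graph) (h : D.VSocket → Fˣ) : ℝ :=
  (Module.finrank F (ldpcCode g h) : ℝ) / D.n

/-! ### The LMP decoder -/

section Decoder

variable {F : Type} [Field F] [Fintype F] {D : NodeDegrees}

open scoped Classical in
/-- Messages from check nodes to variable nodes, given those from variable nodes to check nodes. -/
def checkStep (Smax : ℕ∞) (g : D.Graph) (h : D.VSocket → Fˣ) (μ : D.VSocket → Msg F)
    (e : D.VSocket) : Msg F :=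
  checkRule Smax (h e : F) (fun e' => (h e' : F))
    (Finset.univ.filter fun e' => (g e').1 = (g e).1 ∧ e' ≠ e) μ

open scoped Classical in
/-- Messages from variable nodes to check nodes after `i` iterations, for the received word `y`. -/
def variableMsg (Smax : ℕ∞) (sel : Finset F → F) (g : D.Graph) (h : D.VSocket → Fˣ)
    (y : Fin D.n → F) : ℕ → D.VSocket → Msg F
  | 0 => fun e => .unverified {y e.1}
  | i + 1 => fun e => variableRule Smax sel (y e.1)
      (Finset.univ.filter fun e' => e'.1 = e.1 ∧ e' ≠ e)
      (checkStep Smax g h (variableMsg Smax sel g h y i))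

open scoped Classical in
/-- The decision for the symbol `v` after `ℓ` iterations: the variable-node rule is applied to all
incoming messages. The result is the verified value, or `none` if the symbol is not verified. -/
def lmpDecode (Smax : ℕ∞) (sel : Finset F → F) (ℓ : ℕ) (g : D.Graph) (h : D.VSocket → Fˣ)
    (y : Fin D.n → F) (v : Fin D.n) : Option F :=
  (variableRule Smax sel (y v) (Finset.univ.filter fun e : D.VSocket => e.1 = v)
    (checkStep Smax g h (variableMsg Smax sel g h y ℓ))).value

open scoped Classical in
/-- Symbol error rate when the codeword `c` is sent over the channel with error probability `p`:
the expected fraction of the symbols that are not verified or are verified with a wrong value. -/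
def symbolErrorRate (Smax : ℕ∞) (sel : Finset F → F) (ℓ : ℕ) (p : ℝ) (g : D.Graph)
    (h : D.VSocket → Fˣ) (c : Fin D.n → F) : ℝ :=
  ∑ y : Fin D.n → F, (∏ v, qsc p (c v) (y v)) *
    ((Finset.univ.filter fun v => lmpDecode Smax sel ℓ g h y v ≠ some (c v)).card / D.n)

end Decoder

/-- The probability that a uniformly random graph with the given node degrees satisfies `Q`. -/
def graphProb (D : NodeDegrees) (Q : D.Graph → Prop) : ℝ :=
  (Nat.card {g : D.Graph // Q g} : ℝ) / Nat.card D.Graph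

end

set_option linter.unusedSectionVars false

/-! ### Polynomials with nonnegative coefficients -/

/-! Density evolution. Some `p' > p` still satisfies `p' λ(1 - ρ(1 - x)) < x` on `(0, 1]`, so `x_i`
decreases to `0`, the only fixed point. Dividing by `x` and letting `x → 0` gives `p' λ'(0) ρ'(1) ≤
1`, hence the stability condition `p λ'(0) ρ'(1) < 1` (`mul_derivative_lt_one`). Since `y_{i+1} ≤
λ(x̃_i) + p λ'(x̃_i) ρ'(1) y_i`, the sequence `y_i` is eventually contracted up to a vanishing term.

Decoding: the field. Every symbol on a list is the value `κ ⬝ᵥ y` of one of boundedly many linear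
forms in the received word, and each form takes the correct value at the codeword. If no incorrect
value occurs twice at any node of the computation, the decoder verifies only correct symbols and its
behaviour is determined by which symbols were received correctly (`variableMsg_sound`,
`lmpDecode_eq`). On a tree a false collision is a nontrivial linear relation between the errors;
resampling one wrong symbol shows that it has probability at most `1 / (q - 1)`
(`noiseMean_relation_le`). A union bound gives `O(1 / q)` with a constant that depends only on the
maximal degree and the number of rounds.

Decoding: the noise. Without collisions, messages at a tree-like node follow a recursion over
independent inputs. The probability of no verification, averaged over the noise, is therefore the
number `allUnverified` computed from the graph alone (`noiseMean_not_verified_eq`). This is why one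
random-graph event serves all edge weights and all codewords.

Decoding: the graph. `allUnverified` is the result of an exploration that asks for boundedly many
partners of half-edges. Exchanging partners in a uniform matching shows that the answers are
independent and uniform up to `O(1 / n)` (`abs_matchingMean_run_sub_mean_le`), and with independent
answers the means are exactly density evolution (`mean_msgQuery_inr`). Exploring two roots at once
bounds the second moment; Chebyshev's inequality gives concentration of the average over the nodes,
and Markov's inequality controls the nodes without a tree neighborhood (`one_sub_le_graphProb`).

Capacity. Comparing with a uniform output gives `C_q(p) ≤ 1 - p + log 2 / log q` (`qscCapacity_le`),
while the code rate is at least `1 - r / n`, which tends to the design rate. With thresholds tending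
to `δ` and design rates to `1 - δ`, the second claim follows from the first. -/

theorem pow_tangent_le {a b : ℝ} (ha : 0 ≤ a) (hb : 0 ≤ b) (k : ℕ) :
    a ^ k + (b - a) * (k * a ^ (k - 1)) ≤ b ^ k := by
  induction k with
  | zero => simp
  | succ k ih =>
    have h1 := mul_le_mul_of_nonneg_left ih hb
    rcases k with _ | k
    · simp
    · have h2 : 0 ≤ ((k : ℝ) + 1) * a ^ k * (b - a) ^ 2 := by positivity
      simp only [Nat.add_sub_cancel, pow_succ] at h1 ⊢
      push_cast at h1 ⊢
      nlinarith

namespace IsDegreeDist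

variable {f : ℝ[X]}

theorem eval_nonneg (hf : IsDegreeDist f) {x : ℝ} (hx : 0 ≤ x) : 0 ≤ f.eval x := by
  rw [eval_eq_sum]
  exact Finset.sum_nonneg fun i _ => mul_nonneg (hf.nonneg i) (pow_nonneg hx i)

theorem eval_mono (hf : IsDegreeDist f) {x y : ℝ} (hx : 0 ≤ x) (hxy : x ≤ y) :
    f.eval x ≤ f.eval y := by
  rw [eval_eq_sum, eval_eq_sum]
  exact Finset.sum_le_sum fun i _ =>
    mul_le_mul_of_nonneg_left (pow_le_pow_left₀ hx hxy i) (hf.nonneg i)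

theorem eval_le_one (hf : IsDegreeDist f) {x : ℝ} (hx : 0 ≤ x) (hx1 : x ≤ 1) : f.eval x ≤ 1 :=
  (hf.eval_mono hx hx1).trans_eq hf.eval_one

theorem eval_zero (hf : IsDegreeDist f) : f.eval 0 = 0 := by
  rw [← coeff_zero_eq_eval_zero, hf.coeff_zero]

theorem derivative_eval_nonneg (hf : IsDegreeDist f) {x : ℝ} (hx : 0 ≤ x) :
    0 ≤ (derivative f).eval x := by
  rw [derivative_eval, sum_def]
  exact Finset.sum_nonneg fun i _ =>
    mul_nonneg (mul_nonneg (hf.nonneg i) (Nat.cast_nonneg i)) (pow_nonneg hx _)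

/-- Convexity on the nonnegative reals, monomial by monomial. It is the source of all linear bounds
on `λ` and `ρ` below. -/
theorem tangent_le (hf : IsDegreeDist f) {a b : ℝ} (ha : 0 ≤ a) (hb : 0 ≤ b) :
    f.eval a + (b - a) * (derivative f).eval a ≤ f.eval b := by
  rw [derivative_eval, eval_eq_sum, eval_eq_sum, sum_def, sum_def, sum_def, Finset.mul_sum,
    ← Finset.sum_add_distrib]
  refine Finset.sum_le_sum fun i _ => ?_
  calc _ = f.coeff i * (a ^ i + (b - a) * (i * a ^ (i - 1))) := by ring
    _ ≤ _ := mul_le_mul_of_nonneg_left (pow_tangent_le ha hb i) (hf.nonneg i)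

theorem one_sub_eval_nonneg (hf : IsDegreeDist f) {x : ℝ} (hx : 0 ≤ x) (hx1 : x ≤ 1) :
    0 ≤ 1 - f.eval (1 - x) :=
  sub_nonneg.2 (hf.eval_le_one (by linarith) (by linarith))

theorem one_sub_eval_le_one (hf : IsDegreeDist f) {x : ℝ} (hx1 : x ≤ 1) :
    1 - f.eval (1 - x) ≤ 1 :=
  sub_le_self _ (hf.eval_nonneg (by linarith))

theorem one_sub_eval_le (hf : IsDegreeDist f) {x : ℝ} (hx1 : x ≤ 1) :
    1 - f.eval (1 - x) ≤ (derivative f).eval 1 * x := by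
  have := hf.tangent_le zero_le_one (sub_nonneg.2 hx1)
  rw [hf.eval_one] at this
  linarith

theorem derivative_eval_zero_mul_le (hf : IsDegreeDist f) {x : ℝ} (hx : 0 ≤ x) :
    (derivative f).eval 0 * x ≤ f.eval x := by
  have := hf.tangent_le le_rfl hx
  rw [hf.eval_zero] at this
  linarith

end IsDegreeDist

/-! ### Convergence of density evolution below the threshold -/

section DensityEvolution

variable {lam rho : ℝ[X]} {p : ℝ}

/-- The gap between `p` and an admissible `p'` is what later makes the limiting stability inequality
strict. -/
theorem exists_gt_of_lt_lmpThreshold (hp : 0 ≤ p) (h : p < lmpThreshold lam rho) :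
    ∃ p', p < p' ∧ p' ≤ 1 ∧
      ∀ x ∈ Set.Ioc (0 : ℝ) 1, p' * lam.eval (1 - rho.eval (1 - x)) < x := by
  have hne : {p : ℝ | p ∈ Set.Ioc (0 : ℝ) 1 ∧
      ∀ x ∈ Set.Ioc (0 : ℝ) 1, p * lam.eval (1 - rho.eval (1 - x)) < x}.Nonempty := by
    -- The supremum of the empty set is `0` in `ℝ`, which `0 ≤ p` excludes.
    by_contra hne
    rw [Set.not_nonempty_iff_eq_empty] at hne
    rw [lmpThreshold, hne, Real.sSup_empty] at h
    exact absurd h (not_lt.2 hp)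
  obtain ⟨p', hp', hlt⟩ := exists_lt_of_lt_csSup hne h
  exact ⟨p', hlt, hp'.1.2, hp'.2⟩

/-- The stability condition: the linear part of `λ` is a lower bound for it, so the slope at `0` of
the fixed-point inequality for `p'` gives the bound `≤ 1`. Passing from `p'` to `p` is strict unless
the derivatives have product `0`. -/
theorem mul_derivative_lt_one (hl : IsDegreeDist lam) (hr : IsDegreeDist rho) (hp : 0 ≤ p)
    (h : p < lmpThreshold lam rho) :
    p * (derivative lam).eval 0 * (derivative rho).eval 1 < 1 := by
  obtain ⟨p', hpp', -, hx⟩ := exists_gt_of_lt_lmpThreshold hp h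
  have hp'0 : 0 < p' := hp.trans_lt hpp'
  set a := (derivative lam).eval 0 with ha
  set b := (derivative rho).eval 1 with hb
  have ha0 : 0 ≤ a := hl.derivative_eval_nonneg le_rfl
  have hb0 : 0 ≤ b := hr.derivative_eval_nonneg zero_le_one
  have key : p' * a * b ≤ 1 := by
    have hd : HasDerivAt (fun x : ℝ => 1 - rho.eval (1 - x)) b 0 := by
      have h1 : HasDerivAt (fun x : ℝ => rho.eval x) b (1 - 0) := by
        simpa [hb] using rho.hasDerivAt 1
      have h2 : HasDerivAt (fun x : ℝ => 1 - x) (-1) 0 := by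
        simpa using (hasDerivAt_id (0 : ℝ)).const_sub 1
      simpa [Function.comp_def] using (h1.comp 0 h2).const_sub 1
    have hs := hd.tendsto_slope_zero_right
    simp only [zero_add, sub_zero, hr.eval_one, sub_self, smul_eq_mul] at hs
    have hs2 := hs.const_mul (p' * a)
    refine le_of_tendsto hs2 ?_
    have : Set.Ioc (0 : ℝ) 1 ∈ 𝓝[>] (0 : ℝ) := Ioc_mem_nhdsGT zero_lt_one
    filter_upwards [this] with t ht
    have h1 := hx t ht
    have h2 := hl.derivative_eval_zero_mul_le (hr.one_sub_eval_nonneg ht.1.le ht.2)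
    have h3 : p' * (a * (1 - rho.eval (1 - t))) ≤ t :=
      (mul_le_mul_of_nonneg_left h2 hp'0.le).trans h1.le
    calc p' * a * (t⁻¹ * (1 - rho.eval (1 - t)))
        = t⁻¹ * (p' * (a * (1 - rho.eval (1 - t)))) := by ring
      _ ≤ t⁻¹ * t := mul_le_mul_of_nonneg_left h3 (inv_nonneg.2 ht.1.le)
      _ = 1 := inv_mul_cancel₀ ht.1.ne'
  rcases (mul_nonneg ha0 hb0).eq_or_lt with h0 | h0
  · rw [mul_assoc, ← h0]; simp
  · nlinarith [mul_lt_mul_of_pos_right hpp' h0]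

theorem densityEvolution_mem (hl : IsDegreeDist lam) (hr : IsDegreeDist rho) (hp : 0 ≤ p)
    (hp1 : p ≤ 1) (i : ℕ) :
    0 ≤ (densityEvolution lam rho p i).1 ∧
      (densityEvolution lam rho p i).1 ≤ (densityEvolution lam rho p i).2 ∧
      (densityEvolution lam rho p i).2 ≤ 1 := by
  induction i with
  | zero => simp [densityEvolution]
  | succ i ih =>
    simp only [densityEvolution]
    set x := (densityEvolution lam rho p i).1
    set y := (densityEvolution lam rho p i).2
    obtain ⟨h0, hxy, h1⟩ := ih
    have hx' := hr.one_sub_eval_nonneg h0 (hxy.trans h1)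
    have hy' := hr.one_sub_eval_nonneg (h0.trans hxy) h1
    have hm : rho.eval (1 - y) ≤ rho.eval (1 - x) := hr.eval_mono (by linarith) (by linarith)
    have hd := hl.derivative_eval_nonneg hx'
    have hl0 := hl.eval_nonneg hx'
    refine ⟨mul_nonneg hp hl0, ?_, ?_⟩
    · have h2 : 0 ≤ p * (rho.eval (1 - x) - rho.eval (1 - y)) *
          (derivative lam).eval (1 - rho.eval (1 - x)) :=
        mul_nonneg (mul_nonneg hp (by linarith)) hd
      nlinarith
    · have h2 := hl.tangent_le hx' hy'
      have h3 := hl.eval_le_one hy' (hr.one_sub_eval_le_one h1)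
      have h4 : p * (rho.eval (1 - x) - rho.eval (1 - y)) ≤
          rho.eval (1 - x) - rho.eval (1 - y) := mul_le_of_le_one_left (by linarith) hp1
      have h5 := mul_le_mul_of_nonneg_right h4 hd
      calc _ ≤ lam.eval (1 - rho.eval (1 - x)) + (rho.eval (1 - x) - rho.eval (1 - y)) *
            (derivative lam).eval (1 - rho.eval (1 - x)) := by linarith
        _ = lam.eval (1 - rho.eval (1 - x)) + ((1 - rho.eval (1 - y)) - (1 - rho.eval (1 - x))) *
            (derivative lam).eval (1 - rho.eval (1 - x)) := by ring
        _ ≤ 1 := h2.trans h3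

/-- The sequence is antitone and bounded below; by continuity its limit is a fixed point, and there
is none in `(0, 1]`. -/
theorem tendsto_densityEvolution_fst (hl : IsDegreeDist lam) (hr : IsDegreeDist rho)
    (hp : 0 ≤ p) (h : p < lmpThreshold lam rho) :
    Tendsto (fun i => (densityEvolution lam rho p i).1) atTop (𝓝 0) := by
  obtain ⟨p', hpp', hp'1, hx⟩ := exists_gt_of_lt_lmpThreshold hp h
  have hp1 : p ≤ 1 := hpp'.le.trans hp'1
  set x : ℕ → ℝ := fun i => (densityEvolution lam rho p i).1 with hxdef
  have hmem := densityEvolution_mem hl hr hp hp1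
  have hx0 : ∀ i, 0 ≤ x i := fun i => (hmem i).1
  have hx1 : ∀ i, x i ≤ 1 := fun i => (hmem i).2.1.trans (hmem i).2.2
  have hstep : ∀ i, x (i + 1) = p * lam.eval (1 - rho.eval (1 - x i)) := fun i => rfl
  have hlt : ∀ t, 0 < t → t ≤ 1 → p * lam.eval (1 - rho.eval (1 - t)) < t := fun t ht ht1 =>
    (mul_le_mul_of_nonneg_right hpp'.le (hl.eval_nonneg (hr.one_sub_eval_nonneg ht.le ht1))).trans_lt
      (hx t ⟨ht, ht1⟩)
  have hanti : Antitone x := by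
    refine antitone_nat_of_succ_le fun i => ?_
    rw [hstep]
    rcases (hx0 i).eq_or_lt with h0 | h0
    · rw [← h0]; simp [hr.eval_one, hl.eval_zero]
    · exact (hlt _ h0 (hx1 i)).le
  have hbdd : BddBelow (Set.range x) := ⟨0, by rintro _ ⟨i, rfl⟩; exact hx0 i⟩
  have hlim := tendsto_atTop_ciInf hanti hbdd
  set L := ⨅ i, x i
  have hL0 : 0 ≤ L := le_ciInf hx0
  have hL1 : L ≤ 1 := (ciInf_le hbdd 0).trans (hx1 0)
  have hcont : Continuous fun t : ℝ => p * lam.eval (1 - rho.eval (1 - t)) :=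
    continuous_const.mul (lam.continuous.comp
      (continuous_const.sub (rho.continuous.comp (continuous_const.sub continuous_id))))
  have h1 : Tendsto (fun i => x (i + 1)) atTop (𝓝 (p * lam.eval (1 - rho.eval (1 - L)))) :=
    (hcont.tendsto L).comp hlim
  have h2 := tendsto_nhds_unique h1 ((tendsto_add_atTop_iff_nat 1).2 hlim)
  rcases hL0.eq_or_lt with h0 | h0
  · rwa [← h0] at hlim
  · exact absurd h2 (hlt L h0 hL1).ne

theorem tendsto_zero_of_affine_recursion {y u κ : ℕ → ℝ} {k : ℝ} (hy : ∀ i, 0 ≤ y i)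
    (hy1 : ∀ i, y i ≤ 1) (hrec : ∀ i, y (i + 1) ≤ u i + κ i * y i)
    (hu : Tendsto u atTop (𝓝 0)) (hκ : Tendsto κ atTop (𝓝 k)) (hk : k < 1) :
    Tendsto y atTop (𝓝 0) := by
  obtain ⟨k', hkk', hk'1⟩ := exists_between (max_lt hk zero_lt_one)
  have hk'0 : 0 < k' := (le_max_right _ _).trans_lt hkk'
  refine Metric.tendsto_atTop.2 fun ε hε => ?_
  have e1 : ∀ᶠ i in atTop, κ i < k' := hκ.eventually (gt_mem_nhds ((le_max_left _ _).trans_lt hkk'))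
  have e2 : ∀ᶠ i in atTop, u i < ε / 2 * (1 - k') :=
    hu.eventually (gt_mem_nhds (mul_pos (half_pos hε) (by linarith)))
  obtain ⟨N, hN⟩ := eventually_atTop.1 (e1.and e2)
  -- `ε / 2` is the fixed point of `t ↦ ε / 2 * (1 - k') + k' * t`, which dominates the recursion
  -- from `N` on.
  have hb : ∀ m, y (N + m) ≤ ε / 2 + k' ^ m := by
    intro m
    induction m with
    | zero => simpa using (hy1 N).trans (by linarith)
    | succ m ih =>
      obtain ⟨h1, h2⟩ := hN (N + m) (by omega)
      have h3 := hrec (N + m)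
      have h4 := mul_le_mul_of_nonneg_right h1.le (hy (N + m))
      have h5 := mul_le_mul_of_nonneg_left ih hk'0.le
      rw [← add_assoc, pow_succ]
      nlinarith
  have hpow := tendsto_pow_atTop_nhds_zero_of_lt_one hk'0.le hk'1
  obtain ⟨M, hM⟩ := eventually_atTop.1 (hpow.eventually (gt_mem_nhds (half_pos hε)))
  refine ⟨N + M, fun i hi => ?_⟩
  obtain ⟨m, rfl⟩ := Nat.exists_eq_add_of_le (show N ≤ i by omega)
  rw [Real.dist_0_eq_abs, abs_of_nonneg (hy _)]
  linarith [hb m, hM m (by omega)]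

/-- Bounding `ρ(1 - x) - ρ(1 - y)` by `ρ'(1) y` makes the recursion affine in `y`; its coefficient
tends to `p λ'(0) ρ'(1) < 1` because `x̃_i → 0`. -/
theorem tendsto_densityEvolution_snd (hl : IsDegreeDist lam) (hr : IsDegreeDist rho)
    (hp : 0 ≤ p) (h : p < lmpThreshold lam rho) :
    Tendsto (fun i => (densityEvolution lam rho p i).2) atTop (𝓝 0) := by
  obtain ⟨p', hpp', hp'1, -⟩ := exists_gt_of_lt_lmpThreshold hp h
  have hp1 : p ≤ 1 := hpp'.le.trans hp'1
  have hmem := densityEvolution_mem hl hr hp hp1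
  have hx := tendsto_densityEvolution_fst hl hr hp h
  have hT : Tendsto (fun i => 1 - rho.eval (1 - (densityEvolution lam rho p i).1)) atTop (𝓝 0) := by
    have hc : Continuous fun t : ℝ => 1 - rho.eval (1 - t) :=
      continuous_const.sub (rho.continuous.comp (continuous_const.sub continuous_id))
    have := (hc.tendsto 0).comp hx
    simpa [hr.eval_one, Function.comp_def] using this
  have hu := (lam.continuous.tendsto 0).comp hT
  rw [hl.eval_zero] at hu
  have hκ := ((((derivative lam).continuous.tendsto 0).comp hT).const_mul p).mul_const
    ((derivative rho).eval 1)
  refine tendsto_zero_of_affine_recursion (fun i => (hmem i).1.trans (hmem i).2.1)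
    (fun i => (hmem i).2.2) (fun i => ?_) hu hκ (mul_derivative_lt_one hl hr hp h)
  obtain ⟨h0, hxy, h1⟩ := hmem i
  have hx' := hr.one_sub_eval_nonneg h0 (hxy.trans h1)
  have hd := hl.derivative_eval_nonneg hx'
  have h2 := hr.one_sub_eval_le h1
  simp only [densityEvolution, Function.comp_apply]
  have h3 := mul_le_mul_of_nonneg_left
    (show rho.eval (1 - (densityEvolution lam rho p i).1) -
      rho.eval (1 - (densityEvolution lam rho p i).2) ≤
      (derivative rho).eval 1 * (densityEvolution lam rho p i).2 by linarith) (mul_nonneg hp hd)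
  linarith

end DensityEvolution

/-! ### Capacity of the `q`-ary symmetric channel -/

section Capacity

variable {F : Type} [Fintype F]

theorem qsc_nonneg {p : ℝ} (hp : 0 ≤ p) (hp1 : p ≤ 1) (hq : 2 ≤ Fintype.card F) (x y : F) :
    0 ≤ qsc p x y := by
  have : (2 : ℝ) ≤ Fintype.card F := by exact_mod_cast hq
  unfold qsc
  split_ifs
  · linarith
  · exact div_nonneg hp (by linarith)

theorem sum_qsc {p : ℝ} (hq : 2 ≤ Fintype.card F) (x : F) : ∑ y, qsc p x y = 1 := by
  classical
  have h2 : (2 : ℝ) ≤ Fintype.card F := by exact_mod_cast hq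
  rw [← Finset.add_sum_erase _ _ (Finset.mem_univ x)]
  have : ∀ y ∈ Finset.univ.erase x, qsc p x y = p / (Fintype.card F - 1) := fun y hy => by
    rw [qsc, if_neg (Finset.ne_of_mem_erase hy).symm]
  rw [Finset.sum_congr rfl this, Finset.sum_const, Finset.card_erase_of_mem (Finset.mem_univ x),
    Finset.card_univ, nsmul_eq_mul, Nat.cast_sub (by omega), qsc, if_pos rfl]
  have : (Fintype.card F : ℝ) - 1 ≠ 0 := by linarith
  push_cast
  field_simp
  ring

/-- A term of the mutual information is at most the corresponding term with a uniform output, up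
to a first-order correction (Gibbs' inequality). -/
theorem mul_log_div_le_gibbs {a w s c : ℝ} (ha : 0 ≤ a) (hw : 0 ≤ w) (hs : a * w ≤ s) (hc : 0 < c) :
    a * w * Real.log (w / s) ≤ a * w * Real.log (w * c) + a * w * (1 / (s * c) - 1) := by
  rcases (mul_nonneg ha hw).eq_or_lt with h | h
  · simp [← h]
  · have hw' : 0 < w := lt_of_le_of_ne hw fun h0 => by simp [← h0] at h
    have hs' : 0 < s := h.trans_le hs
    rw [← mul_add]
    refine mul_le_mul_of_nonneg_left ?_ h.le
    have := Real.log_le_sub_one_of_pos (show 0 < 1 / (s * c) by positivity)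
    have e : Real.log (w / s) = Real.log (w * c) + Real.log (1 / (s * c)) := by
      rw [← Real.log_mul (by positivity) (by positivity)]
      congr 1
      field_simp
    linarith

/-- For every input distribution the mutual information is at most the divergence of the channel
from the uniform output, by Gibbs' inequality. Only an upper bound on capacity is needed. -/
theorem qscCapacity_le {p : ℝ} (hp : 0 ≤ p) (hp1 : p ≤ 1) (hq : 2 ≤ Fintype.card F) :
    qscCapacity F p ≤ 1 - p + Real.log 2 / Real.log (Fintype.card F) := by
  classical
  set q : ℝ := (Fintype.card F : ℝ) with hqdef
  have h2 : (2 : ℝ) ≤ q := by rw [hqdef]; exact_mod_cast hq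
  have hlogq : 0 < Real.log q := Real.log_pos (by linarith)
  have : Nonempty F := Fintype.card_pos_iff.1 (by omega)
  refine csSup_le ?_ ?_
  · refine ⟨_, fun _ => 1 / q, fun _ => by positivity, ?_, rfl⟩
    simp [← hqdef]
  rintro I ⟨P, hP, hP1, rfl⟩
  set w : F → F → ℝ := qsc p with hw
  have hw0 : ∀ x y, 0 ≤ w x y := qsc_nonneg hp hp1 hq
  set Q : F → ℝ := fun y => ∑ x', P x' * w x' y with hQ
  have hQ0 : ∀ y, 0 ≤ Q y := fun y => Finset.sum_nonneg fun x _ => mul_nonneg (hP x) (hw0 x y)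
  have hPQ : ∀ x y, P x * w x y ≤ Q y := fun x y =>
    Finset.single_le_sum (f := fun x => P x * w x y) (fun x _ => mul_nonneg (hP x) (hw0 x y))
      (Finset.mem_univ x)
  have hterm : ∀ x y, P x * w x y * Real.logb q (w x y / Q y) ≤
      (P x * (w x y * Real.log (w x y * q)) + P x * w x y * (1 / (Q y * q) - 1)) / Real.log q := by
    intro x y
    rw [Real.logb, mul_div_assoc', ← mul_assoc]
    exact div_le_div_of_nonneg_right
      (mul_log_div_le_gibbs (hP x) (hw0 x y) (hPQ x y) (by linarith)) hlogq.le
  -- The diagonal term is at most `(1 - p) log q`. The off-diagonal arguments are `p q / (q - 1) ≤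
  -- 2` as `q ≥ 2`, and these terms add up to at most `log 2`.
  have hrow : ∀ x, ∑ y, w x y * Real.log (w x y * q) ≤ (1 - p) * Real.log q + Real.log 2 := by
    intro x
    rw [← Finset.add_sum_erase _ _ (Finset.mem_univ x)]
    have e1 : ∀ y ∈ Finset.univ.erase x, w x y * Real.log (w x y * q) ≤
        p / (q - 1) * Real.log 2 := fun y hy => by
      have hval : w x y = p / (q - 1) := by
        rw [hw, qsc, if_neg (Finset.ne_of_mem_erase hy).symm]
      have hpq : 0 ≤ p / (q - 1) := div_nonneg hp (by linarith)
      rw [hval]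
      refine mul_le_mul_of_nonneg_left ?_ hpq
      rcases hp.eq_or_lt with h0 | h0
      · simp [← h0]; positivity
      · refine Real.log_le_log (by have : 0 < q - 1 := by linarith
                                   positivity) ?_
        rw [div_mul_eq_mul_div, div_le_iff₀ (by linarith)]
        nlinarith
    have e2 : w x x = 1 - p := by rw [hw, qsc, if_pos rfl]
    have e3 := Finset.sum_le_sum e1
    rw [Finset.sum_const, Finset.card_erase_of_mem (Finset.mem_univ x),
      Finset.card_univ, nsmul_eq_mul, Nat.cast_sub (by omega), ← hqdef] at e3
    have e4 : (q - (1 : ℕ)) * (p / (q - 1) * Real.log 2) = p * Real.log 2 := by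
      have : q - 1 ≠ 0 := by linarith
      push_cast; field_simp
    have e5 : (1 - p) * Real.log ((1 - p) * q) ≤ (1 - p) * Real.log q := by
      rcases (sub_nonneg.2 hp1).eq_or_lt with h0 | h0
      · simp [← h0]
      · exact mul_le_mul_of_nonneg_left (Real.log_le_log (by positivity) (by nlinarith)) h0.le
    have e6 : p * Real.log 2 ≤ Real.log 2 :=
      mul_le_of_le_one_left (Real.log_nonneg one_le_two) hp1
    rw [e2]
    linarith
  -- Summed over `x` the correction is `1 / q - Q y`, or `0` if `Q y = 0`; the differences `1 / q -
  -- Q y` sum to `0`.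
  have hcorr : ∑ x, ∑ y, P x * w x y * (1 / (Q y * q) - 1) ≤ 0 := by
    rw [Finset.sum_comm]
    have e1 : ∀ y, ∑ x, P x * w x y * (1 / (Q y * q) - 1) ≤ 1 / q - Q y := fun y => by
      rw [← Finset.sum_mul]
      change Q y * _ ≤ _
      rcases (hQ0 y).eq_or_lt with h0 | h0
      · simp [← h0]; linarith
      · exact le_of_eq (by field_simp)
    have e2 : ∑ y, Q y = 1 := by
      rw [hQ, Finset.sum_comm]
      simp only [← Finset.mul_sum]
      rw [hw]
      simp only [sum_qsc hq, mul_one, hP1]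
    refine (Finset.sum_le_sum fun y _ => e1 y).trans ?_
    rw [Finset.sum_sub_distrib, e2, Finset.sum_const, Finset.card_univ, nsmul_eq_mul, ← hqdef]
    exact le_of_eq (by field_simp; ring)
  calc ∑ x, ∑ y, P x * w x y * Real.logb q (w x y / Q y)
      ≤ ∑ x, ∑ y, (P x * (w x y * Real.log (w x y * q)) +
          P x * w x y * (1 / (Q y * q) - 1)) / Real.log q :=
        Finset.sum_le_sum fun x _ => Finset.sum_le_sum fun y _ => hterm x y
    _ = (∑ x, P x * (∑ y, w x y * Real.log (w x y * q)) +
          ∑ x, ∑ y, P x * w x y * (1 / (Q y * q) - 1)) / Real.log q := by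
        simp only [Finset.mul_sum, ← Finset.sum_add_distrib, Finset.sum_div]
    _ ≤ (∑ x, P x * ((1 - p) * Real.log q + Real.log 2) + 0) / Real.log q := by
        refine div_le_div_of_nonneg_right (add_le_add ?_ hcorr) hlogq.le
        exact Finset.sum_le_sum fun x _ => mul_le_mul_of_nonneg_left (hrow x) (hP x)
    _ = 1 - p + Real.log 2 / Real.log q := by
        rw [← Finset.sum_mul, hP1]
        field_simp
        ring

end Capacity

/-! ### Adaptive exploration of a uniformly random matching -/

/-- An adaptive exploration of a matching of half-edges: ask for the partner of a half-edge and
continue depending on the answer. -/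
inductive Query (H : Type) (α : Type) where
  | pure (a : α) : Query H α
  | ask (x : H) (k : H → Query H α) : Query H α

namespace Query

variable {H α β : Type}

/-- Sequential composition. -/
def bind (t : Query H α) (f : α → Query H β) : Query H β :=
  match t with
  | .pure a => f a
  | .ask x k => .ask x fun y => (k y).bind f

/-- The result of an exploration of the matching `o`. -/
def run (o : H → H) : Query H α → α
  | .pure a => a
  | .ask x k => (k (o x)).run o

/-- The half-edges that are asked for in an exploration of `o`. -/
def asked (o : H → H) : Query H α → List H
  | .pure _ => []
  | .ask x k => x :: (k (o x)).asked o

/-- The answers in an exploration of `o`. -/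
def answers (o : H → H) : Query H α → List H
  | .pure _ => []
  | .ask x k => o x :: (k (o x)).answers o

/-- At most `K` questions are asked. -/
def DepthLE : ℕ → Query H α → Prop
  | _, .pure _ => True
  | 0, .ask _ _ => False
  | K + 1, .ask _ k => ∀ y, (k y).DepthLE K

/-- The half-edge `x` is never asked for. -/
def Avoids (x : H) : Query H α → Prop
  | .pure _ => True
  | .ask z k => z ≠ x ∧ ∀ y, (k y).Avoids x

/-- No half-edge is asked for whose partner is known already. -/
def Fresh : Query H α → Prop
  | .pure _ => True
  | .ask x k => ∀ y, (k y).Avoids x ∧ (k y).Avoids y ∧ (k y).Fresh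

theorem run_bind (o : H → H) (t : Query H α) (f : α → Query H β) :
    (t.bind f).run o = (f (t.run o)).run o := by
  induction t with
  | pure a => rfl
  | ask x k ih => exact ih (o x)

theorem answers_bind (o : H → H) (t : Query H α) (f : α → Query H β) :
    (t.bind f).answers o = t.answers o ++ (f (t.run o)).answers o := by
  induction t with
  | pure a => rfl
  | ask x k ih => simp only [bind, answers, run, ih, List.cons_append]

theorem DepthLE.mono {K L : ℕ} {t : Query H α} (h : t.DepthLE K) (hKL : K ≤ L) : t.DepthLE L := by
  induction t generalizing K L with
  | pure a => cases L <;> trivial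
  | ask x k ih =>
    cases K with
    | zero => exact h.elim
    | succ K =>
      cases L with
      | zero => omega
      | succ L => exact fun y => ih y (h y) (by omega)

theorem DepthLE.bind {K L : ℕ} {t : Query H α} {f : α → Query H β} (h : t.DepthLE K)
    (hf : ∀ a, (f a).DepthLE L) : (t.bind f).DepthLE (K + L) := by
  induction t generalizing K with
  | pure a => exact (hf a).mono (by omega)
  | ask x k ih =>
    cases K with
    | zero => exact h.elim
    | succ K =>
      rw [show K + 1 + L = (K + L) + 1 by omega]
      exact fun y => ih y (h y)

theorem length_asked {K : ℕ} {t : Query H α} (h : t.DepthLE K) (o : H → H) :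
    (t.asked o).length ≤ K := by
  induction t generalizing K with
  | pure a => simp [asked]
  | ask x k ih =>
    cases K with
    | zero => exact h.elim
    | succ K => simpa [asked] using ih (o x) (h (o x))

theorem Avoids.notMem_asked {x : H} {t : Query H α} (h : t.Avoids x) (o : H → H) :
    x ∉ t.asked o := by
  induction t with
  | pure a => simp [asked]
  | ask z k ih =>
    simp only [asked, List.mem_cons, not_or]
    exact ⟨h.1.symm, ih _ (h.2 _)⟩

theorem run_congr {o o' : H → H} {t : Query H α} (h : ∀ x ∈ t.asked o, o' x = o x) :
    t.run o' = t.run o := by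
  induction t with
  | pure a => rfl
  | ask x k ih =>
    simp only [asked, List.mem_cons, forall_eq_or_imp] at h
    simp only [run, h.1]
    exact ih _ h.2

/-- Explore with `f` along a list and collect the results. -/
def mapList {ι : Type} (f : ι → Query H α) : List ι → Query H (List α)
  | [] => .pure []
  | i :: l => (f i).bind fun a => (mapList f l).bind fun as => .pure (a :: as)

theorem run_mapList {ι : Type} (o : H → H) (f : ι → Query H α) (l : List ι) :
    (mapList f l).run o = l.map fun i => (f i).run o := by
  induction l with
  | nil => rfl
  | cons i l ih => simp [mapList, run_bind, ih, run]

theorem answers_mapList {ι : Type} (o : H → H) (f : ι → Query H α) (l : List ι) :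
    (mapList f l).answers o = l.flatMap fun i => (f i).answers o := by
  induction l with
  | nil => rfl
  | cons i l ih => simp [mapList, answers_bind, ih, answers]

theorem DepthLE.mapList {ι : Type} {f : ι → Query H α} {K : ℕ} (h : ∀ i, (f i).DepthLE K)
    (l : List ι) : (Query.mapList f l).DepthLE (l.length * K) := by
  induction l with
  | nil => simp [Query.mapList, DepthLE]
  | cons i l ih =>
    rw [List.length_cons, Nat.succ_mul, add_comm]
    refine (h i).bind fun a => ?_
    rw [← Nat.add_zero (l.length * K)]
    exact ih.bind fun _ => trivial

end Query

/-! ### Uniformly random matchings and the exchange of partners -/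

section Matching

variable {S R : Type} [Fintype S] [Fintype R] [DecidableEq S] [DecidableEq R]

/-- The partner of a half-edge in a matching. -/
def partner (g : S ≃ R) : S ⊕ R → S ⊕ R :=
  Sum.elim (fun s => .inr (g s)) fun r => .inl (g.symm r)

theorem partner_partner (g : S ≃ R) (x : S ⊕ R) : partner g (partner g x) = x := by
  cases x <;> simp [partner]

/-- The matching `g` with the partners of the half-edges `x` and `x'` (on the same side)
exchanged. -/
def exchange (x x' : S ⊕ R) (g : S ≃ R) : S ≃ R :=
  match x, x' with
  | .inl s, .inl s' => (Equiv.swap s s').trans g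
  | .inr r, .inr r' => g.trans (Equiv.swap r r')
  | _, _ => g

theorem exchange_exchange (x x' : S ⊕ R) (g : S ≃ R) : exchange x x' (exchange x x' g) = g := by
  rcases x with s | r <;> rcases x' with s' | r' <;> ext <;> simp [exchange]

/-- The half-edges on the side of `x`. -/
def side (x : S ⊕ R) : Finset (S ⊕ R) :=
  match x with
  | .inl _ => Finset.univ.map Function.Embedding.inl
  | .inr _ => Finset.univ.map Function.Embedding.inr

/-- The half-edges on the side opposite to `x`. -/
def opposite (x : S ⊕ R) : Finset (S ⊕ R) :=
  match x with
  | .inl _ => Finset.univ.map Function.Embedding.inr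
  | .inr _ => Finset.univ.map Function.Embedding.inl

/-- Exchanging partners is conjugation by a transposition of half-edges. This treats both sides at
once and shows which partners are untouched. -/
theorem partner_exchange {x x' : S ⊕ R} (h : x' ∈ side x) (g : S ≃ R) (z : S ⊕ R) :
    partner (exchange x x' g) z = Equiv.swap x x' (partner g (Equiv.swap x x' z)) := by
  have e1 : ∀ a b c : S, Equiv.swap (Sum.inl (β := R) a) (.inl b) (.inl c) =
      .inl (Equiv.swap a b c) := fun a b c => by
    simp only [Equiv.swap_apply_def, Sum.inl.injEq]; split_ifs <;> rfl
  have e2 : ∀ a b c : R, Equiv.swap (Sum.inr (α := S) a) (.inr b) (.inr c) =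
      .inr (Equiv.swap a b c) := fun a b c => by
    simp only [Equiv.swap_apply_def, Sum.inr.injEq]; split_ifs <;> rfl
  have e3 : ∀ (a b : S) (c : R), Equiv.swap (Sum.inl a) (.inl b) (.inr c) = .inr c :=
    fun a b c => Equiv.swap_apply_of_ne_of_ne (by simp) (by simp)
  have e4 : ∀ (a b : R) (c : S), Equiv.swap (Sum.inr a) (.inr b) (.inl c) = .inl c :=
    fun a b c => Equiv.swap_apply_of_ne_of_ne (by simp) (by simp)
  rcases x with s | r <;> rcases x' with s' | r' <;> simp [side] at h <;>
    rcases z with z | z <;> simp [exchange, partner, e1, e2, e3, e4]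

theorem partner_mem_opposite {x z : S ⊕ R} (g : S ≃ R) (h : z ∈ side x) :
    partner g z ∈ opposite x := by
  rcases x with s | r <;> rcases z with z | z <;> simp_all [side, opposite, partner]

theorem partner_mem_side {x z : S ⊕ R} (g : S ≃ R) (h : z ∈ opposite x) :
    partner g z ∈ side x := by
  rcases x with s | r <;> rcases z with z | z <;> simp_all [side, opposite, partner]

theorem sum_side_partner (g : S ≃ R) (x : S ⊕ R) (f : S ⊕ R → ℝ) :
    ∑ z ∈ side x, f (partner g z) = ∑ y ∈ opposite x, f y :=
  Finset.sum_bij' (fun z _ => partner g z) (fun z _ => partner g z)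
    (fun _ h => partner_mem_opposite g h) (fun _ h => partner_mem_side g h)
    (fun _ _ => partner_partner g _) (fun _ _ => partner_partner g _) fun _ _ => rfl

theorem card_side (g : S ≃ R) (x : S ⊕ R) : (side x).card = Fintype.card S := by
  rcases x with s | r
  · simp [side]
  · simp [side, Fintype.card_congr g]

theorem card_opposite (g : S ≃ R) (x : S ⊕ R) : (opposite x).card = Fintype.card S := by
  rcases x with s | r
  · simp [opposite, Fintype.card_congr g]
  · simp [opposite]

/-- Mean over the matchings. -/
noncomputable def matchingMean (f : (S ≃ R) → ℝ) : ℝ := (∑ g, f g) / Fintype.card (S ≃ R)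

theorem matchingMean_mono {f f' : (S ≃ R) → ℝ} (h : ∀ g, f g ≤ f' g) :
    matchingMean f ≤ matchingMean f' :=
  div_le_div_of_nonneg_right (Finset.sum_le_sum fun g _ => h g) (Nat.cast_nonneg _)

theorem matchingMean_add (f f' : (S ≃ R) → ℝ) :
    matchingMean (fun g => f g + f' g) = matchingMean f + matchingMean f' := by
  simp [matchingMean, Finset.sum_add_distrib, add_div]

theorem matchingMean_const_mul (c : ℝ) (f : (S ≃ R) → ℝ) :
    matchingMean (fun g => c * f g) = c * matchingMean f := by
  simp [matchingMean, ← Finset.mul_sum, mul_div_assoc]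

theorem matchingMean_sum {ι : Type} (I : Finset ι) (f : ι → (S ≃ R) → ℝ) :
    matchingMean (fun g => ∑ i ∈ I, f i g) = ∑ i ∈ I, matchingMean (f i) := by
  simp only [matchingMean, ← Finset.sum_div]
  rw [Finset.sum_comm]

theorem matchingMean_const (g : S ≃ R) (c : ℝ) :
    matchingMean (fun _ : S ≃ R => c) = c := by
  have : Nonempty (S ≃ R) := ⟨g⟩
  simp [matchingMean]

theorem matchingMean_exchange (x x' : S ⊕ R) (f : (S ≃ R) → ℝ) :
    matchingMean (fun g => f (exchange x x' g)) = matchingMean f := by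
  simp only [matchingMean]
  congr 1
  exact Fintype.sum_equiv ⟨exchange x x', exchange x x', exchange_exchange x x',
    exchange_exchange x x'⟩ _ _ fun _ => rfl

/-! ### Explorations with independent uniform answers -/

namespace Query

variable {α β : Type}

/-- Mean of `f` over the results if the answers are independent and uniform. -/
noncomputable def mean (f : α → ℝ) : Query (S ⊕ R) α → ℝ
  | .pure a => f a
  | .ask x k => (∑ y ∈ opposite x, (k y).mean f) / (opposite x).card

theorem mean_bind (f : β → ℝ) (t : Query (S ⊕ R) α) (k : α → Query (S ⊕ R) β) :
    (t.bind k).mean f = t.mean fun a => (k a).mean f := by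
  induction t with
  | pure a => rfl
  | ask x l ih => simp only [bind, mean, ih]

theorem mean_add (f f' : α → ℝ) (t : Query (S ⊕ R) α) :
    t.mean (fun a => f a + f' a) = t.mean f + t.mean f' := by
  induction t with
  | pure a => rfl
  | ask x l ih => simp only [mean, ih, Finset.sum_add_distrib, add_div]

theorem mean_const_mul (c : ℝ) (f : α → ℝ) (t : Query (S ⊕ R) α) :
    t.mean (fun a => c * f a) = c * t.mean f := by
  induction t with
  | pure a => rfl
  | ask x l ih => simp only [mean, ih, ← Finset.mul_sum, mul_div_assoc]

theorem mean_mul_const (c : ℝ) (f : α → ℝ) (t : Query (S ⊕ R) α) :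
    t.mean (fun a => f a * c) = t.mean f * c := by
  simp only [mul_comm _ c, mean_const_mul]

theorem mean_sub (f f' : α → ℝ) (t : Query (S ⊕ R) α) :
    t.mean (fun a => f a - f' a) = t.mean f - t.mean f' := by
  have := mean_add f (fun a => -1 * f' a) t
  rw [mean_const_mul] at this
  simpa [sub_eq_add_neg] using this

theorem mean_mono {f f' : α → ℝ} (h : ∀ a, f a ≤ f' a) (t : Query (S ⊕ R) α) :
    t.mean f ≤ t.mean f' := by
  induction t with
  | pure a => exact h a
  | ask x l ih =>
    exact div_le_div_of_nonneg_right (Finset.sum_le_sum fun y _ => ih y) (Nat.cast_nonneg _)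

theorem mean_const (g : S ≃ R) (c : ℝ) (t : Query (S ⊕ R) α) : t.mean (fun _ => c) = c := by
  induction t with
  | pure a => rfl
  | ask x l ih =>
    simp only [mean, ih, Finset.sum_const, nsmul_eq_mul]
    have : (opposite x).Nonempty := by
      refine ⟨partner g x, partner_mem_opposite g ?_⟩
      rcases x with s | r <;> simp [side]
    have h0 : ((opposite x).card : ℝ) ≠ 0 := by exact_mod_cast this.card_pos.ne'
    field_simp

/-- An exploration that never uses known half-edges sees almost independent uniform answers. -/
theorem abs_matchingMean_run_sub_mean_le (g₀ : S ≃ R) {f : α → ℝ} (hf : ∀ a, 0 ≤ f a ∧ f a ≤ 1)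
    {K : ℕ} {t : Query (S ⊕ R) α} (ht : t.Fresh) (hK : t.DepthLE K) :
    |matchingMean (fun g => f (t.run (partner g))) - t.mean f| ≤
      K * (2 * K) / Fintype.card S := by
  -- The remaining depth `L` decreases along the induction, while the cost `2 * K` of a single
  -- question stays fixed.
  suffices h : ∀ L : ℕ, L ≤ K → ∀ t : Query (S ⊕ R) α, t.Fresh → t.DepthLE L →
      |matchingMean (fun g => f (t.run (partner g))) - t.mean f| ≤
        L * (2 * K) / Fintype.card S from h K le_rfl t ht hK
  intro L hL t
  induction t generalizing L with
  | pure a =>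
    intro _ _
    simp only [run, mean, matchingMean_const g₀, sub_self, abs_zero]
    positivity
  | ask x k ih =>
    intro ht hd
    cases L with
    | zero => exact hd.elim
    | succ L =>
      set N : ℝ := (Fintype.card S : ℝ) with hN
      have hside : x ∈ side x := by rcases x with s | r <;> simp [side]
      have hcard : ((side x).card : ℝ) = N := by rw [card_side g₀ x]
      have hNpos : 0 < N := by
        rw [← hcard]; exact_mod_cast Finset.card_pos.2 ⟨x, hside⟩
      -- compare with the exchanged matchings
      have hloc : ∀ g : S ≃ R, |∑ x' ∈ side x, (f ((k (partner g x)).run (partner g)) -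
          f ((k (partner g x)).run (partner (exchange x x' g))))| ≤ 2 * K := by
        intro g
        set t' := k (partner g x)
        set A := (t'.asked (partner g)).toFinset
        -- The later run changes only if `x'` is asked for or is the partner of such a half-edge: by
        -- freshness the run asks neither for `x` nor for its partner. This leaves at most `2 * K`
        -- bad `x'`.
        have hbad : ∀ x' ∈ side x, x' ∉ A ∪ A.image (partner g) →
            f (t'.run (partner g)) - f (t'.run (partner (exchange x x' g))) = 0 := by
          intro x' hx' hA
          rw [sub_eq_zero]
          congr 1
          refine (run_congr fun z hz => ?_).symm
          rw [partner_exchange hx']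
          simp only [Finset.mem_union, Finset.mem_image, not_or, not_exists, not_and] at hA
          have hzA : z ∈ A := List.mem_toFinset.2 hz
          have h1 : z ≠ x := fun h => by
            rw [h] at hz
            exact (ht _).1.notMem_asked _ hz
          have h2 : z ≠ x' := fun h => hA.1 (h ▸ hzA)
          have h3 : partner g z ≠ x := fun h => ((ht (partner g x)).2.1.notMem_asked (partner g))
            (by
              rw [← partner_partner g z, h] at hz; exact hz)
          have h4 : partner g z ≠ x' := fun h => hA.2 z hzA h
          rw [Equiv.swap_apply_of_ne_of_ne h1 h2, Equiv.swap_apply_of_ne_of_ne h3 h4]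
        have hsplit : ∑ x' ∈ side x, (f (t'.run (partner g)) -
            f (t'.run (partner (exchange x x' g)))) =
            ∑ x' ∈ (side x).filter (· ∈ A ∪ A.image (partner g)), (f (t'.run (partner g)) -
              f (t'.run (partner (exchange x x' g)))) := by
          rw [Finset.sum_filter]
          exact Finset.sum_congr rfl fun x' hx' => by
            split_ifs with h
            · rfl
            · exact hbad x' hx' h
        rw [hsplit]
        refine (Finset.abs_sum_le_sum_abs _ _).trans ?_
        have hone : ∀ a b : α, |f a - f b| ≤ 1 := fun a b => by
          rw [abs_le]; constructor <;> linarith [hf a, hf b]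
        refine (Finset.sum_le_sum fun x' _ => hone _ _).trans ?_
        rw [Finset.sum_const, nsmul_eq_mul, mul_one]
        have hA : A.card ≤ K :=
          (List.toFinset_card_le _).trans ((length_asked (hd _) _).trans (by omega))
        have : ((side x).filter (· ∈ A ∪ A.image (partner g))).card ≤ 2 * K :=
          calc _ ≤ (A ∪ A.image (partner g)).card :=
                Finset.card_le_card fun z hz => (Finset.mem_filter.1 hz).2
            _ ≤ A.card + (A.image (partner g)).card := Finset.card_union_le _ _
            _ ≤ A.card + A.card := Nat.add_le_add_left Finset.card_image_le _
            _ ≤ 2 * K := by omega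
        exact_mod_cast this
      -- In the exchanged matching, the former partner of `x` is the partner of `x'`. As exchanging
      -- preserves the uniform measure and `x'` runs over its whole side, that partner runs over all
      -- opposite half-edges, independently of the matching used in the rest of the run.
      have hreindex : matchingMean (fun g : S ≃ R => ∑ x' ∈ side x,
          f ((k (partner g x)).run (partner (exchange x x' g)))) =
          ∑ y ∈ opposite x, matchingMean fun g => f ((k y).run (partner g)) := by
        rw [← matchingMean_sum (opposite x)]
        have e1 : ∀ g : S ≃ R, ∑ y ∈ opposite x, f ((k y).run (partner g)) =
            ∑ x' ∈ side x, f ((k (partner g x')).run (partner g)) := fun g =>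
          (sum_side_partner g x fun y => f ((k y).run (partner g))).symm
        simp only [e1]
        rw [matchingMean_sum, matchingMean_sum]
        refine Finset.sum_congr rfl fun x' hx' => ?_
        rw [← matchingMean_exchange x x' fun g => f ((k (partner g x')).run (partner g))]
        congr 1
        ext g
        rcases eq_or_ne (partner g x) x' with h | h
        · exfalso
          have := partner_mem_opposite g hside
          rw [h] at this
          rcases x with s | r <;> rcases x' with s' | r' <;> simp [side, opposite] at this hx'
        · have h' : partner g x ≠ x := fun h0 => by
            rcases x with s | r <;> simp [partner] at h0
          rw [partner_exchange hx' g x', Equiv.swap_apply_right,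
            Equiv.swap_apply_of_ne_of_ne h' h]
      have hdecomp : N * matchingMean (fun g => f ((k (partner g x)).run (partner g))) =
          matchingMean (fun g => ∑ x' ∈ side x, (f ((k (partner g x)).run (partner g)) -
            f ((k (partner g x)).run (partner (exchange x x' g))))) +
          ∑ y ∈ opposite x, matchingMean fun g => f ((k y).run (partner g)) := by
        rw [← hreindex, ← matchingMean_add, ← matchingMean_const_mul]
        congr 1
        ext g
        rw [← Finset.sum_add_distrib]
        simp [hcard]
      set M := matchingMean (fun g => ∑ x' ∈ side x, (f ((k (partner g x)).run (partner g)) -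
            f ((k (partner g x)).run (partner (exchange x x' g))))) with hM
      have hMb : |M| ≤ 2 * K := by
        rw [abs_le]
        constructor
        · rw [← matchingMean_const g₀ (-(2 * K : ℝ))]
          exact matchingMean_mono fun g => (abs_le.1 (hloc g)).1
        · rw [← matchingMean_const g₀ (2 * K : ℝ)]
          exact matchingMean_mono fun g => (abs_le.1 (hloc g)).2
      have hih : |∑ y ∈ opposite x, matchingMean (fun g => f ((k y).run (partner g))) -
          ∑ y ∈ opposite x, (k y).mean f| ≤ L * (2 * K) := by
        rw [← Finset.sum_sub_distrib]
        refine (Finset.abs_sum_le_sum_abs _ _).trans ?_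
        refine (Finset.sum_le_sum fun y _ => ih y L (by omega) (ht y).2.2 (hd y)).trans ?_
        rw [Finset.sum_const, card_opposite g₀, nsmul_eq_mul, ← hN]
        exact le_of_eq (by field_simp)
      simp only [run, mean]
      rw [card_opposite g₀, ← hN, le_div_iff₀ hNpos, ← abs_of_pos hNpos, ← abs_mul, abs_of_pos hNpos,
        sub_mul, mul_comm _ N, hdecomp, div_mul_cancel₀ _ hNpos.ne', add_sub_assoc]
      refine (abs_add_le _ _).trans ((add_le_add hMb hih).trans (le_of_eq ?_))
      push_cast
      ring

end Query

end Matching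

/-! ### Explorations that stop at nodes seen before -/

namespace Query

section Watch

variable {H W α β : Type} [DecidableEq H] [DecidableEq W] (node : H → W)

/-- The exploration `t` that fails when it asks for a known half-edge in `A` or when an answer lies
at a node in `T`. Both sets are updated along the way. -/
def watch (A : Finset H) (T : Finset W) : Query H α → Query H (Option α)
  | .pure a => .pure (some a)
  | .ask x k => if x ∈ A then .pure none else
      .ask x fun y => if node y ∈ T then .pure none else
        watch (insert x (insert y A)) (insert (node y) T) (k y)

/-- No known half-edge is asked for as long as all answers lie at new nodes, and the result and the
final sets of known half-edges and nodes then satisfy `Q`. -/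
def Safe (Q : α → Finset H → Finset W → Prop) (A : Finset H) (T : Finset W) :
    Query H α → Prop
  | .pure a => Q a A T
  | .ask x k => x ∉ A ∧ ∀ y, node y ∉ T →
      Safe Q (insert x (insert y A)) (insert (node y) T) (k y)

variable {node}

theorem Safe.mono {Q Q' : α → Finset H → Finset W → Prop} (h : ∀ a A T, Q a A T → Q' a A T)
    {t : Query H α} {A : Finset H} {T : Finset W} (ht : t.Safe node Q A T) :
    t.Safe node Q' A T := by
  induction t generalizing A T with
  | pure a => exact h _ _ _ ht
  | ask x k ih => exact ⟨ht.1, fun y hy => ih y (ht.2 y hy)⟩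

/-- `Safe` acts as a postcondition on the result and the known sets, so that safety of a composite
exploration follows piece by piece. -/
theorem Safe.bind {Q : β → Finset H → Finset W → Prop} {t : Query H α} {f : α → Query H β}
    {A : Finset H} {T : Finset W}
    (ht : t.Safe node (fun a A' T' => (f a).Safe node Q A' T') A T) :
    (t.bind f).Safe node Q A T := by
  induction t generalizing A T with
  | pure a => exact ht
  | ask x k ih => exact ⟨ht.1, fun y hy => ih y (ht.2 y hy)⟩

theorem watch_avoids {z : H} {A : Finset H} {T : Finset W} (hz : z ∈ A) (t : Query H α) :
    (t.watch node A T).Avoids z := by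
  induction t generalizing A T with
  | pure a => trivial
  | ask x k ih =>
    rw [watch]
    split_ifs with h
    · trivial
    · refine ⟨fun h' => h (h' ▸ hz), fun y => ?_⟩
      dsimp only
      split_ifs
      · trivial
      · exact ih y (by simp [hz])

/-- Both the question and its answer enter the set `A`, and asking for an element of `A` stops the
exploration. -/
theorem watch_fresh (A : Finset H) (T : Finset W) (t : Query H α) :
    (t.watch node A T).Fresh := by
  induction t generalizing A T with
  | pure a => trivial
  | ask x k ih =>
    rw [watch]
    split_ifs with h
    · trivial
    · intro y
      dsimp only
      split_ifs
      · exact ⟨trivial, trivial, trivial⟩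
      · exact ⟨watch_avoids (by simp) _, watch_avoids (by simp) _, ih y _ _⟩

theorem watch_depthLE {K : ℕ} {t : Query H α} (h : t.DepthLE K) (A : Finset H) (T : Finset W) :
    (t.watch node A T).DepthLE K := by
  induction t generalizing A T K with
  | pure a => cases K <;> trivial
  | ask x k ih =>
    cases K with
    | zero => exact h.elim
    | succ K =>
      rw [watch]
      split_ifs
      · trivial
      · intro y
        dsimp only
        split_ifs
        · cases K <;> trivial
        · exact ih y (h y) _ _

/-- An exploration that is not stopped is faithful, and it certifies that the visited nodes are
distinct and outside `T`. The second part is how tree neighborhoods are recognized. -/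
theorem run_watch (o : H → H) (A : Finset H) (T : Finset W) (t : Query H α) :
    (t.watch node A T).run o = none ∨ ((t.watch node A T).run o = some (t.run o) ∧
      ((t.answers o).map node).Nodup ∧ ∀ y ∈ t.answers o, node y ∉ T) := by
  induction t generalizing A T with
  | pure a => simp [watch, run, answers]
  | ask x k ih =>
    rw [watch]
    split_ifs with h
    · exact Or.inl rfl
    · simp only [run, answers]
      split_ifs with h'
      · exact Or.inl rfl
      · rcases ih (o x) (insert x (insert (o x) A)) (insert (node (o x)) T) with h1 | ⟨h1, h2, h3⟩
        · exact Or.inl h1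
        · refine Or.inr ⟨h1, ?_, ?_⟩
          · rw [List.map_cons, List.nodup_cons]
            refine ⟨fun hm => ?_, h2⟩
            obtain ⟨y, hy, hxy⟩ := List.mem_map.1 hm
            exact h3 y hy (by simp [hxy])
          · intro y hy
            rcases List.mem_cons.1 hy with rfl | hy
            · exact h'
            · exact fun hT => h3 y hy (Finset.mem_insert_of_mem hT)

end Watch

/-! ### Comparison of random matchings with independent answers -/

section Compare

variable {S R W α : Type} [Fintype S] [Fintype R] [DecidableEq S] [DecidableEq R] [DecidableEq W]
  {node : S ⊕ R → W} {d : ℕ}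

theorem sum_watch_step_le (hd : ∀ w, (Finset.univ.filter fun x => node x = w).card ≤ d)
    {x : S ⊕ R} {T : Finset W} {F F' : S ⊕ R → ℝ} {c : ℝ} (hc : 0 ≤ c)
    (h1 : ∀ y, node y ∈ T → F y ≤ F' y + 1) (h2 : ∀ y, node y ∉ T → F y ≤ F' y + c) :
    ∑ y ∈ opposite x, F y ≤ ∑ y ∈ opposite x, F' y + (T.card * d + (opposite x).card * c) := by
  have hstep : ∀ y ∈ opposite x, F y ≤ F' y + ((if node y ∈ T then (1 : ℝ) else 0) + c) := by
    intro y _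
    split_ifs with h
    · linarith [h1 y h]
    · linarith [h2 y h]
  refine (Finset.sum_le_sum hstep).trans ?_
  rw [Finset.sum_add_distrib, Finset.sum_add_distrib, Finset.sum_const, nsmul_eq_mul,
    ← Finset.sum_filter, Finset.sum_const, nsmul_eq_mul, mul_one]
  have : ((opposite x).filter fun y => node y ∈ T).card ≤ T.card * d := by
    rw [mul_comm]
    refine Finset.card_le_mul_card_image_of_maps_to (f := node) (t := T)
      (fun y hy => (Finset.mem_filter.1 hy).2) d (fun w _ => ?_)
    refine (Finset.card_le_card fun y hy => ?_).trans (hd w)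
    simp only [Finset.mem_filter] at hy
    simp [hy.2]
  have : (((opposite x).filter fun y => node y ∈ T).card : ℝ) ≤ T.card * d := by exact_mod_cast this
  linarith

/-- A safe exploration stops only when an answer hits `T`. At each of at most `L` questions `T` has
at most `K` nodes with at most `d` half-edges each, so this has probability at most `K * d / N` with
independent answers. -/
theorem mean_watch_le (g₀ : S ≃ R)
    (hd : ∀ w, (Finset.univ.filter fun x => node x = w).card ≤ d) {f : α → ℝ}
    (hf : ∀ a, 0 ≤ f a ∧ f a ≤ 1) {K L : ℕ} {t : Query (S ⊕ R) α} (ht : t.DepthLE L) {A : Finset (S ⊕ R)}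
    {T : Finset W} (hT : T.card + L ≤ K)
    (hs : t.Safe node (fun _ _ _ => True) A T) :
    (t.watch node A T).mean (fun o => o.elim 1 f) ≤ t.mean f + L * (K * d) / Fintype.card S := by
  induction t generalizing A T L with
  | pure a =>
    simp only [watch, mean, Option.elim]
    have : (0 : ℝ) ≤ L * (K * d) / Fintype.card S := by positivity
    linarith
  | ask x k ih =>
    cases L with
    | zero => exact ht.elim
    | succ L =>
      rw [watch, if_neg hs.1]
      simp only [mean]
      have hcard := card_opposite g₀ x
      have hpos : 0 < (opposite x).card := by
        refine Finset.card_pos.2 ⟨partner g₀ x, partner_mem_opposite g₀ ?_⟩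
        rcases x with s | r <;> simp [side]
      have hpos' : (0 : ℝ) < (opposite x).card := by exact_mod_cast hpos
      rw [div_add' _ _ _ hpos'.ne']
      refine div_le_div_of_nonneg_right ?_ hpos'.le
      refine (sum_watch_step_le (F' := fun y => (k y).mean f) (T := T)
        (c := L * (K * d) / Fintype.card S) hd (by positivity) (fun y hy => ?_) fun y hy => ?_).trans ?_
      · rw [if_pos hy]
        simp only [mean, Option.elim]
        have : (0 : ℝ) ≤ (k y).mean f := by
          rw [← mean_const g₀ 0 (k y)]
          exact mean_mono (fun a => (hf a).1) _
        linarith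
      · rw [if_neg hy]
        refine ih y (ht y) ?_ (hs.2 y hy)
        rw [Finset.card_insert_of_notMem hy]
        omega
      · refine add_le_add le_rfl ?_
        have h1 : (T.card : ℝ) * d ≤ K * d :=
          mul_le_mul_of_nonneg_right (by exact_mod_cast (by omega)) (Nat.cast_nonneg _)
        rw [← hcard]
        push_cast
        field_simp
        linarith

/-- The two errors are added: `2 * K ^ 2 / N` for replacing the matching by independent answers and
`K ^ 2 * d / N` for stopping. Stopping counts as the worst value `1`. -/
theorem matchingMean_run_le (g₀ : S ≃ R)
    (hd : ∀ w, (Finset.univ.filter fun x => node x = w).card ≤ d) {f : α → ℝ}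
    (hf : ∀ a, 0 ≤ f a ∧ f a ≤ 1) {K L : ℕ} {t : Query (S ⊕ R) α} (ht : t.DepthLE L)
    {A : Finset (S ⊕ R)} {T : Finset W} (hT : T.card + L ≤ K)
    (hs : t.Safe node (fun _ _ _ => True) A T) :
    matchingMean (fun g => ((t.watch node A T).run (partner g)).elim 1 f) ≤
      t.mean f + K * (K * (d + 2)) / Fintype.card S := by
  have h1 := mean_watch_le g₀ hd hf ht hT hs
  have h2 := abs_matchingMean_run_sub_mean_le g₀ (f := fun o : Option α => o.elim 1 f)
    (fun o => by cases o <;> simp [hf]) (watch_fresh (node := node) A T t) (watch_depthLE ht A T)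
  have h3 := (abs_le.1 h2).2
  have hLK : (L : ℝ) ≤ K := by exact_mod_cast (by omega)
  have h4 : (L : ℝ) * (2 * L) / Fintype.card S + L * (K * d) / Fintype.card S ≤
      K * (K * (d + 2)) / Fintype.card S := by
    rw [← add_div]
    refine div_le_div_of_nonneg_right ?_ (Nat.cast_nonneg _)
    have h5 : (L : ℝ) * (2 * L) ≤ K * (2 * K) := by gcongr
    have h6 : (L : ℝ) * (K * d) ≤ K * (K * d) := by gcongr
    linarith
  linarith

theorem matchingMean_le_mean (g₀ : S ≃ R)
    (hd : ∀ w, (Finset.univ.filter fun x => node x = w).card ≤ d) {f : α → ℝ}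
    (hf : ∀ a, 0 ≤ f a ∧ f a ≤ 1) {K L : ℕ} {t : Query (S ⊕ R) α} (ht : t.DepthLE L)
    {A : Finset (S ⊕ R)} {T : Finset W} (hT : T.card + L ≤ K)
    (hs : t.Safe node (fun _ _ _ => True) A T) :
    matchingMean (fun g => f (t.run (partner g))) ≤
      t.mean f + K * (K * (d + 2)) / Fintype.card S := by
  refine (matchingMean_mono fun g => ?_).trans (matchingMean_run_le g₀ hd hf ht hT hs)
  rcases run_watch (node := node) (partner g) A T t with h | ⟨h, -⟩
  · rw [h]; exact (hf _).2
  · rw [h]; exact le_rfl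

theorem mean_le_matchingMean (g₀ : S ≃ R)
    (hd : ∀ w, (Finset.univ.filter fun x => node x = w).card ≤ d) {f : α → ℝ}
    (hf : ∀ a, 0 ≤ f a ∧ f a ≤ 1) {K L : ℕ} {t : Query (S ⊕ R) α} (ht : t.DepthLE L)
    {A : Finset (S ⊕ R)} {T : Finset W} (hT : T.card + L ≤ K)
    (hs : t.Safe node (fun _ _ _ => True) A T) :
    t.mean f - K * (K * (d + 2)) / Fintype.card S ≤
      matchingMean (fun g => f (t.run (partner g))) := by
  -- The lower bound is the upper bound for the complementary function.
  have h := matchingMean_le_mean g₀ hd (f := fun a => 1 - f a)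
    (fun a => ⟨sub_nonneg.2 (hf a).2, sub_le_self _ (hf a).1⟩) ht hT hs
  have h1 : matchingMean (fun g => 1 - f (t.run (partner g))) +
      matchingMean (fun g => f (t.run (partner g))) = 1 := by
    rw [← matchingMean_add]
    simp [matchingMean_const g₀]
  rw [mean_sub, mean_const g₀] at h
  linarith

/-- With payoff `0` for completed runs, the general bound estimates the probability of stopping,
hence that of a repeated node. -/
theorem matchingMean_not_nodup_le (g₀ : S ≃ R)
    (hd : ∀ w, (Finset.univ.filter fun x => node x = w).card ≤ d)
    {K L : ℕ} {t : Query (S ⊕ R) α} (ht : t.DepthLE L)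
    {A : Finset (S ⊕ R)} {T : Finset W} (hT : T.card + L ≤ K)
    (hs : t.Safe node (fun _ _ _ => True) A T) {P : (S ≃ R) → Prop} [DecidablePred P]
    (hP : ∀ g, ((t.answers (partner g)).map node).Nodup →
      (∀ y ∈ t.answers (partner g), node y ∉ T) → P g) :
    matchingMean (fun g => if P g then 0 else 1) ≤ K * (K * (d + 2)) / Fintype.card S := by
  have h := matchingMean_run_le g₀ hd (f := fun _ : α => 0) (fun _ => by simp) ht hT hs
  rw [mean_const g₀, zero_add] at h
  refine (matchingMean_mono fun g => ?_).trans h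
  rcases run_watch (node := node) (partner g) A T t with h | ⟨h, h1, h2⟩
  · rw [h]; simp only [Option.elim]; split_ifs <;> norm_num
  · rw [h, if_pos (hP g h1 h2)]; rfl

end Compare

/-! ### Depth-first exploration of half-edges -/

section Explore

variable {H W α : Type} [DecidableEq H] [DecidableEq W] {node : H → W}

/-- Depth-first exploration: ask for the partner of `x`, explore its siblings to one level less, and
combine the results. -/
def explore (init : α) (comb : H → List α → α) (sibs : H → List H) : ℕ → H → Query H α
  | 0, _ => .pure init
  | j + 1, x => .ask x fun y =>
      (mapList (explore init comb sibs j) (sibs y)).bind fun l => .pure (comb y l)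

variable {init : α} {comb : H → List α → α} {sibs : H → List H}

theorem run_explore_succ (o : H → H) (j : ℕ) (x : H) :
    (explore init comb sibs (j + 1) x).run o =
      comb (o x) ((sibs (o x)).map fun z => (explore init comb sibs j z).run o) := by
  simp [explore, run, run_bind, run_mapList]

theorem answers_explore_succ (o : H → H) (j : ℕ) (x : H) :
    (explore init comb sibs (j + 1) x).answers o =
      o x :: (sibs (o x)).flatMap fun z => (explore init comb sibs j z).answers o := by
  simp [explore, answers, answers_bind, answers_mapList]

/-- The invariant says that a half-edge that becomes known is either the one explored or sits at a
node that was new. Hence exploring one element of the list never uses up a later one, whose node was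
known beforehand. -/
theorem safe_mapList {f : H → Query H α}
    (hf : ∀ (x : H) (A : Finset H) (T : Finset W), (∀ z ∈ A, node z ∈ T) → x ∉ A → node x ∈ T →
      (f x).Safe node (fun _ A' T' => T ⊆ T' ∧ (∀ z ∈ A', node z ∈ T') ∧
        ∀ z ∈ A', z ∈ A ∨ z = x ∨ node z ∉ T) A T)
    (l : List H) (hl : l.Nodup) (A : Finset H) (T : Finset W) (hA : ∀ z ∈ A, node z ∈ T)
    (hlA : ∀ x ∈ l, x ∉ A) (hlT : ∀ x ∈ l, node x ∈ T) :
    (mapList f l).Safe node (fun _ A' T' => T ⊆ T' ∧ (∀ z ∈ A', node z ∈ T') ∧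
        ∀ z ∈ A', z ∈ A ∨ z ∈ l ∨ node z ∉ T) A T := by
  induction l generalizing A T with
  | nil => exact ⟨subset_rfl, hA, fun z hz => Or.inl hz⟩
  | cons x l ih =>
    rw [List.nodup_cons] at hl
    simp only [List.mem_cons, forall_eq_or_imp] at hlA hlT
    refine Safe.bind (Safe.mono ?_ (hf x A T hA hlA.1 hlT.1))
    rintro _ A' T' ⟨hTT', hA', hnew⟩
    refine Safe.bind (Safe.mono ?_ (ih hl.2 A' T' hA' (fun z hz hzA' => ?_)
      fun z hz => hTT' (hlT.2 z hz)))
    · rintro _ A'' T'' ⟨h1, h2, h3⟩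
      refine ⟨hTT'.trans h1, h2, fun z hz => ?_⟩
      rcases h3 z hz with h | h | h
      · rcases hnew z h with h | h | h
        · exact Or.inl h
        · exact Or.inr (Or.inl (by simp [h]))
        · exact Or.inr (Or.inr h)
      · exact Or.inr (Or.inl (by simp [h]))
      · exact Or.inr (Or.inr fun h' => h (hTT' h'))
    · rcases hnew z hzA' with h | h | h
      · exact hlA.2 z hz h
      · exact hl.1 (h ▸ hz)
      · exact h (hlT.2 z hz)

/-- If the answer lies at a new node, no sibling of it can be known: known half-edges sit at known
nodes, and the answer itself is not its own sibling. -/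
theorem safe_explore (hnd : ∀ y, (sibs y).Nodup)
    (hsib : ∀ y, ∀ z ∈ sibs y, node z = node y ∧ z ≠ y) (j : ℕ) (x : H) (A : Finset H)
    (T : Finset W) (hA : ∀ z ∈ A, node z ∈ T) (hxA : x ∉ A) (hxT : node x ∈ T) :
    (explore init comb sibs j x).Safe node (fun _ A' T' => T ⊆ T' ∧ (∀ z ∈ A', node z ∈ T') ∧
        ∀ z ∈ A', z ∈ A ∨ z = x ∨ node z ∉ T) A T := by
  induction j generalizing x A T with
  | zero => exact ⟨subset_rfl, hA, fun z hz => Or.inl hz⟩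
  | succ j ih =>
    refine ⟨hxA, fun y hy => Safe.bind (Safe.mono ?_ (safe_mapList ih (sibs y) (hnd y) _ _ ?_ ?_ ?_))⟩
    · rintro _ A' T' ⟨h1, h2, h3⟩
      refine ⟨(Finset.subset_insert _ _).trans h1, h2, fun z hz => ?_⟩
      rcases h3 z hz with h | h | h
      · simp only [Finset.mem_insert] at h
        rcases h with h | h | h
        · exact Or.inr (Or.inl h)
        · exact Or.inr (Or.inr (h ▸ hy))
        · exact Or.inl h
      · exact Or.inr (Or.inr ((hsib y z h).1 ▸ hy))
      · exact Or.inr (Or.inr fun h' => h (Finset.mem_insert_of_mem h'))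
    · intro z hz
      simp only [Finset.mem_insert] at hz ⊢
      rcases hz with h | h | h
      · exact Or.inr (h ▸ hxT)
      · exact Or.inl (h ▸ rfl)
      · exact Or.inr (hA z h)
    · intro z hz hz'
      simp only [Finset.mem_insert] at hz'
      have h0 := (hsib y z hz).1
      rcases hz' with h | h | h
      · rw [h] at h0; exact hy (h0 ▸ hxT)
      · exact (hsib y z hz).2 h
      · exact hy (h0 ▸ hA z h)
    · intro z hz
      rw [(hsib y z hz).1]
      exact Finset.mem_insert_self _ _

/-- Bound for the number of questions in an exploration to level `j` with at most `d` siblings. -/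
def exploreDepth (d : ℕ) : ℕ → ℕ
  | 0 => 0
  | j + 1 => d * exploreDepth d j + 1

theorem explore_depthLE {d : ℕ} (hd : ∀ y, (sibs y).length ≤ d) (j : ℕ) (x : H) :
    (explore init comb sibs j x).DepthLE (exploreDepth d j) := by
  induction j generalizing x with
  | zero => trivial
  | succ j ih =>
    intro y
    rw [← Nat.add_zero (d * exploreDepth d j)]
    exact ((DepthLE.mapList ih (sibs y)).mono (Nat.mul_le_mul_right _ (hd y))).bind fun _ => trivial

end Explore

end Query

/-! ### Density evolution on a Tanner graph -/

/-- Probabilities for a message: the correct symbol is not on its list, it is not verified. -/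
abbrev MsgProb : Type := {v : ℝ × ℝ // 0 ≤ v.1 ∧ v.1 ≤ v.2 ∧ v.2 ≤ 1}

namespace MsgProb

theorem fst_nonneg (v : MsgProb) : 0 ≤ v.1.1 := v.2.1

theorem snd_nonneg (v : MsgProb) : 0 ≤ v.1.2 := v.2.1.trans v.2.2.1

theorem fst_le_one (v : MsgProb) : v.1.1 ≤ 1 := v.2.2.1.trans v.2.2.2

/-- Probability that all incoming lists lack the correct symbol. -/
noncomputable def allMissing (l : List MsgProb) : ℝ := (l.map fun v => v.1.1).prod

/-- Probability that exactly one incoming list has the correct symbol, on an unverified message. -/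
noncomputable def oneUnverified : List MsgProb → ℝ
  | [] => 0
  | v :: l => (v.1.2 - v.1.1) * allMissing l + v.1.1 * oneUnverified l

theorem allMissing_cons (v : MsgProb) (l : List MsgProb) :
    allMissing (v :: l) = v.1.1 * allMissing l := by simp [allMissing]

theorem prod_mem_unit (l : List MsgProb) {φ : MsgProb → ℝ} (hφ : ∀ v, 0 ≤ φ v ∧ φ v ≤ 1) :
    0 ≤ (l.map φ).prod ∧ (l.map φ).prod ≤ 1 := by
  induction l with
  | nil => simp
  | cons v l ih =>
    simp only [List.map_cons, List.prod_cons]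
    exact ⟨mul_nonneg (hφ v).1 ih.1, mul_le_one₀ (hφ v).2 ih.1 ih.2⟩

theorem prod_mono (l : List MsgProb) {φ ψ : MsgProb → ℝ} (hφ : ∀ v, 0 ≤ φ v ∧ φ v ≤ ψ v) :
    (l.map φ).prod ≤ (l.map ψ).prod := by
  induction l with
  | nil => simp
  | cons v l ih =>
    simp only [List.map_cons, List.prod_cons]
    refine mul_le_mul (hφ v).2 ih ?_ ((hφ v).1.trans (hφ v).2)
    exact List.prod_nonneg fun a ha => by
      obtain ⟨w, _, rfl⟩ := List.mem_map.1 ha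
      exact (hφ w).1

theorem allMissing_mem (l : List MsgProb) : 0 ≤ allMissing l ∧ allMissing l ≤ 1 :=
  prod_mem_unit l fun v => ⟨v.fst_nonneg, v.fst_le_one⟩

theorem oneUnverified_mem (l : List MsgProb) :
    0 ≤ oneUnverified l ∧ allMissing l + oneUnverified l ≤ 1 := by
  induction l with
  | nil => simp [allMissing, oneUnverified]
  | cons v l ih =>
    rw [allMissing_cons, oneUnverified]
    have h1 := v.2
    have h2 := allMissing_mem l
    constructor
    · have := mul_nonneg (sub_nonneg.2 h1.2.1) h2.1
      have := mul_nonneg h1.1 ih.1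
      linarith
    · have h3 : v.1.1 * oneUnverified l ≤ v.1.2 * oneUnverified l :=
        mul_le_mul_of_nonneg_right h1.2.1 ih.1
      have h4 : v.1.2 * (allMissing l + oneUnverified l) ≤ 1 :=
        mul_le_one₀ h1.2.2 (add_nonneg h2.1 ih.1) ih.2
      linarith

/-- The check-node rule for probabilities. -/
noncomputable def checkNode (l : List MsgProb) : MsgProb :=
  ⟨(1 - (l.map fun v => 1 - v.1.1).prod, 1 - (l.map fun v => 1 - v.1.2).prod), by
    have h1 := prod_mem_unit l (φ := fun v => 1 - v.1.1) fun v =>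
      ⟨sub_nonneg.2 v.fst_le_one, sub_le_self _ v.fst_nonneg⟩
    have h2 := prod_mem_unit l (φ := fun v => 1 - v.1.2) fun v =>
      ⟨sub_nonneg.2 v.2.2.2, sub_le_self _ v.snd_nonneg⟩
    have h3 := prod_mono l (φ := fun v => 1 - v.1.2) (ψ := fun v => 1 - v.1.1) fun v =>
      ⟨sub_nonneg.2 v.2.2.2, sub_le_sub_left v.2.2.1 _⟩
    exact ⟨sub_nonneg.2 h1.2, sub_le_sub_left h3 _, sub_le_self _ h2.1⟩⟩

/-- The variable-node rule for probabilities, at error probability `p`. -/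
noncomputable def varNode {p : ℝ} (hp : 0 ≤ p ∧ p ≤ 1) (l : List MsgProb) : MsgProb :=
  ⟨(p * allMissing l, allMissing l + p * oneUnverified l), by
    have h1 := allMissing_mem l
    have h2 := oneUnverified_mem l
    have h3 := mul_nonneg hp.1 h2.1
    have h4 : p * oneUnverified l ≤ oneUnverified l := mul_le_of_le_one_left h2.1 hp.2
    have h5 : p * allMissing l ≤ allMissing l := mul_le_of_le_one_left h1.1 hp.2
    exact ⟨mul_nonneg hp.1 h1.1, by linarith, by linarith⟩⟩

end MsgProb

namespace Query

section Mean

variable {S R ι : Type} [Fintype S] [Fintype R] [DecidableEq S] [DecidableEq R]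

/-- Under `Query.mean` successive explorations use independent answers, so means of products factor.
-/
theorem mean_mapList_prod {α : Type} (f : ι → Query (S ⊕ R) α) (φ : α → ℝ) (l : List ι) :
    (mapList f l).mean (fun as => (as.map φ).prod) = (l.map fun i => (f i).mean φ).prod := by
  induction l with
  | nil => simp [mapList, mean]
  | cons i l ih =>
    simp only [mapList, mean_bind, mean, List.map_cons, List.prod_cons, mean_const_mul,
      mean_mul_const, ih]

theorem mean_mapList_prod_eq_pow {α : Type} {f : ι → Query (S ⊕ R) α} {φ : α → ℝ} {l : List ι}
    {c : ℝ} (h : ∀ i ∈ l, (f i).mean φ = c) :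
    (mapList f l).mean (fun as => (as.map φ).prod) = c ^ l.length := by
  rw [mean_mapList_prod, List.map_congr_left h]
  simp

/-- `oneUnverified` is affine in each entry, so independence lets the entries be replaced by their
means; equal means then produce the derivative of a power, the origin of `λ'` in density evolution.
-/
theorem mean_mapList_oneUnverified {f : ι → Query (S ⊕ R) MsgProb} {l : List ι} {a b : ℝ}
    (ha : ∀ i ∈ l, (f i).mean (fun v => v.1.1) = a)
    (hb : ∀ i ∈ l, (f i).mean (fun v => v.1.2) = b) :
    (mapList f l).mean MsgProb.oneUnverified = l.length * (b - a) * a ^ (l.length - 1) := by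
  induction l with
  | nil => simp [mapList, mean, MsgProb.oneUnverified]
  | cons i l ih =>
    simp only [List.mem_cons, forall_eq_or_imp] at ha hb
    have h1 : (mapList f l).mean MsgProb.allMissing = a ^ l.length :=
      mean_mapList_prod_eq_pow ha.2
    simp only [mapList, mean_bind, mean, MsgProb.oneUnverified, mean_add, mean_const_mul,
      mean_mul_const, mean_sub, ih ha.2 hb.2, h1, ha.1, hb.1, List.length_cons,
      Nat.add_sub_cancel]
    rcases hl : l.length with _ | k
    · simp
    · simp only [Nat.add_sub_cancel]
      push_cast
      ring

end Mean

end Query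

namespace NodeDegrees

variable (D : NodeDegrees)

/-- The half-edges of the graphs with given node degrees. -/
abbrev HalfEdge : Type := D.VSocket ⊕ D.CSocket

/-- The node of a half-edge. -/
def node : D.HalfEdge → Fin D.n ⊕ Fin D.r := Sum.map Sigma.fst Sigma.fst

@[simp] theorem node_inl (e : D.VSocket) : D.node (.inl e) = .inl e.1 := rfl

@[simp] theorem node_inr (s : D.CSocket) : D.node (.inr s) = .inr s.1 := rfl

/-- The other half-edges at the node of a half-edge. -/
noncomputable def siblings (y : D.HalfEdge) : List D.HalfEdge :=
  (Finset.univ.filter fun z => D.node z = D.node y ∧ z ≠ y).toList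

variable {D}

theorem nodup_siblings (y : D.HalfEdge) : (D.siblings y).Nodup := Finset.nodup_toList _

theorem mem_siblings {y z : D.HalfEdge} : z ∈ D.siblings y ↔ D.node z = D.node y ∧ z ≠ y := by
  simp [siblings]

theorem card_vsocket_fiber (v : Fin D.n) :
    (Finset.univ.filter fun e : D.VSocket => e.1 = v).card = D.dv v := by
  have : (Finset.univ.filter fun e : D.VSocket => e.1 = v) =
      Finset.univ.map (Function.Embedding.sigmaMk v) := by
    ext ⟨a, b⟩
    simp only [Finset.mem_filter, Finset.mem_univ, true_and, Finset.mem_map,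
      Function.Embedding.sigmaMk_apply]
    constructor
    · rintro rfl; exact ⟨b, rfl⟩
    · rintro ⟨j, hj⟩; exact (congrArg Sigma.fst hj).symm
  rw [this]
  simp

theorem card_csocket_fiber (c : Fin D.r) :
    (Finset.univ.filter fun s : D.CSocket => s.1 = c).card = D.dc c := by
  have : (Finset.univ.filter fun e : D.CSocket => e.1 = c) =
      Finset.univ.map (Function.Embedding.sigmaMk c) := by
    ext ⟨a, b⟩
    simp only [Finset.mem_filter, Finset.mem_univ, true_and, Finset.mem_map,
      Function.Embedding.sigmaMk_apply]
    constructor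
    · rintro rfl; exact ⟨b, rfl⟩
    · rintro ⟨j, hj⟩; exact (congrArg Sigma.fst hj).symm
  rw [this]
  simp

theorem filter_node_inl (v : Fin D.n) : (Finset.univ.filter fun z => D.node z = .inl v) =
    (Finset.univ.filter fun e : D.VSocket => e.1 = v).map Function.Embedding.inl := by
  ext z
  rcases z with e | s <;> simp

theorem filter_node_inr (c : Fin D.r) : (Finset.univ.filter fun z => D.node z = .inr c) =
    (Finset.univ.filter fun e : D.CSocket => e.1 = c).map Function.Embedding.inr := by
  ext z
  rcases z with e | s <;> simp

theorem length_siblings (y : D.HalfEdge) :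
    (D.siblings y).length = (Finset.univ.filter fun z => D.node z = D.node y).card - 1 := by
  rw [siblings, Finset.length_toList, ← Finset.filter_filter, Finset.filter_ne',
    Finset.card_erase_of_mem (by simp)]

theorem length_siblings_inl (e : D.VSocket) : (D.siblings (.inl e)).length = D.dv e.1 - 1 := by
  rw [length_siblings, ← card_vsocket_fiber, node_inl, filter_node_inl, Finset.card_map]

theorem length_siblings_inr (s : D.CSocket) : (D.siblings (.inr s)).length = D.dc s.1 - 1 := by
  rw [length_siblings, ← card_csocket_fiber, node_inr, filter_node_inr, Finset.card_map]

variable (D)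

/-- The edge-perspective degree distribution of the variable nodes. -/
noncomputable def variableDist : ℝ[X] :=
  C ((Fintype.card D.VSocket : ℝ)⁻¹) * ∑ e : D.VSocket, X ^ (D.dv e.1 - 1)

/-- The edge-perspective degree distribution of the check nodes. -/
noncomputable def checkDist : ℝ[X] :=
  C ((Fintype.card D.CSocket : ℝ)⁻¹) * ∑ s : D.CSocket, X ^ (D.dc s.1 - 1)

variable {D}

theorem eval_variableDist (x : ℝ) :
    D.variableDist.eval x = (∑ e : D.VSocket, x ^ (D.dv e.1 - 1)) / Fintype.card D.VSocket := by
  simp [variableDist, eval_finsetSum, div_eq_inv_mul]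

theorem eval_checkDist (x : ℝ) :
    D.checkDist.eval x = (∑ s : D.CSocket, x ^ (D.dc s.1 - 1)) / Fintype.card D.CSocket := by
  simp [checkDist, eval_finsetSum, div_eq_inv_mul]

theorem eval_derivative_variableDist (x : ℝ) : (derivative D.variableDist).eval x =
    (∑ e : D.VSocket, ((D.dv e.1 - 1 : ℕ) : ℝ) * x ^ (D.dv e.1 - 1 - 1)) /
      Fintype.card D.VSocket := by
  simp [variableDist, eval_finsetSum, div_eq_inv_mul, derivative_X_pow]

/-- The exploration that computes the message probabilities on a tree. -/
noncomputable def msgQuery (D : NodeDegrees) {p : ℝ} (hp : 0 ≤ p ∧ p ≤ 1) :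
    ℕ → D.HalfEdge → Query D.HalfEdge MsgProb :=
  Query.explore ⟨(1, 1), by norm_num⟩
    (fun y l => y.elim (fun _ => MsgProb.varNode hp l) fun _ => MsgProb.checkNode l) D.siblings

variable {p : ℝ} (hp : 0 ≤ p ∧ p ≤ 1)

theorem mean_msgQuery_succ_inl (j : ℕ) (e : D.VSocket) (φ : MsgProb → ℝ) :
    (D.msgQuery hp (j + 1) (.inl e)).mean φ = (∑ s : D.CSocket,
      (Query.mapList (D.msgQuery hp j) (D.siblings (.inr s))).mean fun l => φ (MsgProb.checkNode l)) /
        Fintype.card D.CSocket := by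
  simp only [msgQuery, Query.explore, Query.mean, Query.mean_bind, opposite, Finset.sum_map,
    Finset.card_map, Finset.card_univ, Function.Embedding.inr_apply, Sum.elim_inr]

theorem mean_msgQuery_succ_inr (j : ℕ) (s : D.CSocket) (φ : MsgProb → ℝ) :
    (D.msgQuery hp (j + 1) (.inr s)).mean φ = (∑ e : D.VSocket,
      (Query.mapList (D.msgQuery hp j) (D.siblings (.inl e))).mean
        fun l => φ (MsgProb.varNode hp l)) / Fintype.card D.VSocket := by
  simp only [msgQuery, Query.explore, Query.mean, Query.mean_bind, opposite, Finset.sum_map,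
    Finset.card_map, Finset.card_univ, Function.Embedding.inl_apply, Sum.elim_inl]

theorem exists_inr_of_mem_siblings {s : D.CSocket} {z : D.HalfEdge}
    (h : z ∈ D.siblings (.inr s)) : ∃ s', z = .inr s' := by
  rcases z with e | s'
  · simp [mem_siblings] at h
  · exact ⟨s', rfl⟩

theorem exists_inl_of_mem_siblings {e : D.VSocket} {z : D.HalfEdge}
    (h : z ∈ D.siblings (.inl e)) : ∃ e', z = .inl e' := by
  rcases z with e' | s'
  · exact ⟨e', rfl⟩
  · simp [mem_siblings] at h

/-- A uniform check socket has a degree distributed from the edge perspective, which turns powers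
into `checkDist`. A general coordinate `φ` covers both components of a message. -/
theorem mean_msgQuery_inl_of_inr (g₀ : D.Graph) (e : D.VSocket) {φ : MsgProb → ℝ} {j : ℕ} {x : ℝ}
    (hφ : ∀ l, φ (MsgProb.checkNode l) = 1 - (l.map fun v => 1 - φ v).prod)
    (h : ∀ s : D.CSocket, (D.msgQuery hp j (.inr s)).mean φ = x) :
    (D.msgQuery hp (j + 1) (.inl e)).mean φ = 1 - D.checkDist.eval (1 - x) := by
  rw [mean_msgQuery_succ_inl, eval_checkDist]
  have h1 : ∀ s : D.CSocket, (Query.mapList (D.msgQuery hp j) (D.siblings (.inr s))).mean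
      (fun l => φ (MsgProb.checkNode l)) = 1 - (1 - x) ^ (D.dc s.1 - 1) := by
    intro s
    simp only [hφ]
    rw [Query.mean_sub, Query.mean_const g₀, Query.mean_mapList_prod_eq_pow (c := 1 - x),
      length_siblings_inr]
    intro z hz
    obtain ⟨s', rfl⟩ := exists_inr_of_mem_siblings hz
    rw [Query.mean_sub, Query.mean_const g₀, h]
  have h2 : (Fintype.card D.CSocket : ℝ) ≠ 0 := by
    have : Nonempty D.CSocket := ⟨g₀ e⟩
    exact_mod_cast Fintype.card_ne_zero
  simp only [h1, Finset.sum_sub_distrib, sub_div, Finset.sum_const, Finset.card_univ, nsmul_eq_mul,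
    mul_one]
  rw [div_self h2]

/-- The mean message probabilities in an exploration with independent uniform answers are given by
density evolution. -/
theorem mean_msgQuery_inr (g₀ : D.Graph) (i : ℕ) (s : D.CSocket) :
    (D.msgQuery hp (2 * i) (.inr s)).mean (fun v => v.1.1) =
        (densityEvolution D.variableDist D.checkDist p i).1 ∧
      (D.msgQuery hp (2 * i) (.inr s)).mean (fun v => v.1.2) =
        (densityEvolution D.variableDist D.checkDist p i).2 := by
  induction i generalizing s with
  | zero => exact ⟨rfl, rfl⟩
  | succ i ih =>
    have hx := fun e => mean_msgQuery_inl_of_inr hp g₀ e (φ := fun v => v.1.1) (fun l => rfl)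
      fun s => (ih s).1
    have hy := fun e => mean_msgQuery_inl_of_inr hp g₀ e (φ := fun v => v.1.2) (fun l => rfl)
      fun s => (ih s).2
    -- One round of density evolution is two levels of exploration: a variable node, then a check
    -- node.
    rw [show 2 * (i + 1) = 2 * i + 1 + 1 by ring, mean_msgQuery_succ_inr, mean_msgQuery_succ_inr]
    simp only [densityEvolution]
    set x := (densityEvolution D.variableDist D.checkDist p i).1
    set y := (densityEvolution D.variableDist D.checkDist p i).2
    have h1 : ∀ e : D.VSocket, (Query.mapList (D.msgQuery hp (2 * i + 1))
        (D.siblings (.inl e))).mean MsgProb.allMissing =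
          (1 - D.checkDist.eval (1 - x)) ^ (D.dv e.1 - 1) := by
      intro e
      rw [← length_siblings_inl]
      refine Query.mean_mapList_prod_eq_pow fun z hz => ?_
      obtain ⟨e', rfl⟩ := exists_inl_of_mem_siblings hz
      exact hx e'
    have h2 : ∀ e : D.VSocket, (Query.mapList (D.msgQuery hp (2 * i + 1))
        (D.siblings (.inl e))).mean MsgProb.oneUnverified = ((D.dv e.1 - 1 : ℕ) : ℝ) *
          ((1 - D.checkDist.eval (1 - y)) - (1 - D.checkDist.eval (1 - x))) *
            (1 - D.checkDist.eval (1 - x)) ^ (D.dv e.1 - 1 - 1) := by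
      intro e
      rw [← length_siblings_inl]
      refine Query.mean_mapList_oneUnverified (fun z hz => ?_) fun z hz => ?_
      · obtain ⟨e', rfl⟩ := exists_inl_of_mem_siblings hz
        exact hx e'
      · obtain ⟨e', rfl⟩ := exists_inl_of_mem_siblings hz
        exact hy e'
    simp only [MsgProb.varNode, Query.mean_const_mul, Query.mean_add, h1, h2]
    rw [eval_derivative_variableDist, eval_variableDist]
    constructor
    · rw [← Finset.mul_sum, mul_div_assoc]
    · rw [Finset.sum_add_distrib, add_div, mul_div_assoc', Finset.mul_sum]
      congr 2
      refine Finset.sum_congr rfl fun e _ => ?_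
      ring

theorem mean_msgQuery_inl (g₀ : D.Graph) (i : ℕ) (e : D.VSocket) :
    (D.msgQuery hp (2 * i + 1) (.inl e)).mean (fun v => v.1.2) =
      1 - D.checkDist.eval (1 - (densityEvolution D.variableDist D.checkDist p i).2) :=
  mean_msgQuery_inl_of_inr hp g₀ e (fun _ => rfl) fun s => (mean_msgQuery_inr hp g₀ i s).2

end NodeDegrees

/-! ### Concentration for the uniformly random Tanner graph -/

namespace NodeDegrees

variable {D : NodeDegrees}

variable (D) in
/-- The half-edges at a variable node. -/
noncomputable def sockets (v : Fin D.n) : List D.HalfEdge :=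
  (Finset.univ.filter fun z => D.node z = .inl v).toList

theorem mem_sockets {v : Fin D.n} {z : D.HalfEdge} : z ∈ D.sockets v ↔ D.node z = .inl v := by
  simp [sockets]

theorem length_sockets (v : Fin D.n) : (D.sockets v).length = D.dv v := by
  rw [sockets, Finset.length_toList, filter_node_inl, Finset.card_map, card_vsocket_fiber]

variable (D) in
/-- All node degrees are at most `d`. -/
structure BoundedBy (d : ℕ) : Prop where
  dv_le : ∀ v, D.dv v ≤ d
  dc_le : ∀ c, D.dc c ≤ d

theorem BoundedBy.card_fiber_le {d : ℕ} (hd : D.BoundedBy d) (w : Fin D.n ⊕ Fin D.r) :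
    (Finset.univ.filter fun z => D.node z = w).card ≤ d := by
  rcases w with v | c
  · rw [filter_node_inl, Finset.card_map, card_vsocket_fiber]
    exact hd.dv_le v
  · rw [filter_node_inr, Finset.card_map, card_csocket_fiber]
    exact hd.dc_le c

theorem BoundedBy.length_siblings_le {d : ℕ} (hd : D.BoundedBy d) (y : D.HalfEdge) :
    (D.siblings y).length ≤ d := by
  rw [length_siblings]
  exact (Nat.sub_le _ _).trans (hd.card_fiber_le _)

variable {p : ℝ} (hp : 0 ≤ p ∧ p ≤ 1)

theorem safe_mapList_msgQuery (J : ℕ) {L : List D.HalfEdge} (hL : L.Nodup)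
    {T : Finset (Fin D.n ⊕ Fin D.r)} (hT : ∀ x ∈ L, D.node x ∈ T) :
    (Query.mapList (D.msgQuery hp J) L).Safe D.node (fun _ _ _ => True) ∅ T :=
  (Query.safe_mapList (fun x A T => Query.safe_explore nodup_siblings
    (fun _ _ h => mem_siblings.1 h) J x A T) L hL ∅ T (by simp) (by simp) hT).mono fun _ _ _ _ => trivial

theorem depthLE_mapList_msgQuery {d : ℕ} (hd : D.BoundedBy d) (J : ℕ) (L : List D.HalfEdge) :
    (Query.mapList (D.msgQuery hp J) L).DepthLE (L.length * Query.exploreDepth d J) :=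
  Query.DepthLE.mapList (fun x => Query.explore_depthLE hd.length_siblings_le J x) L

/-- The probability that no message to the node `v` is verified, if the neighborhood is a tree. -/
noncomputable def allUnverified (D : NodeDegrees) {p : ℝ} (hp : 0 ≤ p ∧ p ≤ 1) (J : ℕ)
    (g : D.Graph) (v : Fin D.n) : ℝ :=
  ((D.sockets v).map fun x => ((D.msgQuery hp J x).run (partner g)).1.2).prod

/-- The nodes that are visited in an exploration to level `J` of the half-edge `x`. -/
noncomputable def visited (D : NodeDegrees) (g : D.Graph) : ℕ → D.HalfEdge → List (Fin D.n ⊕ Fin D.r)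
  | 0, _ => []
  | J + 1, x => D.node (partner g x) ::
      (D.siblings (partner g x)).flatMap fun z => D.visited g J z

theorem map_answers_msgQuery (g : D.Graph) (J : ℕ) (x : D.HalfEdge) :
    ((D.msgQuery hp J x).answers (partner g)).map D.node = D.visited g J x := by
  induction J generalizing x with
  | zero => rfl
  | succ J ih =>
    rw [msgQuery, Query.answers_explore_succ]
    simp only [List.map_cons, List.map_flatMap, visited]
    congr 1
    exact List.flatMap_congr fun z _ => ih z

/-- The neighborhood of the node `v` to level `J` is a tree. -/
def TreeLike (D : NodeDegrees) (g : D.Graph) (J : ℕ) (v : Fin D.n) : Prop :=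
  (.inl v :: (D.sockets v).flatMap fun x => D.visited g J x).Nodup

/-- The constant in the comparison of random graphs with trees. -/
def treeConst (d J : ℕ) : ℝ :=
  (2 + 2 * d * Query.exploreDepth d J : ℕ) *
    ((2 + 2 * d * Query.exploreDepth d J : ℕ) * (d + 2))

theorem treeConst_nonneg (d J : ℕ) : 0 ≤ treeConst d J := by
  unfold treeConst; positivity

section

variable {d J : ℕ} (hd : D.BoundedBy d) (g₀ : D.Graph)

include hd g₀ in
open scoped Classical in
-- A neighborhood fails to be a tree only if the exploration from all sockets of `v` meets a node
-- twice or returns to `v`.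
theorem matchingMean_not_treeLike_le (v : Fin D.n) :
    matchingMean (fun g : D.Graph => if D.TreeLike g J v then 0 else 1) ≤
      treeConst d J / Fintype.card D.VSocket := by
  -- The visited nodes do not depend on the error probability, so `0` serves.
  have hdepth := depthLE_mapList_msgQuery (p := 0) (by norm_num) hd J (D.sockets v)
  refine Query.matchingMean_not_nodup_le g₀ hd.card_fiber_le hdepth (T := {.inl v}) ?_
    (safe_mapList_msgQuery _ J (Finset.nodup_toList _) fun x hx => ?_) fun g h1 h2 => ?_
  · rw [length_sockets, Finset.card_singleton]
    have := Nat.mul_le_mul_right (Query.exploreDepth d J) (hd.dv_le v)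
    nlinarith
  · simp [mem_sockets.1 hx]
  · have e : ((Query.mapList (D.msgQuery (p := 0) (by norm_num) J) (D.sockets v)).answers
        (partner g)).map D.node = (D.sockets v).flatMap fun x => D.visited g J x := by
      rw [Query.answers_mapList, List.map_flatMap]
      exact List.flatMap_congr fun z _ => map_answers_msgQuery _ g J z
    rw [TreeLike, List.nodup_cons]
    refine ⟨fun hm => ?_, e ▸ h1⟩
    rw [← e] at hm
    obtain ⟨y, hy, hyv⟩ := List.mem_map.1 hm
    exact h2 y hy (by simp [hyv])

theorem allUnverified_mem (g : D.Graph) (v : Fin D.n) :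
    0 ≤ D.allUnverified hp J g v ∧ D.allUnverified hp J g v ≤ 1 := by
  have := MsgProb.prod_mem_unit ((D.sockets v).map fun x => (D.msgQuery hp J x).run (partner g))
    (φ := fun v => v.1.2) fun v => ⟨v.snd_nonneg, v.2.2.2⟩
  rwa [List.map_map] at this

variable {y : ℝ} (hy : ∀ e, (D.msgQuery hp J (.inl e)).mean (fun v => v.1.2) = y)

include hd g₀ hy in
theorem matchingMean_allUnverified_ge (v : Fin D.n) :
    y ^ D.dv v - treeConst d J / Fintype.card D.VSocket ≤
      matchingMean fun g => D.allUnverified hp J g v := by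
  have h := Query.mean_le_matchingMean (f := fun l : List MsgProb => (l.map fun v => v.1.2).prod)
    (K := 2 + 2 * d * Query.exploreDepth d J) g₀ hd.card_fiber_le
    (fun l => MsgProb.prod_mem_unit l fun v => ⟨v.snd_nonneg, v.2.2.2⟩)
    (depthLE_mapList_msgQuery hp hd J (D.sockets v)) (T := {.inl v}) (by
      rw [length_sockets, Finset.card_singleton]
      have := Nat.mul_le_mul_right (Query.exploreDepth d J) (hd.dv_le v)
      nlinarith)
    (safe_mapList_msgQuery hp J (Finset.nodup_toList _) fun x hx => by simp [mem_sockets.1 hx])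
  rw [Query.mean_mapList_prod_eq_pow (c := y), length_sockets] at h
  · simp only [Query.run_mapList, List.map_map] at h
    exact h
  · intro x hx
    rcases x with e | s
    · exact hy e
    · simp [mem_sockets] at hx

include hd g₀ hy in
-- The sockets of both nodes are explored in one run that starts with both roots known; the constant
-- `K` therefore allows for two roots and `2 * d` explorations.
theorem matchingMean_allUnverified_mul_le {v v' : Fin D.n} (hv : v ≠ v') :
    matchingMean (fun g => D.allUnverified hp J g v * D.allUnverified hp J g v') ≤
      y ^ D.dv v * y ^ D.dv v' + treeConst d J / Fintype.card D.VSocket := by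
  have hnd : (D.sockets v ++ D.sockets v').Nodup := by
    refine List.Nodup.append (Finset.nodup_toList _) (Finset.nodup_toList _) fun x hx hx' => hv ?_
    rw [mem_sockets] at hx hx'
    exact Sum.inl.inj (hx.symm.trans hx')
  have hT : ∀ x ∈ D.sockets v ++ D.sockets v', D.node x ∈ ({.inl v, .inl v'} : Finset _) := by
    intro x hx
    rw [List.mem_append, mem_sockets, mem_sockets] at hx
    simpa using hx
  have h := Query.matchingMean_le_mean (f := fun l : List MsgProb => (l.map fun v => v.1.2).prod)
    (K := 2 + 2 * d * Query.exploreDepth d J) g₀ hd.card_fiber_le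
    (fun l => MsgProb.prod_mem_unit l fun v => ⟨v.snd_nonneg, v.2.2.2⟩)
    (depthLE_mapList_msgQuery hp hd J (D.sockets v ++ D.sockets v')) (by
      rw [List.length_append, length_sockets, length_sockets, Finset.card_pair (by simpa using hv)]
      have h1 := Nat.mul_le_mul_right (Query.exploreDepth d J) (hd.dv_le v)
      have h2 := Nat.mul_le_mul_right (Query.exploreDepth d J) (hd.dv_le v')
      nlinarith)
    (safe_mapList_msgQuery hp J hnd hT)
  rw [Query.mean_mapList_prod_eq_pow (c := y), List.length_append, length_sockets, length_sockets,
    pow_add] at h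
  · simp only [Query.run_mapList, List.map_map, List.map_append, List.prod_append] at h
    exact h
  · intro x hx
    rcases x with e | s
    · exact hy e
    · simp [mem_sockets] at hx

include hd g₀ hy in
open scoped Classical in
/-- The average probability that no message to a variable node is verified exceeds the value `y`
for trees by `ε` with small probability only. -/
theorem matchingMean_deviation_le (hdv : ∀ v, 1 ≤ D.dv v) (hn : 0 < D.n) {ε : ℝ} (hε : 0 < ε) :
    matchingMean (fun g : D.Graph =>
      if y + ε ≤ (∑ v, D.allUnverified hp J g v) / D.n then 1 else 0) ≤
        (3 * treeConst d J + 1) / ε ^ 2 / D.n := by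
  set n : ℝ := (D.n : ℝ) with hndef
  have hn' : 0 < n := Nat.cast_pos.2 hn
  set c := treeConst d J / n with hc
  have hc0 : 0 ≤ c := div_nonneg (treeConst_nonneg d J) hn'.le
  have hNn : n ≤ Fintype.card D.VSocket := by
    rw [hndef]
    norm_cast
    rw [Fintype.card_sigma]
    simp only [Fintype.card_fin]
    calc D.n = ∑ v : Fin D.n, 1 := by simp
      _ ≤ _ := Finset.sum_le_sum fun v _ => hdv v
  have hcN : treeConst d J / Fintype.card D.VSocket ≤ c :=
    div_le_div_of_nonneg_left (treeConst_nonneg d J) hn' hNn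
  have hy01 : 0 ≤ y ∧ y ≤ 1 := by
    have e : D.VSocket := ⟨⟨0, hn⟩, ⟨0, hdv _⟩⟩
    rw [← hy e]
    exact ⟨(Query.mean_const g₀ 0 _).symm.le.trans (Query.mean_mono (fun v => v.snd_nonneg) _),
      (Query.mean_mono (fun v => v.2.2.2) _).trans (Query.mean_const g₀ 1 _).le⟩
  set U : D.Graph → Fin D.n → ℝ := fun g v => D.allUnverified hp J g v with hU
  set Z : D.Graph → ℝ := fun g => (∑ v, U g v) / n with hZ
  set m : ℝ := (∑ v, y ^ D.dv v) / n with hm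
  have hpow : ∀ v, y ^ D.dv v ≤ y := fun v =>
    pow_le_of_le_one hy01.1 hy01.2 (by have := hdv v; omega)
  have hpow0 : ∀ v, 0 ≤ y ^ D.dv v := fun v => pow_nonneg hy01.1 _
  have hm0 : 0 ≤ m := div_nonneg (Finset.sum_nonneg fun v _ => hpow0 v) hn'.le
  have hmy : m ≤ y := by
    rw [hm, div_le_iff₀ hn']
    refine (Finset.sum_le_sum fun v _ => hpow v).trans ?_
    simp [hndef, mul_comm]
  have hEZ : m - c ≤ matchingMean Z := by
    have : matchingMean Z = (∑ v, matchingMean fun g => U g v) / n := by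
      rw [← matchingMean_sum, hZ]
      simp only [div_eq_inv_mul]
      rw [matchingMean_const_mul]
    rw [this, le_div_iff₀ hn', sub_mul, hm, div_mul_cancel₀ _ hn'.ne']
    calc ∑ v, y ^ D.dv v - c * n = ∑ v : Fin D.n, (y ^ D.dv v - c) := by
          rw [Finset.sum_sub_distrib]; simp [hndef, mul_comm]
      _ ≤ _ := Finset.sum_le_sum fun v _ =>
          (sub_le_sub_left hcN _).trans (matchingMean_allUnverified_ge hp hd g₀ hy v)
  -- Pairs of distinct nodes are nearly uncorrelated; the `n` diagonal terms are at most `1` each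
  -- and cost `1 / n` after division by `n ^ 2`.
  have hEZ2 : matchingMean (fun g => Z g ^ 2) ≤ m ^ 2 + c + 1 / n := by
    have h1 : matchingMean (fun g => Z g ^ 2) =
        (∑ v, ∑ v', matchingMean fun g => U g v * U g v') / n ^ 2 := by
      simp only [← matchingMean_sum]
      rw [hZ, div_eq_inv_mul, ← matchingMean_const_mul]
      congr 1
      ext g
      rw [div_pow, sq (∑ v, U g v), Finset.sum_mul_sum, div_eq_inv_mul]
    have h2 : ∀ v v', matchingMean (fun g => U g v * U g v') ≤
        y ^ D.dv v * y ^ D.dv v' + c + if v = v' then 1 else 0 := by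
      intro v v'
      split_ifs with h
      · have : matchingMean (fun g => U g v * U g v') ≤ 1 := by
          rw [← matchingMean_const g₀ 1]
          exact matchingMean_mono fun g => mul_le_one₀ (allUnverified_mem hp g v).2
            (allUnverified_mem hp g v').1 (allUnverified_mem hp g v').2
        have := mul_nonneg (hpow0 v) (hpow0 v')
        linarith
      · rw [add_zero]
        exact (matchingMean_allUnverified_mul_le hp hd g₀ hy h).trans (by linarith)
    rw [h1, div_le_iff₀ (by positivity)]
    refine (Finset.sum_le_sum fun v _ => Finset.sum_le_sum fun v' _ => h2 v v').trans ?_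
    simp only [Finset.sum_add_distrib, ← Finset.mul_sum, ← Finset.sum_mul, Finset.sum_const,
      Finset.card_univ, Fintype.card_fin, Finset.sum_ite_eq, Finset.mem_univ, if_true, nsmul_eq_mul]
    rw [← hndef, hm]
    apply le_of_eq
    field_simp
  -- The second moment is centred at the tree value `m`, not at the mean of `Z`. A lower bound on
  -- that mean suffices, since it enters with the factor `-2 * m`; the extra error is at most `2 *
  -- c` as `m ≤ 1`.
  have hvar : matchingMean (fun g => (Z g - m) ^ 2) ≤ 3 * c + 1 / n := by
    have h1 : matchingMean (fun g => (Z g - m) ^ 2) =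
        matchingMean (fun g => Z g ^ 2) + (-2 * m) * matchingMean Z + m ^ 2 := by
      rw [← matchingMean_const_mul, ← matchingMean_const g₀ (m ^ 2), ← matchingMean_add,
        ← matchingMean_add]
      congr 1
      ext g
      ring
    have h2 : m * (m - c) ≤ m * matchingMean Z := mul_le_mul_of_nonneg_left hEZ hm0
    have h3 : m * c ≤ c := mul_le_of_le_one_left hc0 (hmy.trans hy01.2)
    rw [h1]
    nlinarith
  have hcheb : ∀ g, (if y + ε ≤ Z g then (1 : ℝ) else 0) ≤ (ε ^ 2)⁻¹ * (Z g - m) ^ 2 := by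
    intro g
    split_ifs with h
    · rw [← div_eq_inv_mul, le_div_iff₀ (by positivity), one_mul]
      exact pow_le_pow_left₀ hε.le (by linarith) 2
    · positivity
  refine (matchingMean_mono hcheb).trans ?_
  rw [matchingMean_const_mul]
  refine (mul_le_mul_of_nonneg_left hvar (by positivity)).trans (le_of_eq ?_)
  rw [hc]
  field_simp

end

end NodeDegrees

/-! ### Decoding without false collisions -/

section Decoding

variable {F : Type} {D : NodeDegrees}

open scoped Classical in
/-- The other edges at the variable node of an edge. -/
noncomputable def varSiblings (e : D.VSocket) : Finset D.VSocket :=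
  Finset.univ.filter fun e' => e'.1 = e.1 ∧ e' ≠ e

open scoped Classical in
/-- The other edges at the check node of an edge. -/
noncomputable def checkSiblings (g : D.Graph) (e : D.VSocket) : Finset D.VSocket :=
  Finset.univ.filter fun e' => (g e').1 = (g e).1 ∧ e' ≠ e

theorem mem_varSiblings {e e' : D.VSocket} : e' ∈ varSiblings e ↔ e'.1 = e.1 ∧ e' ≠ e := by
  simp [varSiblings]

theorem mem_checkSiblings {g : D.Graph} {e e' : D.VSocket} :
    e' ∈ checkSiblings g e ↔ (g e').1 = (g e).1 ∧ e' ≠ e := by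
  simp [checkSiblings]

/-- At a variable node with incoming messages `i ∈ I`, whose lists have the correct symbol if `L i`
and which are verified if `V i`, this condition leads to verification. -/
def VerifiedAt {ι : Type} (I : Finset ι) (L V : ι → Prop) (ok : Prop) : Prop :=
  (∃ i ∈ I, V i) ∨ (ok ∧ ∃ i ∈ I, L i) ∨ ∃ i ∈ I, ∃ j ∈ I, i ≠ j ∧ L i ∧ L j

/-- The correct symbol is on the list sent along an edge in round `i`, if the symbols at the nodes
`v` with `ok v` are received correctly. -/
def Listed (g : D.Graph) (ok : Fin D.n → Prop) : ℕ → D.VSocket → Prop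
  | 0, e => ok e.1
  | i + 1, e => ok e.1 ∨ ∃ e' ∈ varSiblings e, ∀ e'' ∈ checkSiblings g e', Listed g ok i e''

/-- The message sent along an edge in round `i` is verified, if the symbols at the nodes `v` with
`ok v` are received correctly. -/
def Verified (g : D.Graph) (ok : Fin D.n → Prop) : ℕ → D.VSocket → Prop
  | 0, _ => False
  | i + 1, e => VerifiedAt (varSiblings e) (fun e' => ∀ e'' ∈ checkSiblings g e', Listed g ok i e'')
      (fun e' => ∀ e'' ∈ checkSiblings g e', Verified g ok i e'') (ok e.1)

theorem Verified.listed {g : D.Graph} {ok : Fin D.n → Prop} {i : ℕ} {e : D.VSocket}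
    (h : Verified g ok i e) : Listed g ok i e := by
  induction i generalizing e with
  | zero => exact h.elim
  | succ i ih =>
    rcases h with ⟨e', he', h⟩ | ⟨h, -⟩ | ⟨e', he', -, -, -, h, -⟩
    · exact Or.inr ⟨e', he', fun e'' he'' => ih (h e'' he'')⟩
    · exact Or.inl h
    · exact Or.inr ⟨e', he', h⟩

variable [Field F] [Fintype F]

/-- The message `μ` has no symbols but the values at `y` of linear forms in `Φ`, is not verified
with a value other than `c`, has `c` on its list if `L`, and is verified with `c` if `V`. -/
structure Msg.Sound {n : ℕ} (y : Fin n → F) (c : F) (Φ : Finset (Fin n → F)) (L V : Prop)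
    (μ : Msg F) : Prop where
  ne_erasure : μ ≠ .erasure
  symbols : ∀ a ∈ μ.symbols, ∃ κ ∈ Φ, a = κ ⬝ᵥ y
  eq_of_verified : ∀ a, μ = .verified a → a = c
  listed : L → c ∈ μ.symbols
  verified : V → μ = .verified c

/-- No incorrect symbol appears twice among the received symbol at `v` and the values of linear
forms from different incoming edges. -/
def NoCollisionAt {n : ℕ} {ι : Type} (c y : Fin n → F) (v : Fin n) (I : Finset ι)
    (Φ : ι → Finset (Fin n → F)) : Prop :=
  (∀ i ∈ I, ∀ κ ∈ Φ i, κ ⬝ᵥ y = y v → κ ⬝ᵥ y = c v) ∧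
    ∀ i ∈ I, ∀ j ∈ I, i ≠ j → ∀ κ ∈ Φ i, ∀ κ' ∈ Φ j, κ ⬝ᵥ y = κ' ⬝ᵥ y → κ ⬝ᵥ y = c v

open scoped Classical in
-- Without collisions both the verified values and the repeated symbols can only be `c v`, so `sel`
-- has no real choice and disagreement never occurs. Thus the abstract condition `VerifiedAt` forces
-- verification with the correct value.
theorem variableRule_sound {n : ℕ} {ι : Type} {c y : Fin n → F} {v : Fin n} {I : Finset ι}
    {Φ : ι → Finset (Fin n → F)} {L V : ι → Prop} {μ : ι → Msg F} {sel : Finset F → F}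
    (hsel : ∀ s : Finset F, s.Nonempty → sel s ∈ s)
    (hμ : ∀ i ∈ I, (μ i).Sound y (c v) (Φ i) (L i) (V i)) (hnc : NoCollisionAt c y v I Φ) :
    (variableRule ⊤ sel (y v) I μ).Sound y (c v) ({Pi.single v 1} ∪ I.biUnion Φ)
      (y v = c v ∨ ∃ i ∈ I, L i) (VerifiedAt I L V (y v = c v)) := by
  classical
  have hsingle : (Pi.single v 1 : Fin n → F) ⬝ᵥ y = y v := by simp
  have hr : ∃ κ ∈ ({Pi.single v 1} ∪ I.biUnion Φ : Finset (Fin n → F)), y v = κ ⬝ᵥ y :=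
    ⟨Pi.single v 1, by simp, hsingle.symm⟩
  have hsym : ∀ i ∈ I, ∀ a ∈ (μ i).symbols,
      ∃ κ ∈ ({Pi.single v 1} ∪ I.biUnion Φ : Finset (Fin n → F)), a = κ ⬝ᵥ y := by
    intro i hi a ha
    obtain ⟨κ, hκ, h⟩ := (hμ i hi).symbols a ha
    exact ⟨κ, Finset.mem_union_right _ (Finset.mem_biUnion.2 ⟨i, hi, hκ⟩), h⟩
  have hver : ∀ i ∈ I, ∀ a, μ i = .verified a → a ∈ (μ i).symbols := by
    intro i _ a h
    rw [h]
    simp [Msg.symbols]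
  unfold variableRule
  set Vs : Finset F := Finset.univ.filter fun a => ∃ i ∈ I, μ i = .verified a with hVs
  set Rs : Finset F := Finset.univ.filter fun a =>
    2 ≤ (I.filter fun i => a ∈ (μ i).symbols).card + (if a = y v then 1 else 0) with hRs
  have hV : Vs ⊆ {c v} := by
    intro a ha
    obtain ⟨i, hi, h⟩ := (Finset.mem_filter.1 ha).2
    exact Finset.mem_singleton.2 ((hμ i hi).eq_of_verified a h)
  -- A repeated symbol lies on two lists or equals the received symbol and lies on one list; these
  -- are the two clauses of `NoCollisionAt`.
  have hR : Rs ⊆ {c v} := by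
    intro a ha
    have h2 := (Finset.mem_filter.1 ha).2
    rw [Finset.mem_singleton]
    rcases Nat.lt_or_ge 1 (I.filter fun i => a ∈ (μ i).symbols).card with h | h
    · obtain ⟨i, hi, j, hj, hij⟩ := Finset.one_lt_card.1 h
      rw [Finset.mem_filter] at hi hj
      obtain ⟨κ, hκ, e1⟩ := (hμ i hi.1).symbols a hi.2
      obtain ⟨κ', hκ', e2⟩ := (hμ j hj.1).symbols a hj.2
      rw [e1]
      exact hnc.2 i hi.1 j hj.1 hij κ hκ κ' hκ' (e1.symm.trans e2)
    · have hay : a = y v := by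
        by_contra hne
        rw [if_neg hne] at h2
        omega
      rw [if_pos hay] at h2
      obtain ⟨i, hi⟩ := Finset.card_pos.1 (show 0 < (I.filter fun i => a ∈ (μ i).symbols).card by
        omega)
      rw [Finset.mem_filter] at hi
      obtain ⟨κ, hκ, e1⟩ := (hμ i hi.1).symbols a hi.2
      rw [e1]
      exact hnc.1 i hi.1 κ hκ (e1.symm.trans hay)
  have hV1 : ¬ 1 < Vs.card := not_lt.2 ((Finset.card_le_card hV).trans (by simp))
  have hverR : VerifiedAt I L V (y v = c v) → Vs.Nonempty ∨ Rs.Nonempty := by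
    rintro (⟨i, hi, h⟩ | ⟨hy, i, hi, h⟩ | ⟨i, hi, j, hj, hij, h, h'⟩)
    · exact Or.inl ⟨c v, Finset.mem_filter.2 ⟨Finset.mem_univ _, i, hi, (hμ i hi).verified h⟩⟩
    · refine Or.inr ⟨c v, Finset.mem_filter.2 ⟨Finset.mem_univ _, ?_⟩⟩
      rw [if_pos hy.symm]
      have : 0 < (I.filter fun i => c v ∈ (μ i).symbols).card :=
        Finset.card_pos.2 ⟨i, Finset.mem_filter.2 ⟨hi, (hμ i hi).listed h⟩⟩
      omega
    · refine Or.inr ⟨c v, Finset.mem_filter.2 ⟨Finset.mem_univ _, ?_⟩⟩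
      have : 1 < (I.filter fun i => c v ∈ (μ i).symbols).card :=
        Finset.one_lt_card.2 ⟨i, Finset.mem_filter.2 ⟨hi, (hμ i hi).listed h⟩,
          j, Finset.mem_filter.2 ⟨hj, (hμ j hj).listed h'⟩, hij⟩
      omega
  have hself : ∀ s : Finset F, s ⊆ {c v} → s.Nonempty → sel s = c v := fun s hs hne =>
    Finset.mem_singleton.1 (hs (hsel s hne))
  have hsoundV : ∀ s : Finset F, s ⊆ {c v} → s.Nonempty → (∃ κ ∈
      ({Pi.single v 1} ∪ I.biUnion Φ : Finset (Fin n → F)), c v = κ ⬝ᵥ y) →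
      (Msg.verified (sel s)).Sound y (c v) ({Pi.single v 1} ∪ I.biUnion Φ)
        (y v = c v ∨ ∃ i ∈ I, L i) (VerifiedAt I L V (y v = c v)) := by
    intro s hs hne hκ
    rw [hself s hs hne]
    exact ⟨by simp, by simpa [Msg.symbols] using hκ, by simp,
      by simp [Msg.symbols], fun _ => rfl⟩
  dsimp only
  split_ifs with h1 h2 h3 h4
  -- Sound messages are never erasures, so the first branch is reached only vacuously, at a node
  -- without incoming messages.
  · have hI : I = ∅ := by
      rcases h1 with h1 | h1
      · exact Finset.eq_empty_of_forall_notMem fun i hi => (hμ i hi).ne_erasure (h1 i hi)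
      · exact absurd h1 hV1
    subst hI
    refine ⟨by simp, by simp [Msg.symbols], by simp, ?_, ?_⟩
    · rintro (h | ⟨i, hi, -⟩)
      · simp [Msg.symbols, h]
      · simp at hi
    · rintro (⟨i, hi, -⟩ | ⟨-, i, hi, -⟩ | ⟨i, hi, -⟩) <;> simp at hi
  · refine hsoundV _ hV h2 ?_
    obtain ⟨a, ha⟩ := h2
    have hac := Finset.mem_singleton.1 (hV ha)
    obtain ⟨i, hi, h⟩ := (Finset.mem_filter.1 ha).2
    exact hac ▸ hsym i hi a (hver i hi a h)
  · refine hsoundV _ hR h3 ?_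
    obtain ⟨a, ha⟩ := h3
    have hac := Finset.mem_singleton.1 (hR ha)
    have h := (Finset.mem_filter.1 ha).2
    rw [← hac]
    have : 0 < (I.filter fun i => a ∈ (μ i).symbols).card := by
      split_ifs at h <;> omega
    obtain ⟨i, hi⟩ := Finset.card_pos.1 this
    rw [Finset.mem_filter] at hi
    exact hsym i hi.1 a hi.2
  · refine ⟨by simp, ?_, by simp, ?_, fun h => ?_⟩
    · intro a ha
      simp only [Msg.symbols, Finset.mem_union, Finset.mem_singleton, Finset.mem_biUnion] at ha
      rcases ha with rfl | ⟨i, hi, ha⟩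
      · exact hr
      · exact hsym i hi a ha
    · rintro (h | ⟨i, hi, h⟩)
      · simp [Msg.symbols, h]
      · simp only [Msg.symbols, Finset.mem_union, Finset.mem_singleton, Finset.mem_biUnion]
        exact Or.inr ⟨i, hi, (hμ i hi).listed h⟩
    · rcases hverR h with h | h
      · exact absurd h h2
      · exact absurd h h3
  · exact absurd le_top h4

open scoped Classical in
/-- The linear forms in the received symbols on the list that a check node sends along an edge. -/
noncomputable def checkForms (g : D.Graph) (h : D.VSocket → Fˣ)
    (Φ : D.VSocket → Finset (Fin D.n → F)) (e : D.VSocket) : Finset (Fin D.n → F) :=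
  (Fintype.piFinset fun e' => if e' ∈ checkSiblings g e then Φ e' else {0}).image fun b =>
    -((h e : F)⁻¹ • ∑ e' ∈ checkSiblings g e, (h e' : F) • b e')

theorem mem_checkForms {g : D.Graph} {h : D.VSocket → Fˣ} {Φ : D.VSocket → Finset (Fin D.n → F)}
    {e : D.VSocket} {κ : Fin D.n → F} : κ ∈ checkForms g h Φ e ↔
      ∃ b : D.VSocket → Fin D.n → F, (∀ e' ∈ checkSiblings g e, b e' ∈ Φ e') ∧
        κ = -((h e : F)⁻¹ • ∑ e' ∈ checkSiblings g e, (h e' : F) • b e') := by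
  classical
  simp only [checkForms, Finset.mem_image, Fintype.mem_piFinset]
  constructor
  · rintro ⟨b, hb, rfl⟩
    exact ⟨b, fun e' he' => by simpa [he'] using hb e', rfl⟩
  · rintro ⟨b, hb, rfl⟩
    refine ⟨fun e' => if e' ∈ checkSiblings g e then b e' else 0, fun e' => ?_, ?_⟩
    · by_cases he' : e' ∈ checkSiblings g e
      · simpa [he'] using hb e' he'
      · simp [he']
    · congr 2
      exact Finset.sum_congr rfl fun e' he' => by simp only [if_pos he']

theorem dotProduct_checkForm {g : D.Graph} {h : D.VSocket → Fˣ} {e : D.VSocket}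
    (b : D.VSocket → Fin D.n → F) (y : Fin D.n → F) :
    (-((h e : F)⁻¹ • ∑ e' ∈ checkSiblings g e, (h e' : F) • b e')) ⬝ᵥ y =
      -((h e : F)⁻¹ * ∑ e' ∈ checkSiblings g e, (h e' : F) * (b e' ⬝ᵥ y)) := by
  rw [neg_dotProduct, smul_dotProduct, sum_dotProduct]
  simp only [smul_dotProduct, smul_eq_mul]

/-- Solving the check equation maps a choice of incoming forms to an outgoing form. The codeword
itself satisfies the equation, so correct incoming symbols produce the correct outgoing one. -/
theorem checkRule_sound {g : D.Graph} {h : D.VSocket → Fˣ} {e : D.VSocket} {c : Fin D.n → F}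
    {y : Fin D.n → F} {Φ : D.VSocket → Finset (Fin D.n → F)} {L V : D.VSocket → Prop}
    {μ : D.VSocket → Msg F}
    (hc : (h e : F) * c e.1 + ∑ e' ∈ checkSiblings g e, (h e' : F) * c e'.1 = 0)
    (hμ : ∀ e' ∈ checkSiblings g e, (μ e').Sound y (c e'.1) (Φ e') (L e') (V e')) :
    (checkRule ⊤ (h e : F) (fun e' => (h e' : F)) (checkSiblings g e) μ).Sound y (c e.1)
      (checkForms g h Φ e) (∀ e' ∈ checkSiblings g e, L e') (∀ e' ∈ checkSiblings g e, V e') := by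
  classical
  have hh : (h e : F) ≠ 0 := (h e).ne_zero
  have hsolve : ∀ a s : F, (h e : F) * a + s = 0 ↔ a = -((h e : F)⁻¹ * s) := by
    intro a s
    constructor
    · intro h0
      field_simp
      linear_combination h0
    · rintro rfl
      field_simp
      ring
  have hce : c e.1 = -((h e : F)⁻¹ * ∑ e' ∈ checkSiblings g e, (h e' : F) * c e'.1) :=
    (hsolve _ _).1 hc
  unfold checkRule
  split_ifs with h1 h2
  · have hval : ∀ e' ∈ checkSiblings g e, μ e' = .verified (c e'.1) := by
      intro e' he'
      obtain ⟨a, ha⟩ := h1 e' he'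
      rw [ha, (hμ e' he').eq_of_verified a ha]
    have hsum : -((h e : F)⁻¹ * ∑ e' ∈ checkSiblings g e, (h e' : F) * (μ e').value.getD 0) =
        c e.1 := by
      rw [hce]
      congr 2
      exact Finset.sum_congr rfl fun e' he' => by simp [hval e' he', Msg.value]
    rw [hsum]
    refine ⟨by simp, ?_, by simp, by simp [Msg.symbols], fun _ => rfl⟩
    intro a ha
    rw [Msg.symbols, Finset.mem_singleton] at ha
    subst ha
    -- Verified values also come from forms, so that the support and size bounds for forms apply to
    -- them. The value `0` off the siblings is irrelevant.
    have hex : ∀ e', ∃ κ : Fin D.n → F, e' ∈ checkSiblings g e → κ ∈ Φ e' ∧ c e'.1 = κ ⬝ᵥ y := by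
      intro e'
      by_cases he' : e' ∈ checkSiblings g e
      · obtain ⟨κ, hκ, hk⟩ := (hμ e' he').symbols (c e'.1) (by simp [hval e' he', Msg.symbols])
        exact ⟨κ, fun _ => ⟨hκ, hk⟩⟩
      · exact ⟨0, fun h => absurd h he'⟩
    choose b hb using hex
    refine ⟨_, mem_checkForms.2 ⟨b, fun e' he' => (hb e' he').1, rfl⟩, ?_⟩
    rw [dotProduct_checkForm, hce]
    congr 2
    exact Finset.sum_congr rfl fun e' he' => by rw [(hb e' he').2]
  · obtain ⟨e', he', h2⟩ := h2
    exact absurd h2 (hμ e' he').ne_erasure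
  · dsimp only
    rw [if_pos le_top]
    refine ⟨by simp, ?_, by simp, ?_, fun hv => ?_⟩
    · intro a ha
      obtain ⟨b, hb, hab⟩ := ((@Finset.mem_filter _ _ (_) _ _).1 ha).2
      have hex : ∀ e', ∃ κ : Fin D.n → F, e' ∈ checkSiblings g e → κ ∈ Φ e' ∧ b e' = κ ⬝ᵥ y := by
        intro e'
        by_cases he' : e' ∈ checkSiblings g e
        · obtain ⟨κ, hκ, hk⟩ := (hμ e' he').symbols (b e') (hb e' he')
          exact ⟨κ, fun _ => ⟨hκ, hk⟩⟩
        · exact ⟨0, fun h => absurd h he'⟩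
      choose B hB using hex
      refine ⟨_, mem_checkForms.2 ⟨B, fun e' he' => (hB e' he').1, rfl⟩, ?_⟩
      rw [dotProduct_checkForm, (hsolve _ _).1 hab]
      congr 2
      exact Finset.sum_congr rfl fun e' he' => by rw [(hB e' he').2]
    · intro hl
      exact (@Finset.mem_filter _ _ (_) _ _).2 ⟨Finset.mem_univ _,
        fun e' => c e'.1, fun e' he' => (hμ e' he').listed (hl e' he'), hc⟩
    · exact absurd (fun e' he' => ⟨_, (hμ e' he').verified (hv e' he')⟩) h1

open scoped Classical in
/-- The linear forms in the received symbols on the list sent along an edge in round `i`. -/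
noncomputable def forms (g : D.Graph) (h : D.VSocket → Fˣ) : ℕ → D.VSocket → Finset (Fin D.n → F)
  | 0, e => {Pi.single e.1 1}
  | i + 1, e => {Pi.single e.1 1} ∪ (varSiblings e).biUnion (checkForms g h (forms g h i))

/-- There are no false collisions in the computation of the message sent along an edge in round
`i`. -/
def NoCollision (g : D.Graph) (h : D.VSocket → Fˣ) (c y : Fin D.n → F) : ℕ → D.VSocket → Prop
  | 0, _ => True
  | i + 1, e => NoCollisionAt c y e.1 (varSiblings e) (checkForms g h (forms g h i)) ∧
      ∀ e' ∈ varSiblings e, ∀ e'' ∈ checkSiblings g e', NoCollision g h c y i e''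

/-- The row of the parity-check matrix is expanded over edges instead of variable nodes, which is
valid with parallel edges, whose weights add up in one entry. -/
theorem checkEquation {g : D.Graph} {h : D.VSocket → Fˣ} {c : Fin D.n → F} (hc : c ∈ ldpcCode g h)
    (e : D.VSocket) :
    (h e : F) * c e.1 + ∑ e' ∈ checkSiblings g e, (h e' : F) * c e'.1 = 0 := by
  classical
  have h0 : (parityCheck g h).mulVec c (g e).1 = 0 := by
    have : (parityCheck g h).mulVec c = 0 := hc
    rw [this]; rfl
  rw [Matrix.mulVec, dotProduct] at h0
  have h1 : ∀ v, parityCheck g h (g e).1 v * c v =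
      ∑ e' : D.VSocket, if (g e').1 = (g e).1 then (if e'.1 = v then (h e' : F) * c e'.1 else 0)
        else 0 := by
    intro v
    rw [parityCheck, Finset.sum_mul, Finset.sum_filter]
    refine Finset.sum_congr rfl fun e' _ => ?_
    split_ifs with h1 h2 h3 <;> simp_all
  simp only [h1] at h0
  rw [Finset.sum_comm] at h0
  have h2 : ∀ e' : D.VSocket, (∑ v, if (g e').1 = (g e).1 then
      (if e'.1 = v then (h e' : F) * c e'.1 else 0) else 0) =
      if (g e').1 = (g e).1 then (h e' : F) * c e'.1 else 0 := by
    intro e'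
    split_ifs <;> simp
  simp only [h2] at h0
  rw [← Finset.sum_filter] at h0
  have h3 : (Finset.univ.filter fun e' => (g e').1 = (g e).1) = insert e (checkSiblings g e) := by
    ext e'
    simp only [Finset.mem_filter, Finset.mem_univ, true_and, Finset.mem_insert, mem_checkSiblings]
    constructor
    · intro h
      by_cases he : e' = e
      · exact Or.inl he
      · exact Or.inr ⟨h, he⟩
    · rintro (rfl | h)
      · rfl
      · exact h.1
  rw [h3, Finset.sum_insert (by simp [mem_checkSiblings])] at h0
  exact h0

/-- Induction over rounds. The check rule needs only that the word sent is a codeword; the variable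
rule needs the absence of collisions at its node. No tree assumption enters. -/
theorem variableMsg_sound {g : D.Graph} {h : D.VSocket → Fˣ} {c y : Fin D.n → F}
    (hc : c ∈ ldpcCode g h) {sel : Finset F → F} (hsel : ∀ s : Finset F, s.Nonempty → sel s ∈ s)
    {i : ℕ} {e : D.VSocket} (hnc : NoCollision g h c y i e) :
    (variableMsg ⊤ sel g h y i e).Sound y (c e.1) (forms g h i e)
      (Listed g (fun v => y v = c v) i e) (Verified g (fun v => y v = c v) i e) := by
  induction i generalizing e with
  | zero =>
    refine ⟨by simp [variableMsg], ?_, by simp [variableMsg], fun hl => ?_, fun h => h.elim⟩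
    · intro a ha
      simp only [variableMsg, Msg.symbols, Finset.mem_singleton] at ha
      exact ⟨Pi.single e.1 1, by simp [forms], by simp [ha]⟩
    · change y e.1 = c e.1 at hl
      simp [variableMsg, Msg.symbols, hl]
  | succ i ih =>
    refine variableRule_sound (c := c) hsel (fun e' he' => ?_) hnc.1
    have h1 : e'.1 = e.1 := (mem_varSiblings.1 he').1
    rw [← h1]
    exact checkRule_sound (checkEquation hc e') fun e'' he'' => ih (hnc.2 e' he' e'' he'')

open scoped Classical in
theorem lmpDecode_eq {g : D.Graph} {h : D.VSocket → Fˣ} {c y : Fin D.n → F}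
    (hc : c ∈ ldpcCode g h) {sel : Finset F → F} (hsel : ∀ s : Finset F, s.Nonempty → sel s ∈ s)
    {ℓ : ℕ} {v : Fin D.n}
    (hnc : NoCollisionAt c y v (Finset.univ.filter fun e : D.VSocket => e.1 = v)
      (checkForms g h (forms g h ℓ)))
    (hnc' : ∀ e : D.VSocket, e.1 = v → ∀ e' ∈ checkSiblings g e, NoCollision g h c y ℓ e')
    (hver : ∃ e : D.VSocket, e.1 = v ∧
      ∀ e' ∈ checkSiblings g e, Verified g (fun v => y v = c v) ℓ e') :
    lmpDecode ⊤ sel ℓ g h y v = some (c v) := by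
  have := variableRule_sound (c := c) (y := y) (v := v) (Φ := checkForms g h (forms g h ℓ))
    (I := Finset.univ.filter fun e : D.VSocket => e.1 = v)
    (L := fun e => ∀ e' ∈ checkSiblings g e, Listed g (fun v => y v = c v) ℓ e')
    (V := fun e => ∀ e' ∈ checkSiblings g e, Verified g (fun v => y v = c v) ℓ e')
    (μ := checkStep ⊤ g h (variableMsg ⊤ sel g h y ℓ)) hsel (fun e he => ?_) hnc
  · obtain ⟨e, he, hv⟩ := hver
    rw [lmpDecode, this.verified (Or.inl ⟨e, by simpa using he, hv⟩)]
    rfl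
  · have h1 : e.1 = v := by simpa using he
    rw [← h1]
    exact checkRule_sound (checkEquation hc e) fun e' he' =>
      variableMsg_sound hc hsel (hnc' e h1 e' he')

end Decoding

/-! ### Means over independent symbols -/

section ProductMean

variable {ι F : Type} [Fintype ι] [DecidableEq ι] [Fintype F]

/-- Mean of `f` over words with independent symbols, where the symbol at `i` has weights `w i`. -/
noncomputable def productMean (w : ι → F → ℝ) (f : (ι → F) → ℝ) : ℝ :=
  ∑ y : ι → F, (∏ i, w i (y i)) * f y

variable {w : ι → F → ℝ}

theorem productMean_add (f f' : (ι → F) → ℝ) :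
    productMean w (fun y => f y + f' y) = productMean w f + productMean w f' := by
  simp [productMean, mul_add, Finset.sum_add_distrib]

theorem productMean_sub (f f' : (ι → F) → ℝ) :
    productMean w (fun y => f y - f' y) = productMean w f - productMean w f' := by
  simp [productMean, mul_sub, Finset.sum_sub_distrib]

theorem productMean_sum {κ : Type} (K : Finset κ) (f : κ → (ι → F) → ℝ) :
    productMean w (fun y => ∑ k ∈ K, f k y) = ∑ k ∈ K, productMean w (f k) := by
  simp only [productMean, Finset.mul_sum]
  rw [Finset.sum_comm]

theorem productMean_mono (hw : ∀ i a, 0 ≤ w i a) {f f' : (ι → F) → ℝ} (h : ∀ y, f y ≤ f' y) :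
    productMean w f ≤ productMean w f' :=
  Finset.sum_le_sum fun y _ => mul_le_mul_of_nonneg_left (h y)
    (Finset.prod_nonneg fun i _ => hw i (y i))

theorem productMean_const (hw1 : ∀ i, ∑ a, w i a = 1) (c : ℝ) :
    productMean w (fun _ => c) = c := by
  have h := Finset.prod_univ_sum (fun _ : ι => (Finset.univ : Finset F)) w
  simp only [hw1, Finset.prod_const_one, Fintype.piFinset_univ] at h
  rw [productMean, ← Finset.sum_mul, ← h, one_mul]

theorem productMean_coord (hw1 : ∀ i, ∑ a, w i a = 1) (u : ι) (φ : F → ℝ) :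
    productMean w (fun y => φ (y u)) = ∑ a, w u a * φ a := by
  have h := Finset.prod_univ_sum (fun _ : ι => (Finset.univ : Finset F))
    (fun i a => w i a * if i = u then φ a else 1)
  rw [Fintype.piFinset_univ] at h
  rw [productMean]
  calc ∑ y : ι → F, (∏ i, w i (y i)) * φ (y u)
      = ∑ y : ι → F, ∏ i, (w i (y i) * if i = u then φ (y i) else 1) := by
        refine Finset.sum_congr rfl fun y _ => ?_
        rw [Finset.prod_mul_distrib]
        congr 1
        simp [Finset.prod_ite_eq']
    _ = ∏ i, ∑ a, w i a * (if i = u then φ a else 1) := h.symm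
    _ = ∑ a, w u a * φ a := by
        rw [Finset.prod_eq_single u]
        · simp
        · intro i _ hi
          simp [hi, hw1]
        · simp

/-- Exchanging symbols between two independent words does not change means. -/
theorem sum_sum_exchange (A : Finset ι) (G : (ι → F) → (ι → F) → ℝ) :
    ∑ y : ι → F, ∑ y' : ι → F, (∏ i, w i (y i)) * (∏ i, w i (y' i)) * G y y' =
      ∑ y : ι → F, ∑ y' : ι → F, (∏ i, w i (y i)) * (∏ i, w i (y' i)) *
        G (A.piecewise y y') (A.piecewise y' y) := by
  rw [← Fintype.sum_prod_type', ← Fintype.sum_prod_type']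
  let σ : (ι → F) × (ι → F) → (ι → F) × (ι → F) := fun z =>
    (A.piecewise z.1 z.2, A.piecewise z.2 z.1)
  have hσ : ∀ z, σ (σ z) = z := by
    rintro ⟨y, y'⟩
    ext i <;> by_cases h : i ∈ A <;> simp [σ, h]
  refine Fintype.sum_equiv ⟨σ, σ, hσ, hσ⟩ _ _ fun z => ?_
  have h1 := hσ z
  simp only [σ, Prod.ext_iff] at h1
  simp only [Equiv.coe_fn_mk, σ, h1.1, h1.2]
  congr 1
  rw [← Finset.prod_mul_distrib, ← Finset.prod_mul_distrib]
  refine Finset.prod_congr rfl fun i _ => ?_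
  by_cases h : i ∈ A <;> simp [h, mul_comm]

/-- Decoupling: adjoin an independent copy of the word and exchange the symbols outside `A`. Then
the first factor sees only one copy and the second only the other. -/
theorem productMean_mul_of_dependsOn (hw1 : ∀ i, ∑ a, w i a = 1) {f f' : (ι → F) → ℝ}
    {A B : Finset ι} (hf : DependsOn f (A : Set ι)) (hf' : DependsOn f' (B : Set ι)) (hAB : Disjoint A B) :
    productMean w (fun y => f y * f' y) = productMean w f * productMean w f' := by
  have h := sum_sum_exchange (w := w) A fun y y' => f y * f' y
  have e1 : ∀ y y' : ι → F, f (A.piecewise y y') = f y := fun y y' =>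
    hf fun i hi => by simp [Finset.mem_coe.1 hi]
  have e2 : ∀ y y' : ι → F, f' (A.piecewise y y') = f' y' := fun y y' =>
    hf' fun i hi => by
      have : i ∉ A := fun h => Finset.disjoint_left.1 hAB h (Finset.mem_coe.1 hi)
      simp [this]
  simp only [e1, e2] at h
  have h1 : ∑ y : ι → F, ∑ y' : ι → F, (∏ i, w i (y i)) * (∏ i, w i (y' i)) * (f y * f' y) =
      productMean w (fun y => f y * f' y) := by
    have := productMean_const (w := w) hw1 1
    simp only [productMean, mul_one] at this
    rw [productMean]
    refine Finset.sum_congr rfl fun y _ => ?_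
    rw [← Finset.sum_mul, ← Finset.mul_sum, this, mul_one]
  have h2 : ∑ y : ι → F, ∑ y' : ι → F, (∏ i, w i (y i)) * (∏ i, w i (y' i)) * (f y * f' y') =
      productMean w f * productMean w f' := by
    rw [productMean, productMean, Finset.sum_mul_sum]
    exact Finset.sum_congr rfl fun y _ => Finset.sum_congr rfl fun y' _ => by ring
  rw [← h1, h, h2]

/-- A symbol can be replaced by an independent copy. -/
theorem productMean_update (hw1 : ∀ i, ∑ a, w i a = 1) (u : ι) (f : (ι → F) → ℝ) :
    productMean w f = productMean w fun y => ∑ a, w u a * f (Function.update y u a) := by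
  -- Exchanging all coordinates but `u` is, up to the names of the two words, resampling at `u`.
  have h := sum_sum_exchange (w := w) (Finset.univ.erase u) fun y y' => f y
  have e1 : ∀ y y' : ι → F, (Finset.univ.erase u).piecewise y y' = Function.update y u (y' u) := by
    intro y y'
    ext i
    by_cases hi : i = u
    · subst hi; simp
    · simp [hi]
  simp only [e1] at h
  have h1 : ∑ y : ι → F, ∑ y' : ι → F, (∏ i, w i (y i)) * (∏ i, w i (y' i)) * f y =
      productMean w f := by
    have := productMean_const (w := w) hw1 1
    simp only [productMean, mul_one] at this
    rw [productMean]
    refine Finset.sum_congr rfl fun y _ => ?_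
    rw [← Finset.sum_mul, ← Finset.mul_sum, this, mul_one]
  rw [← h1, h, productMean]
  refine Finset.sum_congr rfl fun y _ => ?_
  rw [← productMean_coord hw1 u fun a => f (Function.update y u a), productMean, Finset.mul_sum]
  exact Finset.sum_congr rfl fun y' _ => by ring

end ProductMean

/-! ### Noise of the `q`-ary symmetric channel -/

section Noise

variable {F : Type} [Field F] [Fintype F] {n : ℕ} {p : ℝ}

theorem two_le_card_field : 2 ≤ Fintype.card F := Fintype.one_lt_card

/-- Mean over the received words if `c` is sent over the channel with error probability `p`. -/
noncomputable def noiseMean (p : ℝ) (c : Fin n → F) (f : (Fin n → F) → ℝ) : ℝ :=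
  productMean (fun v => qsc p (c v)) f

theorem noiseMean_mono (hp : 0 ≤ p ∧ p ≤ 1) {c : Fin n → F} {f f' : (Fin n → F) → ℝ}
    (h : ∀ y, f y ≤ f' y) : noiseMean p c f ≤ noiseMean p c f' :=
  productMean_mono (fun _ _ => qsc_nonneg hp.1 hp.2 two_le_card_field _ _) h

theorem noiseMean_const (c : Fin n → F) (a : ℝ) : noiseMean p c (fun _ => a) = a :=
  productMean_const (fun v => sum_qsc two_le_card_field (c v)) a

open scoped Classical in
theorem noiseMean_ne (c : Fin n → F) (v : Fin n) :
    noiseMean p c (fun y => if y v = c v then 0 else 1) = p := by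
  rw [noiseMean, productMean_coord (fun v => sum_qsc two_le_card_field (c v)) v
    fun a => if a = c v then 0 else 1]
  have h : ∀ a, qsc p (c v) a * (if a = c v then 0 else 1) =
      qsc p (c v) a - if a = c v then 1 - p else 0 := by
    intro a
    split_ifs with h
    · simp [qsc, h]
    · simp
  simp only [h, Finset.sum_sub_distrib, sum_qsc two_le_card_field, Finset.sum_ite_eq',
    Finset.mem_univ, if_true]
  ring

open scoped Classical in
/-- A nontrivial linear relation between the errors is satisfied with small probability. -/
theorem noiseMean_relation_le (hp : 0 ≤ p ∧ p ≤ 1) (c δ : Fin n → F) (u : Fin n) :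
    noiseMean p c (fun y => if δ u ≠ 0 ∧ y u ≠ c u ∧ δ ⬝ᵥ (y - c) = 0 then 1 else 0) ≤
      1 / (Fintype.card F - 1) := by
  have h2 : (2 : ℝ) ≤ Fintype.card F := by exact_mod_cast two_le_card_field (F := F)
  have hq : 0 ≤ 1 / ((Fintype.card F : ℝ) - 1) := div_nonneg zero_le_one (by linarith)
  have hw1 : ∀ v, ∑ a, qsc p (c v) a = 1 := fun v => sum_qsc two_le_card_field (c v)
  by_cases hδ : δ u = 0
  · simp only [hδ, ne_eq, not_true_eq_false, false_and, if_false]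
    rw [noiseMean_const]
    exact hq
  rw [noiseMean, productMean_update hw1 u]
  refine (noiseMean_mono hp (fun y => ?_)).trans
    (noiseMean_const c (1 / ((Fintype.card F : ℝ) - 1))).le
  -- the error at `u` is determined by the other errors
  set a₀ : F := c u - (δ u)⁻¹ * (δ ⬝ᵥ (Function.update y u (c u) - c)) with ha₀
  have hkey : ∀ a, δ ⬝ᵥ (Function.update y u a - c) = 0 → a = a₀ := by
    intro a ha
    have h1 : Function.update y u a - c = (Function.update y u (c u) - c) +
        Pi.single u (a - c u) := by
      ext v
      by_cases hv : v = u
      · subst hv; simp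
      · simp [hv]
    rw [h1, dotProduct_add, dotProduct_single] at ha
    rw [ha₀]
    field_simp
    linear_combination ha
  have hterm : ∀ a, qsc p (c u) a * (if δ u ≠ 0 ∧ Function.update y u a u ≠ c u ∧
      δ ⬝ᵥ (Function.update y u a - c) = 0 then 1 else 0) ≤
      if a = a₀ then 1 / ((Fintype.card F : ℝ) - 1) else 0 := by
    intro a
    split_ifs with h h' h'
    · have hne : c u ≠ a := fun h0 => h.2.1 (by simp [h0])
      rw [mul_one, qsc, if_neg hne]
      exact div_le_div_of_nonneg_right hp.2 (by linarith)
    · exact absurd (hkey a h.2.2) h'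
    · simpa using hq
    · simp
  refine (Finset.sum_le_sum fun a _ => hterm a).trans ?_
  simp

end Noise

/-! ### Neighborhoods and the probability of false collisions -/

section Neighborhoods

variable {D : NodeDegrees}

/-- The variable nodes whose received symbols determine the message along an edge in round `i`. -/
noncomputable def nbhd (g : D.Graph) : ℕ → D.VSocket → Finset (Fin D.n)
  | 0, e => {e.1}
  | i + 1, e => {e.1} ∪ (varSiblings e).biUnion fun e' => (checkSiblings g e').biUnion (nbhd g i)

/-- The variable nodes that determine the message from a check node along an edge. -/
noncomputable def checkNbhd (g : D.Graph) (i : ℕ) (e : D.VSocket) : Finset (Fin D.n) :=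
  (checkSiblings g e).biUnion (nbhd g i)

/-- The neighborhood that determines the message along an edge in round `i` is a tree. -/
def TreeBehind (g : D.Graph) : ℕ → D.VSocket → Prop
  | 0, _ => True
  | i + 1, e => (∀ e' ∈ varSiblings e, e.1 ∉ checkNbhd g i e') ∧
      (∀ e' ∈ varSiblings e, ∀ e'' ∈ varSiblings e, e' ≠ e'' →
        Disjoint (checkNbhd g i e') (checkNbhd g i e'')) ∧
      ∀ e' ∈ varSiblings e, (∀ a ∈ checkSiblings g e', ∀ b ∈ checkSiblings g e', a ≠ b →
        Disjoint (nbhd g i a) (nbhd g i b)) ∧ ∀ a ∈ checkSiblings g e', TreeBehind g i a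

open scoped Classical in
theorem card_varSiblings_le {d : ℕ} (hd : D.BoundedBy d) (e : D.VSocket) :
    (varSiblings e).card ≤ d :=
  calc (varSiblings e).card ≤ (Finset.univ.filter fun e' : D.VSocket => e'.1 = e.1).card :=
        Finset.card_le_card fun e' he' => by
          simpa using (mem_varSiblings.1 he').1
    _ ≤ d := by
      convert (NodeDegrees.card_vsocket_fiber e.1).le.trans (hd.dv_le _)

open scoped Classical in
theorem card_checkSiblings_le {d : ℕ} (hd : D.BoundedBy d) (g : D.Graph) (e : D.VSocket) :
    (checkSiblings g e).card ≤ d :=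
  calc (checkSiblings g e).card ≤ (Finset.univ.filter fun s : D.CSocket => s.1 = (g e).1).card :=
        Finset.card_le_card_of_injOn g (fun e' he' => by
          simpa using (mem_checkSiblings.1 he').1) g.injective.injOn
    _ ≤ d := by
      convert (NodeDegrees.card_csocket_fiber (g e).1).le.trans (hd.dc_le _)

/-- Bound for the size of a neighborhood. -/
def nbhdBound (d : ℕ) : ℕ → ℕ
  | 0 => 1
  | i + 1 => 1 + d * (d * nbhdBound d i)

/-- Bound for the number of linear forms on a list. -/
def formBound (d : ℕ) : ℕ → ℕ
  | 0 => 1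
  | i + 1 => 1 + d * formBound d i ^ d

theorem one_le_formBound (d i : ℕ) : 1 ≤ formBound d i := by
  cases i
  · exact le_rfl
  · exact Nat.le_add_right _ _

theorem card_checkNbhd_le_of {d b : ℕ} (hd : D.BoundedBy d) {g : D.Graph} {i : ℕ}
    (h : ∀ e, (nbhd g i e).card ≤ b) (e : D.VSocket) : (checkNbhd g i e).card ≤ d * b :=
  (Finset.card_biUnion_le_card_mul _ _ b fun e' _ => h e').trans
    (Nat.mul_le_mul_right _ (card_checkSiblings_le hd g e))

theorem card_nbhd_le {d : ℕ} (hd : D.BoundedBy d) (g : D.Graph) (i : ℕ) (e : D.VSocket) :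
    (nbhd g i e).card ≤ nbhdBound d i := by
  induction i generalizing e with
  | zero => simp [nbhd, nbhdBound]
  | succ i ih =>
    refine (Finset.card_union_le _ _).trans (Nat.add_le_add (by simp) ?_)
    exact (Finset.card_biUnion_le_card_mul _ _ (d * nbhdBound d i) fun e' _ =>
      card_checkNbhd_le_of hd ih e').trans (Nat.mul_le_mul_right _ (card_varSiblings_le hd e))

variable {F : Type} [Field F] [Fintype F]

theorem card_checkForms_le {d M : ℕ} (hd : D.BoundedBy d) {g : D.Graph} {h : D.VSocket → Fˣ}
    {Φ : D.VSocket → Finset (Fin D.n → F)} (hM : 1 ≤ M) (hΦ : ∀ e, (Φ e).card ≤ M)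
    (e : D.VSocket) : (checkForms g h Φ e).card ≤ M ^ d := by
  classical
  refine Finset.card_image_le.trans ?_
  rw [Fintype.card_piFinset]
  calc ∏ e', (if e' ∈ checkSiblings g e then Φ e' else {0}).card
      ≤ ∏ e' : D.VSocket, (if e' ∈ checkSiblings g e then M else 1) := by
        refine Finset.prod_le_prod' fun e' _ => ?_
        split_ifs
        · exact hΦ e'
        · simp
    -- Off the siblings the choices are singletons, so the bound does not grow with the length of
    -- the code.
    _ = M ^ (checkSiblings g e).card := by simp [Finset.prod_ite_mem]
    _ ≤ M ^ d := Nat.pow_le_pow_right hM (card_checkSiblings_le hd g e)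

theorem card_forms_le {d : ℕ} (hd : D.BoundedBy d) (g : D.Graph) (h : D.VSocket → Fˣ) (i : ℕ)
    (e : D.VSocket) : (forms g h i e).card ≤ formBound d i := by
  classical
  induction i generalizing e with
  | zero => simp [forms, formBound]
  | succ i ih =>
    refine (Finset.card_union_le _ _).trans (Nat.add_le_add (by simp) ?_)
    exact (Finset.card_biUnion_le_card_mul _ _ (formBound d i ^ d) fun e' _ =>
      card_checkForms_le hd (one_le_formBound d i) ih e').trans
        (Nat.mul_le_mul_right _ (card_varSiblings_le hd e))

theorem mem_checkNbhd_of_checkForms {g : D.Graph} {h : D.VSocket → Fˣ} {i : ℕ}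
    (hf : ∀ e, ∀ κ ∈ forms g h i e, ∀ u, κ u ≠ 0 → u ∈ nbhd g i e) {e : D.VSocket}
    {κ : Fin D.n → F} (hκ : κ ∈ checkForms g h (forms g h i) e) {u : Fin D.n} (hu : κ u ≠ 0) :
    u ∈ checkNbhd g i e := by
  obtain ⟨b, hb, rfl⟩ := mem_checkForms.1 hκ
  by_contra hcon
  refine hu ?_
  rw [Pi.neg_apply, Pi.smul_apply, Finset.sum_apply, Finset.sum_eq_zero, smul_zero, neg_zero]
  intro e' he'
  rw [Pi.smul_apply]
  by_contra h0
  exact hcon (Finset.mem_biUnion.2 ⟨e', he', hf e' _ (hb e' he') u fun h1 => h0 (by rw [h1]; simp)⟩)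

/-- Supports of forms lie in the neighborhoods, so disjoint neighborhoods prevent a relation between
two forms from being trivial. -/
theorem mem_nbhd_of_forms {g : D.Graph} {h : D.VSocket → Fˣ} {i : ℕ} (e : D.VSocket)
    (κ : Fin D.n → F) (hκ : κ ∈ forms g h i e) (u : Fin D.n) (hu : κ u ≠ 0) :
    u ∈ nbhd g i e := by
  classical
  have hsingle : ∀ u v : Fin D.n, (Pi.single v 1 : Fin D.n → F) u ≠ 0 → u = v := fun u v h => by
    by_contra hne
    exact h (Pi.single_eq_of_ne hne 1)
  induction i generalizing e κ u with
  | zero =>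
    rw [forms, Finset.mem_singleton] at hκ
    subst hκ
    simpa [nbhd] using hsingle _ _ hu
  | succ i ih =>
    rw [forms, Finset.mem_union, Finset.mem_singleton, Finset.mem_biUnion] at hκ
    rw [nbhd, Finset.mem_union, Finset.mem_singleton, Finset.mem_biUnion]
    rcases hκ with rfl | ⟨e', he', hκ⟩
    · exact Or.inl (hsingle _ _ hu)
    · exact Or.inr ⟨e', he', mem_checkNbhd_of_checkForms ih hκ hu⟩

theorem dotProduct_of_mem_checkForms {g : D.Graph} {h : D.VSocket → Fˣ} {c : Fin D.n → F}
    (hc : c ∈ ldpcCode g h) {Φ : D.VSocket → Finset (Fin D.n → F)}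
    (hΦ : ∀ e, ∀ κ ∈ Φ e, κ ⬝ᵥ c = c e.1) {e : D.VSocket} {κ : Fin D.n → F}
    (hκ : κ ∈ checkForms g h Φ e) : κ ⬝ᵥ c = c e.1 := by
  obtain ⟨b, hb, rfl⟩ := mem_checkForms.1 hκ
  rw [dotProduct_checkForm]
  have h1 : ∑ e' ∈ checkSiblings g e, (h e' : F) * (b e' ⬝ᵥ c) =
      ∑ e' ∈ checkSiblings g e, (h e' : F) * c e'.1 :=
    Finset.sum_congr rfl fun e' he' => by rw [hΦ e' _ (hb e' he')]
  have h2 := checkEquation hc e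
  have hh : (h e : F) ≠ 0 := (h e).ne_zero
  rw [h1]
  field_simp
  linear_combination -h2

/-- Every form reproduces the correct symbol from the codeword. Hence an equality between two values
at the received word is a linear relation between errors only. -/
theorem dotProduct_of_mem_forms {g : D.Graph} {h : D.VSocket → Fˣ} {c : Fin D.n → F}
    (hc : c ∈ ldpcCode g h) (i : ℕ) (e : D.VSocket) (κ : Fin D.n → F) (hκ : κ ∈ forms g h i e) :
    κ ⬝ᵥ c = c e.1 := by
  classical
  induction i generalizing e κ with
  | zero =>
    rw [forms, Finset.mem_singleton] at hκ
    simp [hκ]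
  | succ i ih =>
    rw [forms, Finset.mem_union, Finset.mem_singleton, Finset.mem_biUnion] at hκ
    rcases hκ with rfl | ⟨e', he', hκ⟩
    · simp
    · rw [dotProduct_of_mem_checkForms hc ih hκ, (mem_varSiblings.1 he').1]

variable {p : ℝ}

theorem le_sum_of_mem {κ : Type} {K : Finset κ} {f : κ → ℝ} (h0 : ∀ k, 0 ≤ f k) {k : κ}
    (hk : k ∈ K) {a : ℝ} (h : a ≤ f k) : a ≤ ∑ k ∈ K, f k :=
  h.trans (Finset.single_le_sum (fun k _ => h0 k) hk)

theorem noiseMean_sum {n : ℕ} {κ : Type} (c : Fin n → F) (K : Finset κ) (f : κ → (Fin n → F) → ℝ) :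
    noiseMean p c (fun y => ∑ k ∈ K, f k y) = ∑ k ∈ K, noiseMean p c (f k) :=
  productMean_sum K f

theorem noiseMean_add {n : ℕ} (c : Fin n → F) (f f' : (Fin n → F) → ℝ) :
    noiseMean p c (fun y => f y + f' y) = noiseMean p c f + noiseMean p c f' :=
  productMean_add f f'

open scoped Classical in
/-- False collisions at a variable node are unlikely in a large field, if the linear forms from
different edges depend on different symbols. -/
theorem noiseMean_not_noCollisionAt_le (hp : 0 ≤ p ∧ p ≤ 1) {n : ℕ} {ι : Type}
    {c : Fin n → F} {v : Fin n} {I : Finset ι} {Φ : ι → Finset (Fin n → F)} {A : ι → Finset (Fin n)}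
    {d b M : ℕ} (hI : I.card ≤ d) (hM : ∀ i ∈ I, (Φ i).card ≤ M) (hb : ∀ i ∈ I, (A i).card ≤ b)
    (hc : ∀ i ∈ I, ∀ κ ∈ Φ i, κ ⬝ᵥ c = c v)
    (hA : ∀ i ∈ I, ∀ κ ∈ Φ i, ∀ u, κ u ≠ 0 → u ∈ A i) (hv : ∀ i ∈ I, v ∉ A i)
    (hdisj : ∀ i ∈ I, ∀ j ∈ I, i ≠ j → Disjoint (A i) (A j)) :
    noiseMean p c (fun y => if NoCollisionAt c y v I Φ then 0 else 1) ≤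
      (d * M * b + d * d * (M * M * b) : ℕ) * (1 / (Fintype.card F - 1)) := by
  have h2 : (2 : ℝ) ≤ Fintype.card F := by exact_mod_cast two_le_card_field (F := F)
  set η : ℝ := 1 / ((Fintype.card F : ℝ) - 1) with hη
  have hη0 : 0 ≤ η := div_nonneg zero_le_one (by linarith)
  -- `E δ u` is the indicator of a relation `δ` between the errors that involves a wrong symbol at
  -- `u`; only these three properties are used.
  obtain ⟨E, hE0, hE1, hEη⟩ : ∃ E : (Fin n → F) → Fin n → (Fin n → F) → ℝ,
      (∀ δ u y, 0 ≤ E δ u y) ∧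
      (∀ δ u y, δ u ≠ 0 → y u ≠ c u → δ ⬝ᵥ (y - c) = 0 → 1 ≤ E δ u y) ∧
      ∀ δ u, noiseMean p c (E δ u) ≤ η := by
    refine ⟨fun δ u y => if δ u ≠ 0 ∧ y u ≠ c u ∧ δ ⬝ᵥ (y - c) = 0 then 1 else 0,
      fun δ u y => ?_, fun δ u y h1 h2 h3 => ?_, fun δ u => noiseMean_relation_le hp c δ u⟩
    · dsimp only; split_ifs <;> norm_num
    · simp only [if_pos (And.intro h1 (And.intro h2 h3)), le_refl]
  have hex : ∀ (κ y : Fin n → F), κ ⬝ᵥ y ≠ κ ⬝ᵥ c → ∃ u, κ u ≠ 0 ∧ y u ≠ c u := by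
    intro κ y hne
    by_contra hcon
    push Not at hcon
    refine hne (Finset.sum_congr rfl fun u _ => ?_)
    by_cases h : κ u = 0
    · simp [h]
    · rw [hcon u h]
  -- An incorrect value of `κ` requires a wrong symbol at some `u` in its support. By disjointness
  -- `u` is not in the support of the form it collides with, so the difference of the two forms is
  -- nonzero at `u`. The sums range over all such witnesses.
  have hpt : ∀ y, (if NoCollisionAt c y v I Φ then (0 : ℝ) else 1) ≤
      ∑ i ∈ I, ∑ κ ∈ Φ i, ∑ u ∈ A i, E (κ - Pi.single v 1) u y +
        ∑ i ∈ I, ∑ j ∈ I, ∑ κ ∈ Φ i, ∑ κ' ∈ Φ j, ∑ u ∈ A i, E (κ - κ') u y := by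
    intro y
    have hs1 : 0 ≤ ∑ i ∈ I, ∑ κ ∈ Φ i, ∑ u ∈ A i, E (κ - Pi.single v 1) u y :=
      Finset.sum_nonneg fun i _ => Finset.sum_nonneg fun κ _ => Finset.sum_nonneg fun u _ => hE0 _ _ _
    have hs2 : 0 ≤ ∑ i ∈ I, ∑ j ∈ I, ∑ κ ∈ Φ i, ∑ κ' ∈ Φ j, ∑ u ∈ A i, E (κ - κ') u y :=
      Finset.sum_nonneg fun i _ => Finset.sum_nonneg fun j _ => Finset.sum_nonneg fun κ _ =>
        Finset.sum_nonneg fun κ' _ => Finset.sum_nonneg fun u _ => hE0 _ _ _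
    split_ifs with h
    · exact add_nonneg hs1 hs2
    · rw [NoCollisionAt, not_and_or] at h
      push Not at h
      rcases h with ⟨i, hi, κ, hκ, h1, h2⟩ | ⟨i, hi, j, hj, hij, κ, hκ, κ', hκ', h1, h2⟩
      · obtain ⟨u, hu, hyu⟩ := hex κ y (by rwa [hc i hi κ hκ])
        have huA := hA i hi κ hκ u hu
        have huv : u ≠ v := fun h => hv i hi (h ▸ huA)
        have hval : 1 ≤ E (κ - Pi.single v 1) u y := by
          refine hE1 _ _ _ (by simpa [huv] using hu) hyu ?_
          rw [dotProduct_sub, sub_dotProduct, sub_dotProduct, hc i hi κ hκ, h1]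
          simp
        refine le_add_of_le_of_nonneg ?_ hs2
        refine le_sum_of_mem (fun _ => Finset.sum_nonneg fun _ _ => Finset.sum_nonneg
          fun _ _ => hE0 _ _ _) hi ?_
        refine le_sum_of_mem (fun _ => Finset.sum_nonneg fun _ _ => hE0 _ _ _) hκ ?_
        exact le_sum_of_mem (fun _ => hE0 _ _ _) huA hval
      · obtain ⟨u, hu, hyu⟩ := hex κ y (by rwa [hc i hi κ hκ])
        have huA := hA i hi κ hκ u hu
        have hu' : κ' u = 0 := by
          by_contra h
          exact Finset.disjoint_left.1 (hdisj i hi j hj hij) huA (hA j hj κ' hκ' u h)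
        have hval : 1 ≤ E (κ - κ') u y := by
          refine hE1 _ _ _ (by simpa [hu'] using hu) hyu ?_
          rw [dotProduct_sub, sub_dotProduct, sub_dotProduct, hc i hi κ hκ, hc j hj κ' hκ', h1]
          simp
        refine le_add_of_nonneg_of_le hs1 ?_
        refine le_sum_of_mem (fun _ => Finset.sum_nonneg fun _ _ => Finset.sum_nonneg
          fun _ _ => Finset.sum_nonneg fun _ _ => Finset.sum_nonneg fun _ _ => hE0 _ _ _) hi ?_
        refine le_sum_of_mem (fun _ => Finset.sum_nonneg fun _ _ => Finset.sum_nonneg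
          fun _ _ => Finset.sum_nonneg fun _ _ => hE0 _ _ _) hj ?_
        refine le_sum_of_mem (fun _ => Finset.sum_nonneg fun _ _ => Finset.sum_nonneg
          fun _ _ => hE0 _ _ _) hκ ?_
        refine le_sum_of_mem (fun _ => Finset.sum_nonneg fun _ _ => hE0 _ _ _) hκ' ?_
        exact le_sum_of_mem (fun _ => hE0 _ _ _) huA hval
  refine (noiseMean_mono hp hpt).trans ?_
  simp only [noiseMean_add, noiseMean_sum]
  have hsum : ∀ {κ : Type} (K : Finset κ) (f : κ → ℝ) (m k : ℕ), K.card ≤ k →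
      (∀ x ∈ K, f x ≤ m * η) → ∑ x ∈ K, f x ≤ (k * m : ℕ) * η := by
    intro κ K f m k hk hf
    refine (Finset.sum_le_sum hf).trans ?_
    rw [Finset.sum_const, nsmul_eq_mul, Nat.cast_mul, mul_assoc]
    exact mul_le_mul_of_nonneg_right (by exact_mod_cast hk) (by positivity)
  have h1 := hsum I _ (M * b) d hI fun i hi => hsum (Φ i)
    (fun κ => ∑ u ∈ A i, noiseMean p c (E (κ - Pi.single v 1) u)) b M (hM i hi) fun κ _ => by
      simpa using hsum (A i) (fun u => noiseMean p c (E (κ - Pi.single v 1) u)) 1 b (hb i hi)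
        fun u _ => by simpa using hEη _ u
  have h2 := hsum I _ (d * (M * (M * b))) d hI fun i hi => hsum I
    (fun j => ∑ κ ∈ Φ i, ∑ κ' ∈ Φ j, ∑ u ∈ A i, noiseMean p c (E (κ - κ') u)) (M * (M * b)) d hI
      fun j hj => hsum (Φ i) (fun κ => ∑ κ' ∈ Φ j, ∑ u ∈ A i, noiseMean p c (E (κ - κ') u)) (M * b) M
        (hM i hi) fun κ _ => hsum (Φ j) (fun κ' => ∑ u ∈ A i, noiseMean p c (E (κ - κ') u)) b M
          (hM j hj) fun κ' _ => by
            simpa using hsum (A i) (fun u => noiseMean p c (E (κ - κ') u)) 1 b (hb i hi)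
              fun u _ => by simpa using hEη _ u
  refine (add_le_add h1 h2).trans (le_of_eq ?_)
  push_cast
  ring

/-- The constant in the bound for the probability of false collisions. -/
def collisionBound (d : ℕ) : ℕ → ℕ
  | 0 => 0
  | i + 1 => d * formBound d i ^ d * (d * nbhdBound d i) +
      d * d * (formBound d i ^ d * formBound d i ^ d * (d * nbhdBound d i)) +
        d * (d * collisionBound d i)

open scoped Classical in
-- Union bound over a collision at `v` itself and collisions inside the incoming messages. A general
-- set `I` of edges at `v` covers both the messages along an edge and the final decision.
theorem noiseMean_collision_step (hp : 0 ≤ p ∧ p ≤ 1) {d : ℕ} (hd : D.BoundedBy d) {g : D.Graph}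
    {h : D.VSocket → Fˣ} {c : Fin D.n → F} (hc : c ∈ ldpcCode g h) {i : ℕ} {v : Fin D.n}
    {I : Finset D.VSocket} (hI : I.card ≤ d) (hIv : ∀ e ∈ I, e.1 = v)
    (hv : ∀ e ∈ I, v ∉ checkNbhd g i e)
    (hdisj : ∀ e ∈ I, ∀ e' ∈ I, e ≠ e' → Disjoint (checkNbhd g i e) (checkNbhd g i e'))
    (ih : ∀ e ∈ I, ∀ e' ∈ checkSiblings g e,
      noiseMean p c (fun y => if NoCollision g h c y i e' then 0 else 1) ≤
        collisionBound d i * (1 / (Fintype.card F - 1))) :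
    noiseMean p c (fun y => if NoCollisionAt c y v I (checkForms g h (forms g h i)) ∧
        ∀ e ∈ I, ∀ e' ∈ checkSiblings g e, NoCollision g h c y i e' then 0 else 1) ≤
      collisionBound d (i + 1) * (1 / (Fintype.card F - 1)) := by
  have h2 : (2 : ℝ) ≤ Fintype.card F := by exact_mod_cast two_le_card_field (F := F)
  set η : ℝ := 1 / ((Fintype.card F : ℝ) - 1) with hη
  have hη0 : 0 ≤ η := div_nonneg zero_le_one (by linarith)
  have h1 := noiseMean_not_noCollisionAt_le hp (c := c) (v := v) (I := I)
    (Φ := checkForms g h (forms g h i)) (A := checkNbhd g i) (d := d) (b := d * nbhdBound d i)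
    (M := formBound d i ^ d) hI
    (fun e _ => card_checkForms_le hd (one_le_formBound d i) (card_forms_le hd g h i) e)
    (fun e _ => card_checkNbhd_le_of hd (card_nbhd_le hd g i) e)
    (fun e he κ hκ => by
      rw [dotProduct_of_mem_checkForms hc (dotProduct_of_mem_forms hc i) hκ, hIv e he])
    (fun e _ κ hκ u hu => mem_checkNbhd_of_checkForms mem_nbhd_of_forms hκ hu) hv hdisj
  have hpt : ∀ y, (if NoCollisionAt c y v I (checkForms g h (forms g h i)) ∧
      ∀ e ∈ I, ∀ e' ∈ checkSiblings g e, NoCollision g h c y i e' then (0 : ℝ) else 1) ≤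
      (if NoCollisionAt c y v I (checkForms g h (forms g h i)) then 0 else 1) +
        ∑ e ∈ I, ∑ e' ∈ checkSiblings g e, if NoCollision g h c y i e' then 0 else 1 := by
    intro y
    have h01 : ∀ e', (0 : ℝ) ≤ if NoCollision g h c y i e' then 0 else 1 := fun e' => by
      split_ifs <;> norm_num
    have hs : (0 : ℝ) ≤ ∑ e ∈ I, ∑ e' ∈ checkSiblings g e,
        if NoCollision g h c y i e' then 0 else 1 :=
      Finset.sum_nonneg fun e _ => Finset.sum_nonneg fun e' _ => h01 e'
    by_cases hA : NoCollisionAt c y v I (checkForms g h (forms g h i))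
    · rw [if_pos hA, zero_add]
      split_ifs with hB
      · exact hs
      · have hB' : ¬ ∀ e ∈ I, ∀ e' ∈ checkSiblings g e, NoCollision g h c y i e' :=
          fun h => hB ⟨hA, h⟩
        push Not at hB'
        obtain ⟨e, he, e', he', hn⟩ := hB'
        refine le_sum_of_mem (fun e => Finset.sum_nonneg fun e' _ => h01 e') he ?_
        refine le_sum_of_mem h01 he' ?_
        rw [if_neg hn]
    · rw [if_neg hA, if_neg fun h => hA h.1]
      linarith
  refine (noiseMean_mono hp hpt).trans ?_
  simp only [noiseMean_add, noiseMean_sum]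
  have h3 : ∑ e ∈ I, ∑ e' ∈ checkSiblings g e,
      noiseMean p c (fun y => if NoCollision g h c y i e' then 0 else 1) ≤
      d * (d * (collisionBound d i * η)) := by
    have hb0 : 0 ≤ (collisionBound d i : ℝ) * η := by positivity
    refine (Finset.sum_le_sum fun e he => (Finset.sum_le_sum fun e' he' => ih e he e' he').trans
      (?_ : _ ≤ (d : ℝ) * (collisionBound d i * η))).trans ?_
    · rw [Finset.sum_const, nsmul_eq_mul]
      exact mul_le_mul_of_nonneg_right (by exact_mod_cast card_checkSiblings_le hd g e) hb0
    · rw [Finset.sum_const, nsmul_eq_mul]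
      exact mul_le_mul_of_nonneg_right (by exact_mod_cast hI) (by positivity)
  refine (add_le_add h1 h3).trans (le_of_eq ?_)
  rw [collisionBound]
  push_cast
  ring

open scoped Classical in
theorem noiseMean_not_noCollision_le (hp : 0 ≤ p ∧ p ≤ 1) {d : ℕ} (hd : D.BoundedBy d) {g : D.Graph}
    {h : D.VSocket → Fˣ} {c : Fin D.n → F} (hc : c ∈ ldpcCode g h) (i : ℕ) (e : D.VSocket)
    (ht : TreeBehind g i e) :
    noiseMean p c (fun y => if NoCollision g h c y i e then 0 else 1) ≤
      collisionBound d i * (1 / (Fintype.card F - 1)) := by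
  induction i generalizing e with
  | zero => simp [NoCollision, collisionBound, noiseMean_const]
  | succ i ih =>
    refine le_of_eq_of_le ?_ (noiseMean_collision_step hp hd hc (card_varSiblings_le hd e)
      (fun e' he' => (mem_varSiblings.1 he').1) ht.1 ht.2.1
      fun e' he' e'' he'' => ih e'' ((ht.2.2 e' he').2 e'' he''))
    congr 1
    ext y
    exact if_congr Iff.rfl rfl rfl

end Neighborhoods

/-! ### Message probabilities as means over the noise -/

namespace MsgProb

open scoped Classical in
/-- The message probabilities in a deterministic situation. -/
noncomputable def indicator (L V : Prop) (h : V → L) : MsgProb :=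
  ⟨(if L then 0 else 1, if V then 0 else 1), by
    by_cases hV : V
    · simp [hV, h hV]
    · by_cases hL : L <;> simp [hV, hL]⟩

theorem checkNode_perm {l l' : List MsgProb} (h : l.Perm l') : checkNode l = checkNode l' := by
  refine Subtype.ext ?_
  simp only [checkNode]
  rw [(h.map fun v => 1 - v.1.1).prod_eq, (h.map fun v => 1 - v.1.2).prod_eq]

theorem allMissing_perm {l l' : List MsgProb} (h : l.Perm l') : allMissing l = allMissing l' :=
  (h.map _).prod_eq

/-- The recursion describes a symmetric function, though it does not look symmetric. This frees the
comparison from the order in which siblings are listed. -/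
theorem oneUnverified_perm {l l' : List MsgProb} (h : l.Perm l') :
    oneUnverified l = oneUnverified l' := by
  induction h with
  | nil => rfl
  | cons x h ih => rw [oneUnverified, oneUnverified, ih, allMissing_perm h]
  | swap x y l =>
    simp only [oneUnverified, allMissing_cons]
    ring
  | trans _ _ ih1 ih2 => exact ih1.trans ih2

theorem varNode_perm {p : ℝ} (hp : 0 ≤ p ∧ p ≤ 1) {l l' : List MsgProb} (h : l.Perm l') :
    varNode hp l = varNode hp l' := by
  refine Subtype.ext ?_
  simp only [varNode]
  rw [allMissing_perm h, oneUnverified_perm h]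

variable {κ : Type} {A B : κ → Prop} (hBA : ∀ x, B x → A x)

open scoped Classical in
theorem prod_one_sub_ite (P : κ → Prop) (l : List κ) :
    (l.map fun x => 1 - if P x then (0 : ℝ) else 1).prod = if ∀ x ∈ l, P x then 1 else 0 := by
  induction l with
  | nil => simp
  | cons x l ih =>
    rw [List.map_cons, List.prod_cons, ih]
    by_cases h : P x
    · simp [h]
    · simp [h]

open scoped Classical in
-- On deterministic inputs the probability rule reduces to the logical rule of the decoder. The two
-- are then linked by averaging, as the rules are affine in each input.
theorem checkNode_indicator (l : List κ) :
    checkNode (l.map fun x => indicator (A x) (B x) (hBA x)) =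
      indicator (∀ x ∈ l, A x) (∀ x ∈ l, B x) fun h x hx => hBA x (h x hx) := by
  refine Subtype.ext (Prod.ext ?_ ?_)
  · simp only [checkNode, List.map_map, Function.comp_def, indicator, prod_one_sub_ite]
    split_ifs <;> norm_num
  · simp only [checkNode, List.map_map, Function.comp_def, indicator, prod_one_sub_ite]
    split_ifs <;> norm_num

open scoped Classical in
theorem allMissing_indicator (l : List κ) :
    allMissing (l.map fun x => indicator (A x) (B x) (hBA x)) =
      if ∃ x ∈ l, A x then 0 else 1 := by
  induction l with
  | nil => simp [allMissing]
  | cons x l ih =>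
    rw [List.map_cons, allMissing_cons, ih]
    by_cases h : A x
    · simp [h, indicator]
    · simp [h, indicator]

open scoped Classical in
-- Absence of duplicates matters: positions in the list must correspond to distinct indices for
-- "exactly one" to be expressed by elements.
theorem oneUnverified_indicator {l : List κ} (hl : l.Nodup) :
    oneUnverified (l.map fun x => indicator (A x) (B x) (hBA x)) =
      if (∀ x ∈ l, ¬ B x) ∧ (∃ x ∈ l, A x) ∧ ¬ ∃ x ∈ l, ∃ x' ∈ l, x ≠ x' ∧ A x ∧ A x'
        then 1 else 0 := by
  induction l with
  | nil => simp [oneUnverified]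
  | cons x l ih =>
    rw [List.nodup_cons] at hl
    rw [List.map_cons, oneUnverified, ih hl.2, allMissing_indicator]
    have hne : ∀ z ∈ l, z ≠ x := fun z hz h => hl.1 (h ▸ hz)
    by_cases hA : A x
    · have e1 : (indicator (A x) (B x) (hBA x)).1.1 = 0 := by simp [indicator, hA]
      by_cases hB : B x
      · simp [indicator, hA, hB]
      · have e2 : (indicator (A x) (B x) (hBA x)).1.2 = 1 := by simp [indicator, hB]
        rw [e1, e2]
        by_cases hex : ∃ z ∈ l, A z
        · rw [if_pos hex]
          obtain ⟨z, hz, hAz⟩ := hex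
          rw [if_neg (c := (∀ z ∈ x :: l, ¬ B z) ∧ _) (fun h => h.2.2 ⟨x, List.mem_cons_self, z,
            List.mem_cons_of_mem _ hz, (hne z hz).symm, hA, hAz⟩)]
          ring
        · rw [if_neg hex, if_pos (c := (∀ z ∈ x :: l, ¬ B z) ∧ _)]
          · ring
          · refine ⟨fun z hz hBz => ?_, ⟨x, List.mem_cons_self, hA⟩, ?_⟩
            · rcases List.mem_cons.1 hz with rfl | hz
              · exact hB hBz
              · exact hex ⟨z, hz, hBA z hBz⟩
            · rintro ⟨z, hz, z', hz', hzz', h1, h2⟩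
              rcases List.mem_cons.1 hz with rfl | hz
              · rcases List.mem_cons.1 hz' with rfl | hz'
                · exact hzz' rfl
                · exact hex ⟨z', hz', h2⟩
              · exact hex ⟨z, hz, h1⟩
    · have hB : ¬ B x := fun h => hA (hBA x h)
      have hiff : ((∀ z ∈ x :: l, ¬ B z) ∧ (∃ z ∈ x :: l, A z) ∧
          ¬ ∃ z ∈ x :: l, ∃ z' ∈ x :: l, z ≠ z' ∧ A z ∧ A z') ↔
          ((∀ z ∈ l, ¬ B z) ∧ (∃ z ∈ l, A z) ∧ ¬ ∃ z ∈ l, ∃ z' ∈ l, z ≠ z' ∧ A z ∧ A z') := by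
        simp [hA, hB]
      have e1 : (indicator (A x) (B x) (hBA x)).1.1 = 1 := by simp [indicator, hA]
      have e2 : (indicator (A x) (B x) (hBA x)).1.2 = 1 := by simp [indicator, hB]
      rw [e1, e2, if_congr hiff rfl rfl]
      ring

end MsgProb

theorem dependsOn_list_map {ι F κ α β : Type} {φ : κ → (ι → F) → α} {A : κ → Finset ι} {l : List κ}
    {B : Set ι} (hφ : ∀ x ∈ l, DependsOn (φ x) (A x : Set ι)) (hB : ∀ x ∈ l, (A x : Set ι) ⊆ B)
    (G : List α → β) : DependsOn (fun y => G (l.map fun x => φ x y)) B := by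
  intro y y' h
  have : l.map (fun x => φ x y) = l.map fun x => φ x y' :=
    List.map_congr_left fun x hx => hφ x hx fun i hi => h i (hB x hx hi)
  simp only [this]

/-! ### Independence for lists of messages -/

section ProductMeanList

variable {ι F κ : Type} [Fintype ι] [DecidableEq ι] [Fintype F] {w : ι → F → ℝ}

theorem productMean_list_prod (hw1 : ∀ i, ∑ a, w i a = 1) {φ : κ → (ι → F) → ℝ}
    {A : κ → Finset ι} {l : List κ} (hφ : ∀ x ∈ l, DependsOn (φ x) (A x : Set ι))
    (hl : l.Pairwise fun x x' => Disjoint (A x) (A x')) :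
    productMean w (fun y => (l.map fun x => φ x y).prod) =
      (l.map fun x => productMean w (φ x)).prod := by
  induction l with
  | nil => simp [productMean_const hw1]
  | cons x l ih =>
    rw [List.pairwise_cons] at hl
    simp only [List.map_cons, List.prod_cons]
    rw [productMean_mul_of_dependsOn hw1 (f := φ x)
      (f' := fun y => (l.map fun x => φ x y).prod) (A := A x) (B := (A x)ᶜ) (hφ x (by simp)) ?_
      disjoint_compl_right, ih (fun z hz => hφ z (by simp [hz])) hl.2]
    refine dependsOn_list_map (fun z hz => hφ z (by simp [hz])) (fun z hz i hi => ?_) List.prod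
    rw [Finset.coe_compl]
    exact fun h => Finset.disjoint_left.1 (hl.1 z hz) h hi

/-- Both functions are affine in each entry, and the entries are independent because they depend on
disjoint sets of symbols; hence means pass through. The two statements are proved together since the
recursion for the second uses the first. -/
theorem productMean_oneUnverified (hw1 : ∀ i, ∑ a, w i a = 1) {φ : κ → (ι → F) → MsgProb}
    {A : κ → Finset ι} {m : κ → MsgProb} {l : List κ}
    (hφ : ∀ x ∈ l, DependsOn (φ x) (A x : Set ι))
    (hl : l.Pairwise fun x x' => Disjoint (A x) (A x'))
    (h1 : ∀ x ∈ l, productMean w (fun y => (φ x y).1.1) = (m x).1.1)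
    (h2 : ∀ x ∈ l, productMean w (fun y => (φ x y).1.2) = (m x).1.2) :
    productMean w (fun y => MsgProb.allMissing (l.map fun x => φ x y)) =
        MsgProb.allMissing (l.map m) ∧
      productMean w (fun y => MsgProb.oneUnverified (l.map fun x => φ x y)) =
        MsgProb.oneUnverified (l.map m) := by
  induction l with
  | nil => simp [productMean_const hw1, MsgProb.allMissing, MsgProb.oneUnverified]
  | cons x l ih =>
    rw [List.pairwise_cons] at hl
    obtain ⟨ih1, ih2⟩ := ih (fun z hz => hφ z (by simp [hz])) hl.2
      (fun z hz => h1 z (by simp [hz])) (fun z hz => h2 z (by simp [hz]))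
    have hrest : ∀ G : List MsgProb → ℝ, DependsOn (fun y => G (l.map fun x => φ x y))
        (((A x)ᶜ : Finset ι) : Set ι) := fun G => by
      refine dependsOn_list_map (fun z hz => hφ z (by simp [hz])) (fun z hz i hi => ?_) G
      rw [Finset.coe_compl]
      exact fun h => Finset.disjoint_left.1 (hl.1 z hz) h hi
    have hx : ∀ G : MsgProb → ℝ, DependsOn (fun y => G (φ x y)) (A x : Set ι) := fun G y y' h =>
      congrArg G (hφ x (by simp) h)
    have hmul : ∀ (G : MsgProb → ℝ) (G' : List MsgProb → ℝ),
        productMean w (fun y => G (φ x y) * G' (l.map fun x => φ x y)) =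
          productMean w (fun y => G (φ x y)) * productMean w fun y => G' (l.map fun x => φ x y) :=
      fun G G' => productMean_mul_of_dependsOn hw1 (hx G) (hrest G') disjoint_compl_right
    have e1 := h1 x (by simp)
    have e2 := h2 x (by simp)
    simp only [List.map_cons, MsgProb.allMissing_cons, MsgProb.oneUnverified]
    constructor
    · rw [hmul (fun v => v.1.1) MsgProb.allMissing, e1, ih1]
    · rw [productMean_add, hmul (fun v => v.1.2 - v.1.1) MsgProb.allMissing,
        hmul (fun v => v.1.1) MsgProb.oneUnverified, productMean_sub, e1, e2, ih1, ih2]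

end ProductMeanList

/-! ### From the exploration to neighborhoods in the graph -/

section GraphMessages

variable {D : NodeDegrees} {g : D.Graph}

theorem siblings_inl_perm (e : D.VSocket) :
    (D.siblings (.inl e)).Perm ((varSiblings e).toList.map Sum.inl) := by
  refine (List.perm_ext_iff_of_nodup (NodeDegrees.nodup_siblings _)
    ((Finset.nodup_toList _).map Sum.inl_injective)).2 fun z => ?_
  rcases z with e' | s <;> simp [NodeDegrees.mem_siblings, mem_varSiblings]

theorem siblings_inr_perm (e : D.VSocket) : (D.siblings (.inr (g e))).Perm
    ((checkSiblings g e).toList.map fun e' => Sum.inr (g e')) := by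
  refine (List.perm_ext_iff_of_nodup (NodeDegrees.nodup_siblings _) ((Finset.nodup_toList _).map
    (Sum.inr_injective.comp g.injective))).2 fun z => ?_
  rcases z with e' | s
  · simp [NodeDegrees.mem_siblings]
  · obtain ⟨e', rfl⟩ := g.surjective s
    simp [NodeDegrees.mem_siblings, mem_checkSiblings]

open scoped Classical in
theorem sockets_perm (v : Fin D.n) : (D.sockets v).Perm
    ((Finset.univ.filter fun e : D.VSocket => e.1 = v).toList.map Sum.inl) := by
  refine (List.perm_ext_iff_of_nodup (Finset.nodup_toList _)
    ((Finset.nodup_toList _).map Sum.inl_injective)).2 fun z => ?_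
  rcases z with e' | s <;> simp

theorem run_msgQuery_succ_inl {p : ℝ} (hp : 0 ≤ p ∧ p ≤ 1) (j : ℕ) (e : D.VSocket) :
    (D.msgQuery hp (j + 1) (.inl e)).run (partner g) = MsgProb.checkNode
      ((checkSiblings g e).toList.map fun e' => (D.msgQuery hp j (.inr (g e'))).run (partner g)) := by
  rw [NodeDegrees.msgQuery, Query.run_explore_succ]
  refine (MsgProb.checkNode_perm ((siblings_inr_perm e).map _)).trans ?_
  rw [List.map_map]
  rfl

theorem run_msgQuery_succ_inr {p : ℝ} (hp : 0 ≤ p ∧ p ≤ 1) (j : ℕ) (e : D.VSocket) :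
    (D.msgQuery hp (j + 1) (.inr (g e))).run (partner g) = MsgProb.varNode hp
      ((varSiblings e).toList.map fun e' => (D.msgQuery hp j (.inl e')).run (partner g)) := by
  rw [NodeDegrees.msgQuery, Query.run_explore_succ]
  have h : partner g (.inr (g e)) = .inl e := by simp [partner]
  rw [h]
  refine (MsgProb.varNode_perm hp ((siblings_inl_perm e).map _)).trans ?_
  rw [List.map_map]
  rfl

theorem visited_succ_inl (j : ℕ) (e : D.VSocket) : D.visited g (j + 1) (.inl e) =
    .inr (g e).1 :: (D.siblings (.inr (g e))).flatMap fun z => D.visited g j z := rfl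

theorem visited_succ_inr (j : ℕ) (e : D.VSocket) : D.visited g (j + 1) (.inr (g e)) =
    .inl e.1 :: (D.siblings (.inl e)).flatMap fun z => D.visited g j z := by
  simp [NodeDegrees.visited, partner]

theorem mem_visited_of_mem_checkNbhd {i : ℕ}
    (h : ∀ e u, u ∈ nbhd g i e → .inl u ∈ D.visited g (2 * i + 2) (.inr (g e))) {e : D.VSocket}
    {u : Fin D.n} (hu : u ∈ checkNbhd g i e) : .inl u ∈ D.visited g (2 * i + 3) (.inl e) := by
  obtain ⟨e', he', hu⟩ := Finset.mem_biUnion.1 hu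
  rw [visited_succ_inl]
  refine List.mem_cons_of_mem _ (List.mem_flatMap.2 ⟨.inr (g e'), ?_, h e' u hu⟩)
  rw [mem_checkSiblings] at he'
  simp [NodeDegrees.mem_siblings, he']

/-- Round `i` needs `2 * i + 2` levels, since round `0` already looks at the variable node behind
the check socket. Inclusion in the visited list converts distinct visits into disjoint
neighborhoods. -/
theorem mem_visited_of_mem_nbhd (i : ℕ) (e : D.VSocket) (u : Fin D.n) (hu : u ∈ nbhd g i e) :
    .inl u ∈ D.visited g (2 * i + 2) (.inr (g e)) := by
  induction i generalizing e u with
  | zero =>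
    rw [nbhd, Finset.mem_singleton] at hu
    rw [visited_succ_inr, hu]
    simp
  | succ i ih =>
    rw [nbhd, Finset.mem_union, Finset.mem_singleton, Finset.mem_biUnion] at hu
    rw [visited_succ_inr]
    rcases hu with rfl | ⟨e', he', hu⟩
    · simp
    · refine List.mem_cons_of_mem _ (List.mem_flatMap.2 ⟨.inl e', ?_,
        mem_visited_of_mem_checkNbhd ih hu⟩)
      rw [mem_varSiblings] at he'
      simp [NodeDegrees.mem_siblings, he']

/-- The part of the neighborhood behind the check node of an edge is a tree. -/
def CheckTreeBehind (g : D.Graph) (i : ℕ) (e : D.VSocket) : Prop :=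
  (∀ a ∈ checkSiblings g e, ∀ b ∈ checkSiblings g e, a ≠ b →
    Disjoint (nbhd g i a) (nbhd g i b)) ∧ ∀ a ∈ checkSiblings g e, TreeBehind g i a

theorem disjoint_of_pairwise_visited {l : List D.HalfEdge} {j : ℕ}
    (hl : l.Pairwise fun x x' => List.Disjoint (D.visited g j x) (D.visited g j x'))
    {x x' : D.HalfEdge} (hx : x ∈ l) (hx' : x' ∈ l) (hne : x ≠ x') {A A' : Finset (Fin D.n)}
    (hA : ∀ u ∈ A, .inl u ∈ D.visited g j x) (hA' : ∀ u ∈ A', .inl u ∈ D.visited g j x') :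
    Disjoint A A' := by
  have : Std.Symm fun x x' => List.Disjoint (D.visited g j x) (D.visited g j x') :=
    ⟨fun _ _ h => h.symm⟩
  exact Finset.disjoint_left.2 fun u hu hu' => hl.forall hx hx' hne (hA u hu) (hA' u hu')

theorem checkTreeBehind_of_nodup_visited {i : ℕ}
    (h : ∀ e, (D.visited g (2 * i + 2) (.inr (g e))).Nodup → TreeBehind g i e) {e : D.VSocket}
    (hnd : (D.visited g (2 * i + 3) (.inl e)).Nodup) : CheckTreeBehind g i e := by
  rw [visited_succ_inl, List.nodup_cons, List.nodup_flatMap] at hnd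
  have hmem : ∀ a ∈ checkSiblings g e, Sum.inr (g a) ∈ D.siblings (.inr (g e)) := fun a ha => by
    rw [mem_checkSiblings] at ha
    simp [NodeDegrees.mem_siblings, ha]
  exact ⟨fun a ha b hb hab => disjoint_of_pairwise_visited hnd.2.2 (hmem a ha) (hmem b hb)
    (by simpa using hab) (mem_visited_of_mem_nbhd i a) (mem_visited_of_mem_nbhd i b),
    fun a ha => h a (hnd.2.1 _ (hmem a ha))⟩

theorem treeBehind_of_nodup_visited (i : ℕ) (e : D.VSocket)
    (hnd : (D.visited g (2 * i + 2) (.inr (g e))).Nodup) : TreeBehind g i e := by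
  induction i generalizing e with
  | zero => trivial
  | succ i ih =>
    rw [visited_succ_inr, List.nodup_cons, List.nodup_flatMap] at hnd
    have hmem : ∀ a ∈ varSiblings e, Sum.inl a ∈ D.siblings (.inl e) := fun a ha => by
      rw [mem_varSiblings] at ha
      simp [NodeDegrees.mem_siblings, ha]
    refine ⟨fun a ha hea => hnd.1 (List.mem_flatMap.2 ⟨_, hmem a ha, ?_⟩),
      fun a ha b hb hab => ?_, fun a ha => ?_⟩
    · exact mem_visited_of_mem_checkNbhd (mem_visited_of_mem_nbhd i) hea
    · exact disjoint_of_pairwise_visited hnd.2.2 (hmem a ha) (hmem b hb) (by simpa using hab)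
        (fun u hu => mem_visited_of_mem_checkNbhd (mem_visited_of_mem_nbhd i) hu)
        (fun u hu => mem_visited_of_mem_checkNbhd (mem_visited_of_mem_nbhd i) hu)
    · exact checkTreeBehind_of_nodup_visited ih (hnd.2.1 _ (hmem a ha))

/-- The final decision adds one check level, hence `2 * ℓ + 3`. That `v` heads the duplicate-free
list keeps its own symbol out of the neighborhoods. -/
theorem NodeDegrees.TreeLike.root {ℓ : ℕ} {v : Fin D.n} (h : D.TreeLike g (2 * ℓ + 3) v) :
    (∀ e : D.VSocket, e.1 = v → v ∉ checkNbhd g ℓ e) ∧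
      (∀ e e' : D.VSocket, e.1 = v → e'.1 = v → e ≠ e' →
        Disjoint (checkNbhd g ℓ e) (checkNbhd g ℓ e')) ∧
      ∀ e : D.VSocket, e.1 = v → CheckTreeBehind g ℓ e := by
  rw [NodeDegrees.TreeLike, List.nodup_cons, List.nodup_flatMap] at h
  have hmem : ∀ e : D.VSocket, e.1 = v → Sum.inl e ∈ D.sockets v := fun e he => by
    simp [NodeDegrees.mem_sockets, he]
  refine ⟨fun e he hv => h.1 (List.mem_flatMap.2 ⟨_, hmem e he, ?_⟩),
    fun e e' he he' hne => ?_, fun e he => ?_⟩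
  · exact mem_visited_of_mem_checkNbhd (mem_visited_of_mem_nbhd ℓ) hv
  · exact disjoint_of_pairwise_visited h.2.2 (hmem e he) (hmem e' he') (by simpa using hne)
      (fun u hu => mem_visited_of_mem_checkNbhd (mem_visited_of_mem_nbhd ℓ) hu)
      (fun u hu => mem_visited_of_mem_checkNbhd (mem_visited_of_mem_nbhd ℓ) hu)
  · exact checkTreeBehind_of_nodup_visited (treeBehind_of_nodup_visited ℓ) (h.2.1 _ (hmem e he))

end GraphMessages

/-! ### The probability of verification on trees -/

theorem MsgProb.indicator_congr {L L' V V' : Prop} (hL : L ↔ L') (hV : V ↔ V') (h : V → L)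
    (h' : V' → L') : indicator L V h = indicator L' V' h' := by
  obtain rfl := propext hL
  obtain rfl := propext hV
  rfl

theorem VerifiedAt.congr {ι : Type} {I : Finset ι} {L L' V V' : ι → Prop} {ok ok' : Prop}
    (hL : ∀ i ∈ I, (L i ↔ L' i)) (hV : ∀ i ∈ I, (V i ↔ V' i)) (hok : ok ↔ ok') :
    VerifiedAt I L V ok ↔ VerifiedAt I L' V' ok' := by
  have h : ∀ {L L' V V' : ι → Prop} {ok ok' : Prop}, (∀ i ∈ I, (L i ↔ L' i)) →
      (∀ i ∈ I, (V i ↔ V' i)) → (ok ↔ ok') → VerifiedAt I L V ok → VerifiedAt I L' V' ok' := by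
    rintro L L' V V' ok ok' hL hV hok (⟨i, hi, h⟩ | ⟨h, i, hi, h'⟩ | ⟨i, hi, j, hj, hij, h, h'⟩)
    · exact Or.inl ⟨i, hi, (hV i hi).1 h⟩
    · exact Or.inr (Or.inl ⟨hok.1 h, i, hi, (hL i hi).1 h'⟩)
    · exact Or.inr (Or.inr ⟨i, hi, j, hj, hij, (hL i hi).1 h, (hL j hj).1 h'⟩)
  exact ⟨h hL hV hok, h (fun i hi => (hL i hi).symm) (fun i hi => (hV i hi).symm) hok.symm⟩

section TreeMessages

variable {D : NodeDegrees} {g : D.Graph}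

theorem listed_verified_congr {ok ok' : Fin D.n → Prop} {i : ℕ} {e : D.VSocket}
    (h : ∀ u ∈ nbhd g i e, (ok u ↔ ok' u)) :
    (Listed g ok i e ↔ Listed g ok' i e) ∧ (Verified g ok i e ↔ Verified g ok' i e) := by
  induction i generalizing e with
  | zero => exact ⟨h e.1 (by simp [nbhd]), Iff.rfl⟩
  | succ i ih =>
    have h0 : ok e.1 ↔ ok' e.1 := h e.1 (by simp [nbhd])
    have hs : ∀ e' ∈ varSiblings e, ∀ e'' ∈ checkSiblings g e',
        (Listed g ok i e'' ↔ Listed g ok' i e'') ∧ (Verified g ok i e'' ↔ Verified g ok' i e'') :=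
      fun e' he' e'' he'' => ih fun u hu => h u <| by
        rw [nbhd, Finset.mem_union]
        exact Or.inr (Finset.mem_biUnion.2 ⟨e', he', Finset.mem_biUnion.2 ⟨e'', he'', hu⟩⟩)
    have hL : ∀ e' ∈ varSiblings e, ((∀ e'' ∈ checkSiblings g e', Listed g ok i e'') ↔
        ∀ e'' ∈ checkSiblings g e', Listed g ok' i e'') :=
      fun e' he' => forall₂_congr fun e'' he'' => (hs e' he' e'' he'').1
    exact ⟨or_congr h0 (exists_congr fun e' => and_congr_right fun he' => hL e' he'),
      VerifiedAt.congr hL (fun e' he' => forall₂_congr fun e'' he'' => (hs e' he' e'' he'').2) h0⟩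

/-- The state of the message sent along an edge by a variable node. -/
noncomputable def varState (g : D.Graph) (ok : Fin D.n → Prop) (i : ℕ) (e : D.VSocket) : MsgProb :=
  .indicator (Listed g ok i e) (Verified g ok i e) Verified.listed

/-- The state of the message sent along an edge by a check node. -/
noncomputable def checkState (g : D.Graph) (ok : Fin D.n → Prop) (i : ℕ) (e : D.VSocket) : MsgProb :=
  .indicator (∀ e' ∈ checkSiblings g e, Listed g ok i e') (∀ e' ∈ checkSiblings g e, Verified g ok i e')
    fun h e' he' => (h e' he').listed

theorem checkState_eq (ok : Fin D.n → Prop) (i : ℕ) (e : D.VSocket) : checkState g ok i e =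
    .checkNode ((checkSiblings g e).toList.map fun e' => varState g ok i e') := by
  unfold varState
  rw [MsgProb.checkNode_indicator fun e' => Verified.listed]
  exact MsgProb.indicator_congr (by simp) (by simp) _ _

open scoped Classical in
-- `varNode` for a single noise realization, with `p` replaced by the indicator of a wrong received
-- symbol. A message stays unverified if all lists lack the symbol, or if exactly one unverified
-- list has it and the received symbol is wrong.
theorem varState_succ (ok : Fin D.n → Prop) (i : ℕ) (e : D.VSocket) :
    (varState g ok (i + 1) e).1.1 = (if ok e.1 then 0 else 1) *
        MsgProb.allMissing ((varSiblings e).toList.map fun e' => checkState g ok i e') ∧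
      (varState g ok (i + 1) e).1.2 =
        MsgProb.allMissing ((varSiblings e).toList.map fun e' => checkState g ok i e') +
          (if ok e.1 then 0 else 1) *
            MsgProb.oneUnverified ((varSiblings e).toList.map fun e' => checkState g ok i e') := by
  unfold checkState
  rw [MsgProb.allMissing_indicator fun e' h e'' he'' => (h e'' he'').listed,
    MsgProb.oneUnverified_indicator (fun e' h e'' he'' => (h e'' he'').listed)
      (Finset.nodup_toList _)]
  simp only [Finset.mem_toList, varState, MsgProb.indicator]
  set L : D.VSocket → Prop := fun e' => ∀ e'' ∈ checkSiblings g e', Listed g ok i e''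
  set V : D.VSocket → Prop := fun e' => ∀ e'' ∈ checkSiblings g e', Verified g ok i e''
  have hVL : ∀ e', V e' → L e' := fun e' h e'' he'' => (h e'' he'').listed
  have hLs : Listed g ok (i + 1) e ↔ ok e.1 ∨ ∃ e' ∈ varSiblings e, L e' := Iff.rfl
  have hVs : Verified g ok (i + 1) e ↔ VerifiedAt (varSiblings e) L V (ok e.1) := Iff.rfl
  constructor
  · by_cases h1 : ok e.1
    · rw [if_pos (hLs.2 (Or.inl h1)), if_pos h1, zero_mul]
    · rw [if_neg h1, one_mul]
      exact if_congr (hLs.trans (or_iff_right h1)) rfl rfl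
  · by_cases h2 : ∃ e' ∈ varSiblings e, L e'
    · by_cases h1 : ok e.1
      · rw [if_pos h1, if_pos h2, if_pos (c := Verified g ok (i + 1) e) (Or.inr (Or.inl ⟨h1, h2⟩))]
        ring
      · rw [if_neg h1, if_pos h2, zero_add, one_mul]
        by_cases h3 : Verified g ok (i + 1) e
        · rw [if_pos h3, if_neg]
          rintro ⟨h4, -, h5⟩
          rcases h3 with ⟨e', he', h⟩ | ⟨h, -⟩ | h
          exacts [h4 e' he' h, h1 h, h5 h]
        · rw [if_neg h3, if_pos]
          exact ⟨fun e' he' h => h3 (Or.inl ⟨e', he', h⟩), h2, fun h => h3 (Or.inr (Or.inr h))⟩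
    · rw [if_neg h2, if_neg (c := Verified g ok (i + 1) e),
        if_neg (c := (∀ e' ∈ varSiblings e, ¬ V e') ∧ _) fun h => h2 h.2.1]
      · ring
      · rintro (⟨e', he', h⟩ | ⟨-, h⟩ | ⟨e', he', -, -, -, h, -⟩)
        exacts [h2 ⟨e', he', hVL e' h⟩, h2 h, h2 ⟨e', he', h⟩]

variable {F : Type}

theorem dependsOn_varState (c : Fin D.n → F) (i : ℕ) (e : D.VSocket) :
    DependsOn (fun y : Fin D.n → F => varState g (fun v => y v = c v) i e)
      (nbhd g i e : Set (Fin D.n)) := by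
  intro y y' h
  have := listed_verified_congr (g := g) (i := i) (e := e) (ok := fun v => y v = c v)
    (ok' := fun v => y' v = c v) fun u hu => by rw [h u hu]
  exact MsgProb.indicator_congr this.1 this.2 _ _

theorem dependsOn_checkState (c : Fin D.n → F) (i : ℕ) (e : D.VSocket) :
    DependsOn (fun y : Fin D.n → F => checkState g (fun v => y v = c v) i e)
      (checkNbhd g i e : Set (Fin D.n)) := by
  simp only [checkState_eq]
  refine dependsOn_list_map (fun e' _ => dependsOn_varState c i e') (fun e' he' u hu => ?_) _
  exact Finset.mem_coe.2 (Finset.mem_biUnion.2 ⟨e', Finset.mem_toList.1 he', hu⟩)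

theorem pairwise_toList {α : Type} {s : Finset α} {r : α → α → Prop}
    (h : ∀ a ∈ s, ∀ b ∈ s, a ≠ b → r a b) : s.toList.Pairwise r :=
  List.Nodup.pairwise_of_forall_ne s.nodup_toList fun a ha b hb hab =>
    h a (Finset.mem_toList.1 ha) b (Finset.mem_toList.1 hb) hab

variable [Field F] [Fintype F] {p : ℝ} (hp : 0 ≤ p ∧ p ≤ 1)

theorem noiseMean_checkState_eq {c : Fin D.n → F} {i j : ℕ} {e : D.VSocket}
    (hd : ∀ a ∈ checkSiblings g e, ∀ b ∈ checkSiblings g e, a ≠ b →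
      Disjoint (nbhd g i a) (nbhd g i b))
    (ih : ∀ a ∈ checkSiblings g e,
      noiseMean p c (fun y => (varState g (fun v => y v = c v) i a).1.1) =
        ((D.msgQuery hp j (.inr (g a))).run (partner g)).1.1 ∧
      noiseMean p c (fun y => (varState g (fun v => y v = c v) i a).1.2) =
        ((D.msgQuery hp j (.inr (g a))).run (partner g)).1.2) :
    noiseMean p c (fun y => (checkState g (fun v => y v = c v) i e).1.1) =
        ((D.msgQuery hp (j + 1) (.inl e)).run (partner g)).1.1 ∧
      noiseMean p c (fun y => (checkState g (fun v => y v = c v) i e).1.2) =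
        ((D.msgQuery hp (j + 1) (.inl e)).run (partner g)).1.2 := by
  have hw1 : ∀ v, ∑ a, qsc p (c v) a = 1 := fun v => sum_qsc two_le_card_field (c v)
  have key : ∀ φ : MsgProb → ℝ,
      (∀ a ∈ checkSiblings g e, noiseMean p c (fun y => φ (varState g (fun v => y v = c v) i a)) =
        φ ((D.msgQuery hp j (.inr (g a))).run (partner g))) →
      noiseMean p c (fun y => 1 - (((checkSiblings g e).toList.map fun e' =>
        varState g (fun v => y v = c v) i e').map fun v => 1 - φ v).prod) =
      1 - (((checkSiblings g e).toList.map fun e' =>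
        (D.msgQuery hp j (.inr (g e'))).run (partner g)).map fun v => 1 - φ v).prod := by
    intro φ hφ
    simp only [List.map_map, Function.comp_def]
    rw [noiseMean, productMean_sub, productMean_const hw1, productMean_list_prod hw1
      (φ := fun e' y => 1 - φ (varState g (fun v => y v = c v) i e')) (A := nbhd g i)
      (fun a _ y y' h => congrArg (fun v => 1 - φ v) (dependsOn_varState c i a h))
      (pairwise_toList hd)]
    congr 2
    refine List.map_congr_left fun a ha => ?_
    rw [productMean_sub, productMean_const hw1]
    exact congrArg _ (hφ a (Finset.mem_toList.1 ha))
  rw [run_msgQuery_succ_inl]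
  simp only [checkState_eq]
  exact ⟨key (fun v => v.1.1) fun a ha => (ih a ha).1, key (fun v => v.1.2) fun a ha => (ih a ha).2⟩

/-- On a tree the noise average commutes with the message rules, so the exact probabilities for this
graph equal the result of the exploration. The exploration starts from `(1, 1)`, one step of density
evolution before the received symbols are used. -/
theorem noiseMean_varState_eq (hdc : ∀ s, 2 ≤ D.dc s) (c : Fin D.n → F) {i : ℕ} {e : D.VSocket}
    (ht : TreeBehind g i e) :
    noiseMean p c (fun y => (varState g (fun v => y v = c v) i e).1.1) =
        ((D.msgQuery hp (2 * i + 2) (.inr (g e))).run (partner g)).1.1 ∧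
      noiseMean p c (fun y => (varState g (fun v => y v = c v) i e).1.2) =
        ((D.msgQuery hp (2 * i + 2) (.inr (g e))).run (partner g)).1.2 := by
  classical
  have hw1 : ∀ v, ∑ a, qsc p (c v) a = 1 := fun v => sum_qsc two_le_card_field (c v)
  induction i generalizing e with
  | zero =>
    -- Check degree at least two makes the product over the siblings nonempty, so the starting state
    -- `(1, 1)` survives the first check node; an empty product would give `(0, 0)`.
    have hne : ∀ e' : D.VSocket, (checkSiblings g e').toList ≠ [] := by
      intro e' h
      have h1 := (siblings_inr_perm (g := g) e').length_eq
      rw [List.length_map, h, List.length_nil, NodeDegrees.length_siblings_inr] at h1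
      have := hdc (g e').1
      omega
    have h1 : ∀ e', (D.msgQuery hp 1 (.inl e')).run (partner g) = ⟨(1, 1), by norm_num⟩ := by
      intro e'
      rw [run_msgQuery_succ_inl]
      obtain ⟨a, l, hl⟩ := List.exists_cons_of_ne_nil (hne e')
      rw [hl]
      refine Subtype.ext ?_
      have h0 : ∀ x, (D.msgQuery hp 0 x).run (partner g) = ⟨(1, 1), by norm_num⟩ := fun x => rfl
      simp [MsgProb.checkNode, h0]
    have h2 : ∀ l : List D.VSocket, MsgProb.allMissing (l.map fun e' =>
        (D.msgQuery hp 1 (.inl e')).run (partner g)) = 1 ∧ MsgProb.oneUnverified (l.map fun e' =>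
        (D.msgQuery hp 1 (.inl e')).run (partner g)) = 0 := by
      intro l
      induction l with
      | nil => simp [MsgProb.allMissing, MsgProb.oneUnverified]
      | cons a l ihl =>
        rw [List.map_cons, MsgProb.allMissing_cons, MsgProb.oneUnverified, h1, ihl.1, ihl.2]
        norm_num
    rw [run_msgQuery_succ_inr]
    simp only [MsgProb.varNode, (h2 _).1, (h2 _).2, mul_one, mul_zero, add_zero]
    constructor
    · refine Eq.trans (congrArg _ (funext fun y => ?_)) (noiseMean_ne c e.1)
      exact if_congr Iff.rfl rfl rfl
    · refine Eq.trans (congrArg _ (funext fun y => ?_)) (noiseMean_const c 1)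
      exact if_neg id
  | succ i ih =>
    obtain ⟨ht1, ht2, ht3⟩ := ht
    have hcheck := fun e' (he' : e' ∈ varSiblings e) =>
      noiseMean_checkState_eq hp (c := c) (ht3 e' he').1 fun a ha => ih ((ht3 e' he').2 a ha)
    obtain ⟨hm1, hm2⟩ := productMean_oneUnverified hw1
      (φ := fun e' y => checkState g (fun v => y v = c v) i e') (A := checkNbhd g i)
      (m := fun e' => (D.msgQuery hp (2 * i + 3) (.inl e')).run (partner g))
      (l := (varSiblings e).toList) (fun e' _ => dependsOn_checkState c i e') (pairwise_toList ht2)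
      (fun e' he' => (hcheck e' (Finset.mem_toList.1 he')).1)
      fun e' he' => (hcheck e' (Finset.mem_toList.1 he')).2
    -- The received symbol at the node itself lies outside all neighborhoods behind it, so its error
    -- is independent of the incoming messages.
    have hmul : ∀ G : List MsgProb → ℝ, productMean (fun v => qsc p (c v)) (fun y =>
        (if y e.1 = c e.1 then 0 else 1) *
          G ((varSiblings e).toList.map fun e' => checkState g (fun v => y v = c v) i e')) =
        p * productMean (fun v => qsc p (c v)) fun y =>
          G ((varSiblings e).toList.map fun e' => checkState g (fun v => y v = c v) i e') := by
      intro G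
      rw [productMean_mul_of_dependsOn hw1 (A := {e.1}) (B := {e.1}ᶜ)
        (f := fun y => if y e.1 = c e.1 then 0 else 1) (fun y y' h => by simp [h e.1 (by simp)]) ?_
        disjoint_compl_right]
      · congr 1
        exact noiseMean_ne c e.1
      · refine dependsOn_list_map (fun e' _ => dependsOn_checkState c i e')
          (fun e' he' u hu => ?_) G
        rw [Finset.coe_compl, Finset.coe_singleton]
        rintro rfl
        exact ht1 e' (Finset.mem_toList.1 he') hu
    rw [show 2 * (i + 1) + 2 = 2 * i + 3 + 1 by ring, run_msgQuery_succ_inr]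
    simp only [MsgProb.varNode, (varState_succ _ _ _).1, (varState_succ _ _ _).2, noiseMean]
    rw [productMean_add, hmul, hmul, hm1, hm2]
    exact ⟨rfl, rfl⟩

open scoped Classical in
-- The final decision is verified as soon as one incoming message is; the neighborhoods behind the
-- edges at `v` are disjoint, so the failure probabilities multiply.
theorem noiseMean_not_verified_eq (hdc : ∀ s, 2 ≤ D.dc s) (c : Fin D.n → F) {ℓ : ℕ} {v : Fin D.n}
    (ht : D.TreeLike g (2 * ℓ + 3) v) :
    noiseMean p c (fun y => if ∃ e : D.VSocket, e.1 = v ∧ ∀ e' ∈ checkSiblings g e,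
      Verified g (fun u => y u = c u) ℓ e' then 0 else 1) = D.allUnverified hp (2 * ℓ + 3) g v := by
  have hw1 : ∀ v, ∑ a, qsc p (c v) a = 1 := fun v => sum_qsc two_le_card_field (c v)
  obtain ⟨-, hdisj, hcheck⟩ := ht.root
  set l := (Finset.univ.filter fun e : D.VSocket => e.1 = v).toList with hl
  have hmem : ∀ e ∈ l, e.1 = v := fun e he => by simpa [hl] using he
  have h1 : ∀ y : Fin D.n → F, (if ∃ e : D.VSocket, e.1 = v ∧ ∀ e' ∈ checkSiblings g e,
      Verified g (fun u => y u = c u) ℓ e' then (0 : ℝ) else 1) =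
      (l.map fun e => (checkState g (fun u => y u = c u) ℓ e).1.2).prod := by
    intro y
    have := MsgProb.prod_one_sub_ite (fun e => ¬ ∀ e' ∈ checkSiblings g e,
      Verified g (fun u => y u = c u) ℓ e') l
    refine Eq.trans ?_ (this.symm.trans (congrArg List.prod (List.map_congr_left fun e _ => ?_)))
    swap
    · by_cases h : ∀ e' ∈ checkSiblings g e, Verified g (fun u => y u = c u) ℓ e'
      · simp only [checkState, MsgProb.indicator]
        rw [if_neg (not_not.2 h), if_pos h, sub_self]
      · simp only [checkState, MsgProb.indicator]
        rw [if_pos h, if_neg h, sub_zero]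
    by_cases h : ∃ e : D.VSocket, e.1 = v ∧ ∀ e' ∈ checkSiblings g e,
      Verified g (fun u => y u = c u) ℓ e'
    · rw [if_pos h, if_neg]
      obtain ⟨e, he, h⟩ := h
      exact fun h' => h' e (by simp [hl, he]) h
    · rw [if_neg h, if_pos]
      exact fun e he h' => h ⟨e, hmem e he, h'⟩
  refine (congrArg (noiseMean p c) (funext h1)).trans ?_
  rw [noiseMean, productMean_list_prod hw1
    (φ := fun e y => (checkState g (fun u => y u = c u) ℓ e).1.2) (A := checkNbhd g ℓ)
    (fun e _ y y' h => congrArg (fun v => v.1.2) (dependsOn_checkState c ℓ e h))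
    (pairwise_toList fun a ha b hb hab => hdisj a b (by simpa using ha) (by simpa using hb) hab),
    NodeDegrees.allUnverified, ((sockets_perm v).map _).prod_eq, List.map_map]
  congr 1
  refine List.map_congr_left fun e he => ?_
  obtain ⟨h2, h3⟩ := hcheck e (hmem e he)
  exact (noiseMean_checkState_eq hp h2 fun a ha => noiseMean_varState_eq hp hdc c (h3 a ha)).2

open scoped Classical in
-- Decoding fails only if no incoming message would be verified or if a false collision occurs
-- somewhere in the computation.
theorem noiseMean_decode_le {d : ℕ} (hd : D.BoundedBy d) (hdc : ∀ s, 2 ≤ D.dc s)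
    {sel : Finset F → F} (hsel : ∀ s : Finset F, s.Nonempty → sel s ∈ s) {h : D.VSocket → Fˣ}
    {c : Fin D.n → F} (hc : c ∈ ldpcCode g h) {ℓ : ℕ} {v : Fin D.n}
    (ht : D.TreeLike g (2 * ℓ + 3) v) :
    noiseMean p c (fun y => if lmpDecode ⊤ sel ℓ g h y v = some (c v) then 0 else 1) ≤
      D.allUnverified hp (2 * ℓ + 3) g v + collisionBound d (ℓ + 1) * (1 / (Fintype.card F - 1)) := by
  obtain ⟨hv, hdisj, hcheck⟩ := ht.root
  set I := Finset.univ.filter fun e : D.VSocket => e.1 = v with hI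
  have hIv : ∀ e ∈ I, e.1 = v := fun e he => by simpa [hI] using he
  have hcoll := noiseMean_collision_step hp hd hc (h := h) (i := ℓ) (v := v) (I := I)
    (by
      rw [hI]
      convert (NodeDegrees.card_vsocket_fiber v).le.trans (hd.dv_le v)) hIv
    (fun e he => hv e (hIv e he)) (fun e he e' he' => hdisj e e' (hIv e he) (hIv e' he'))
    fun e he e' he' => noiseMean_not_noCollision_le hp hd hc ℓ e' ((hcheck e (hIv e he)).2 e' he')
  rw [← noiseMean_not_verified_eq hp hdc c ht]
  refine le_trans ?_ (add_le_add_right hcoll _)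
  rw [← noiseMean_add]
  refine noiseMean_mono hp fun y => ?_
  have h01 : ∀ (P : Prop) [Decidable P], (0 : ℝ) ≤ if P then 0 else 1 := fun P _ => by split_ifs <;> norm_num
  by_cases h1 : ∃ e : D.VSocket, e.1 = v ∧ ∀ e' ∈ checkSiblings g e,
      Verified g (fun u => y u = c u) ℓ e'
  · by_cases h2 : NoCollisionAt c y v I (checkForms g h (forms g h ℓ)) ∧
        ∀ e ∈ I, ∀ e' ∈ checkSiblings g e, NoCollision g h c y ℓ e'
    · rw [if_pos (lmpDecode_eq hc hsel h2.1 (fun e he => h2.2 e (by simp [hI, he])) h1)]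
      exact add_nonneg (h01 _) (h01 _)
    · rw [if_neg h2]
      refine le_trans ?_ (le_add_of_nonneg_left (h01 _))
      split_ifs <;> norm_num
  · rw [if_neg h1]
    refine le_trans ?_ (le_add_of_nonneg_right (h01 _))
    split_ifs <;> norm_num

open scoped Classical in
/-- The symbol error rate on a graph is at most the fraction of the nodes whose neighborhood is not
a tree, the mean probability of no verification on trees, and that of false collisions. -/
theorem symbolErrorRate_le {d : ℕ} (hd : D.BoundedBy d) (hdc : ∀ s, 2 ≤ D.dc s)
    {sel : Finset F → F} (hsel : ∀ s : Finset F, s.Nonempty → sel s ∈ s) {h : D.VSocket → Fˣ}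
    {c : Fin D.n → F} (hc : c ∈ ldpcCode g h) (ℓ : ℕ) (hn : 0 < D.n) :
    symbolErrorRate ⊤ sel ℓ p g h c ≤
      (∑ v, if D.TreeLike g (2 * ℓ + 3) v then (0 : ℝ) else 1) / D.n +
        (∑ v, D.allUnverified hp (2 * ℓ + 3) g v) / D.n +
          collisionBound d (ℓ + 1) * (1 / (Fintype.card F - 1)) := by
  have h2 : (2 : ℝ) ≤ Fintype.card F := by exact_mod_cast two_le_card_field (F := F)
  have hn' : (0 : ℝ) < D.n := by exact_mod_cast hn
  set η : ℝ := collisionBound d (ℓ + 1) * (1 / (Fintype.card F - 1)) with hη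
  have hη0 : 0 ≤ η := mul_nonneg (by positivity) (div_nonneg zero_le_one (by linarith))
  have e1 : symbolErrorRate ⊤ sel ℓ p g h c = (∑ v, noiseMean p c fun y =>
      if lmpDecode ⊤ sel ℓ g h y v = some (c v) then 0 else 1) / D.n := by
    rw [← noiseMean_sum, noiseMean, productMean, symbolErrorRate, Finset.sum_div]
    refine Finset.sum_congr rfl fun y _ => ?_
    rw [mul_div_assoc]
    congr 2
    rw [Finset.card_filter]
    push_cast
    refine Finset.sum_congr rfl fun v _ => ?_
    by_cases hv : lmpDecode ⊤ sel ℓ g h y v = some (c v) <;> simp [hv]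
  have hv : ∀ v, noiseMean p c (fun y => if lmpDecode ⊤ sel ℓ g h y v = some (c v) then 0 else 1) ≤
      (if D.TreeLike g (2 * ℓ + 3) v then (0 : ℝ) else 1) + D.allUnverified hp (2 * ℓ + 3) g v + η := by
    intro v
    have h0 := (NodeDegrees.allUnverified_mem (J := 2 * ℓ + 3) hp g v).1
    by_cases ht : D.TreeLike g (2 * ℓ + 3) v
    · rw [if_pos ht, zero_add]
      exact noiseMean_decode_le hp hd hdc hsel hc ht
    · rw [if_neg ht]
      refine (noiseMean_mono hp (f' := fun _ => 1) fun y => ?_).trans ?_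
      · split_ifs <;> norm_num
      · rw [noiseMean_const]
        linarith
  rw [e1, ← add_div, ← Finset.sum_add_distrib, div_add' _ _ _ hn'.ne']
  refine div_le_div_of_nonneg_right ((Finset.sum_le_sum fun v _ => hv v).trans ?_) hn'.le
  rw [Finset.sum_add_distrib, Finset.sum_const, Finset.card_univ, Fintype.card_fin, nsmul_eq_mul,
    mul_comm η]

end TreeMessages

/-! ### Limits of the degree distributions -/

section SocketSums

/-- Sockets are grouped by the degree `k + 1` of their node. Nodes of degree zero have no sockets,
so the truncated subtraction does no harm. -/
theorem sum_sockets {n : ℕ} {deg : Fin n → ℕ} {d : ℕ} (h : ∀ v, deg v ≤ d) (φ : ℕ → ℝ) (N : ℝ) :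
    (∑ e : Σ v, Fin (deg v), φ (deg e.1 - 1)) / N = ∑ k ∈ Finset.range d, φ k *
      (((k + 1 : ℕ) : ℝ) * (Finset.univ.filter fun v => deg v = k + 1).card / N) := by
  have h1 : ∑ e : Σ v, Fin (deg v), φ (deg e.1 - 1) = ∑ v, (deg v : ℝ) * φ (deg v - 1) := by
    rw [Fintype.sum_sigma]
    simp
  have h2 : ∀ v, (deg v : ℝ) * φ (deg v - 1) =
      ∑ k ∈ Finset.range d, if deg v = k + 1 then ((k + 1 : ℕ) : ℝ) * φ k else 0 := by
    intro v
    rcases hv : deg v with _ | j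
    · simp
    · have hj : j ∈ Finset.range d := by
        have := h v
        rw [Finset.mem_range]
        omega
      rw [Finset.sum_eq_single_of_mem j hj fun k _ hk => if_neg fun h => hk (by omega)]
      simp
  rw [h1, Finset.sum_congr rfl fun v _ => h2 v, Finset.sum_comm, Finset.sum_div]
  refine Finset.sum_congr rfl fun k _ => ?_
  rw [← Finset.sum_filter, Finset.sum_const, nsmul_eq_mul]
  ring

theorem tendsto_sum_sockets {n : ℕ → ℕ} {deg : ∀ m, Fin (n m) → ℕ} {N : ℕ → ℝ} {d : ℕ}
    (h : ∀ m v, deg m v ≤ d) {f : ℝ[X]}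
    (hf : ∀ k : ℕ, 1 ≤ k → Tendsto
      (fun m => (k : ℝ) * (Finset.univ.filter fun v => deg m v = k).card / N m) atTop
      (𝓝 (f.coeff (k - 1)))) {φ : ℕ → ℕ → ℝ} {φ₀ : ℕ → ℝ}
    (hφ : ∀ k, Tendsto (fun m => φ m k) atTop (𝓝 (φ₀ k))) :
    Tendsto (fun m => (∑ e : Σ v, Fin (deg m v), φ m (deg m e.1 - 1)) / N m) atTop
      (𝓝 (∑ k ∈ Finset.range d, φ₀ k * f.coeff k)) := by
  simp only [fun m => sum_sockets (h m)]
  exact tendsto_finsetSum _ fun k _ => (hφ k).mul (hf (k + 1) (by omega))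

end SocketSums

theorem sum_support_coeff_div {f : ℝ[X]} {d : ℕ} (hd : f.natDegree < d) :
    ∑ i ∈ f.support, f.coeff i / (i + 1) =
      ∑ k ∈ Finset.range d, ((k : ℝ) + 1)⁻¹ * f.coeff k := by
  rw [← sum_def f fun i a => a / ((i : ℝ) + 1), sum_over_range' _ (by simp) d hd]
  exact Finset.sum_congr rfl fun k _ => div_eq_inv_mul _ _

theorem IsDegreeDist.sum_support_coeff_div_pos {f : ℝ[X]} (hf : IsDegreeDist f) :
    0 < ∑ i ∈ f.support, f.coeff i / ((i : ℝ) + 1) := by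
  have hne : f.support.Nonempty := by
    rw [support_nonempty]
    rintro rfl
    simpa using hf.eval_one
  refine Finset.sum_pos (fun i hi => div_pos ?_ (by positivity)) hne
  exact (hf.nonneg i).lt_of_ne (mem_support_iff.1 hi).symm

namespace IsLongEnsemble

variable {lam rho : ℝ[X]} {D : ℕ → NodeDegrees}

theorem two_le_dc (hD : IsLongEnsemble lam rho D) (hr : IsDegreeDist rho) (m : ℕ)
    (c : Fin (D m).r) : 2 ≤ (D m).dc c := by
  by_contra h
  refine hD.dc_mem m c ?_
  rw [show (D m).dc c - 1 = 0 by omega, hr.coeff_zero]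

theorem two_le_dv (hD : IsLongEnsemble lam rho D) (hl : IsDegreeDist lam) (m : ℕ)
    (v : Fin (D m).n) : 2 ≤ (D m).dv v := by
  by_contra h
  refine hD.dv_mem m v ?_
  rw [show (D m).dv v - 1 = 0 by omega, hl.coeff_zero]

theorem boundedBy (hD : IsLongEnsemble lam rho D) (m : ℕ) :
    (D m).BoundedBy (max lam.natDegree rho.natDegree + 1) where
  dv_le v := by
    have := le_natDegree_of_ne_zero (hD.dv_mem m v)
    omega
  dc_le c := by
    have := le_natDegree_of_ne_zero (hD.dc_mem m c)
    omega

theorem tendsto_variableDist (hD : IsLongEnsemble lam rho D) {z : ℕ → ℝ} {z₀ : ℝ}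
    (hz : Tendsto z atTop (𝓝 z₀)) :
    Tendsto (fun m => (D m).variableDist.eval (z m)) atTop (𝓝 (lam.eval z₀)) := by
  simp only [NodeDegrees.eval_variableDist]
  have h := tendsto_sum_sockets (fun m => (hD.boundedBy m).dv_le) hD.dv_frac
    (φ := fun m k => z m ^ k) (φ₀ := fun k => z₀ ^ k) fun k => hz.pow k
  rw [eval_eq_sum_range' (Nat.lt_succ_of_le (le_max_left _ rho.natDegree))]
  simpa [mul_comm] using h

theorem tendsto_checkDist (hD : IsLongEnsemble lam rho D) {z : ℕ → ℝ} {z₀ : ℝ}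
    (hz : Tendsto z atTop (𝓝 z₀)) :
    Tendsto (fun m => (D m).checkDist.eval (z m)) atTop (𝓝 (rho.eval z₀)) := by
  simp only [NodeDegrees.eval_checkDist]
  have h := tendsto_sum_sockets (fun m => (hD.boundedBy m).dc_le) hD.dc_frac
    (φ := fun m k => z m ^ k) (φ₀ := fun k => z₀ ^ k) fun k => hz.pow k
  rw [eval_eq_sum_range' (Nat.lt_succ_of_le (le_max_right lam.natDegree _))]
  simpa [mul_comm] using h

theorem tendsto_derivative_variableDist (hD : IsLongEnsemble lam rho D) {z : ℕ → ℝ} {z₀ : ℝ}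
    (hz : Tendsto z atTop (𝓝 z₀)) :
    Tendsto (fun m => (derivative (D m).variableDist).eval (z m)) atTop
      (𝓝 ((derivative lam).eval z₀)) := by
  simp only [NodeDegrees.eval_derivative_variableDist]
  have h := tendsto_sum_sockets (fun m => (hD.boundedBy m).dv_le) hD.dv_frac
    (φ := fun m k => (k : ℝ) * z m ^ (k - 1)) (φ₀ := fun k => (k : ℝ) * z₀ ^ (k - 1))
    fun k => (hz.pow _).const_mul _
  rw [derivative_eval, sum_over_range' _ (by simp) _
    (Nat.lt_succ_of_le (le_max_left _ rho.natDegree))]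
  simpa [mul_comm, mul_left_comm, mul_assoc] using h

/-- For each fixed round density evolution is a polynomial expression in the degree fractions, so
the exact recursion of the finite graphs converges to the one of the limit pair. -/
theorem tendsto_densityEvolution (hD : IsLongEnsemble lam rho D) (p : ℝ) (i : ℕ) :
    Tendsto (fun m => (densityEvolution (D m).variableDist (D m).checkDist p i).1) atTop
        (𝓝 (densityEvolution lam rho p i).1) ∧
      Tendsto (fun m => (densityEvolution (D m).variableDist (D m).checkDist p i).2) atTop
        (𝓝 (densityEvolution lam rho p i).2) := by
  induction i with
  | zero => exact ⟨tendsto_const_nhds, tendsto_const_nhds⟩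
  | succ i ih =>
    have h1 := hD.tendsto_checkDist (ih.1.const_sub 1)
    have h2 := hD.tendsto_checkDist (ih.2.const_sub 1)
    have h3 := hD.tendsto_variableDist (h1.const_sub 1)
    have h4 := hD.tendsto_derivative_variableDist (h1.const_sub 1)
    exact ⟨h3.const_mul p, h3.add (((h1.sub h2).const_mul p).mul h4)⟩

/-- Weighting each socket by the inverse degree of its node counts every node once. -/
theorem tendsto_length_div (hD : IsLongEnsemble lam rho D) (hl : IsDegreeDist lam) :
    Tendsto (fun m => ((D m).n : ℝ) / (∑ v, (D m).dv v : ℕ)) atTop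
      (𝓝 (∑ i ∈ lam.support, lam.coeff i / (i + 1))) := by
  have h := tendsto_sum_sockets (fun m => (hD.boundedBy m).dv_le) hD.dv_frac
    (φ := fun _ k => ((k : ℝ) + 1)⁻¹) (φ₀ := fun k => ((k : ℝ) + 1)⁻¹) fun k => tendsto_const_nhds
  rw [sum_support_coeff_div (Nat.lt_succ_of_le (le_max_left _ rho.natDegree))]
  refine h.congr fun m => ?_
  congr 1
  rw [Fintype.sum_sigma]
  have : ∀ v, ∑ e : Fin ((D m).dv v), (((((D m).dv v - 1 : ℕ) : ℝ) + 1)⁻¹) = 1 := fun v => by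
    have h2 := hD.two_le_dv hl m v
    have h3 : ((D m).dv v : ℝ) ≠ 0 := by exact_mod_cast (by omega : (D m).dv v ≠ 0)
    rw [Nat.cast_sub (by omega)]
    simp [h3]
  simp only [this]
  simp

theorem tendsto_checks_div (hD : IsLongEnsemble lam rho D) (hr : IsDegreeDist rho) :
    Tendsto (fun m => ((D m).r : ℝ) / (∑ v, (D m).dv v : ℕ)) atTop
      (𝓝 (∑ i ∈ rho.support, rho.coeff i / (i + 1))) := by
  have h := tendsto_sum_sockets (fun m => (hD.boundedBy m).dc_le) hD.dc_frac
    (φ := fun _ k => ((k : ℝ) + 1)⁻¹) (φ₀ := fun k => ((k : ℝ) + 1)⁻¹) fun k => tendsto_const_nhds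
  rw [sum_support_coeff_div (Nat.lt_succ_of_le (le_max_right lam.natDegree _))]
  refine h.congr fun m => ?_
  rw [(D m).edges_eq]
  congr 1
  rw [Fintype.sum_sigma]
  have : ∀ v, ∑ e : Fin ((D m).dc v), (((((D m).dc v - 1 : ℕ) : ℝ) + 1)⁻¹) = 1 := fun v => by
    have h2 := hD.two_le_dc hr m v
    have h3 : ((D m).dc v : ℝ) ≠ 0 := by exact_mod_cast (by omega : (D m).dc v ≠ 0)
    rw [Nat.cast_sub (by omega)]
    simp [h3]
  simp only [this]
  simp

theorem tendsto_one_sub_checks_div_length (hD : IsLongEnsemble lam rho D) (hl : IsDegreeDist lam)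
    (hr : IsDegreeDist rho) :
    Tendsto (fun m => 1 - ((D m).r : ℝ) / (D m).n) atTop (𝓝 (designRate lam rho)) := by
  have h := (hD.tendsto_checks_div hr).div (hD.tendsto_length_div hl)
    hl.sum_support_coeff_div_pos.ne'
  refine (h.congr' ?_).const_sub 1
  filter_upwards [hD.length.eventually_gt_atTop 0] with m hm
  have : (∑ v, (D m).dv v : ℕ) ≠ 0 := by
    have h1 : (D m).dv ⟨0, hm⟩ ≤ ∑ v, (D m).dv v := Finset.single_le_sum_of_canonicallyOrdered
      (Finset.mem_univ _)
    have h2 := hD.two_le_dv hl m ⟨0, hm⟩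
    omega
  exact div_div_div_cancel_right₀ (by exact_mod_cast this) _ _

end IsLongEnsemble

theorem NodeDegrees.nonempty_graph (D : NodeDegrees) : Nonempty D.Graph :=
  ⟨Fintype.equivOfCardEq (by simpa using D.edges_eq)⟩

/-- Rank–nullity: `r` checks lower the dimension by at most `r`, whatever the weights. -/
theorem one_sub_checks_div_length_le_codeRate {F : Type} [Field F] {D : NodeDegrees} (g : D.Graph)
    (h : D.VSocket → Fˣ) (hn : 0 < D.n) : 1 - (D.r : ℝ) / D.n ≤ codeRate g h := by
  have h1 := LinearMap.finrank_range_add_finrank_ker (parityCheck g h).mulVecLin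
  have h2 := Submodule.finrank_le (LinearMap.range (parityCheck g h).mulVecLin)
  rw [Module.finrank_fin_fun] at h1 h2
  have hn' : (0 : ℝ) < D.n := by exact_mod_cast hn
  rw [codeRate, ldpcCode, le_div_iff₀ hn', sub_mul, one_mul, div_mul_cancel₀ _ hn'.ne']
  have h3 : (D.n : ℝ) ≤ D.r + Module.finrank F (LinearMap.ker (parityCheck g h).mulVecLin) := by
    exact_mod_cast (by omega)
  linarith

/-! ### Decoding with high probability -/

open scoped Classical in
theorem graphProb_eq_matchingMean (D : NodeDegrees) (Q : D.Graph → Prop) :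
    graphProb D Q = matchingMean fun g : D.Graph => if Q g then 1 else 0 := by
  rw [graphProb, matchingMean, Finset.sum_boole, Nat.card_eq_fintype_card, Nat.card_eq_fintype_card,
    Fintype.card_subtype]

namespace NodeDegrees

variable {D : NodeDegrees} {p : ℝ} {d J : ℕ}

open scoped Classical in
-- Markov's inequality; each node fails to have a tree neighborhood with probability `O(1 / n)`, so
-- the mean number of failures stays bounded.
theorem matchingMean_le_not_treeLike_le (hd : D.BoundedBy d) (hdv : ∀ v, 1 ≤ D.dv v) (hn : 0 < D.n)
    {ε : ℝ} (hε : 0 < ε) :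
    matchingMean (fun g : D.Graph =>
      if ε ≤ (∑ v, if D.TreeLike g J v then (0 : ℝ) else 1) / D.n then 1 else 0) ≤
        treeConst d J / ε / D.n := by
  obtain ⟨g₀⟩ := D.nonempty_graph
  have hn' : (0 : ℝ) < D.n := by exact_mod_cast hn
  have hcard : (D.n : ℝ) ≤ Fintype.card D.VSocket := by
    rw [Fintype.card_sigma]
    simp only [Fintype.card_fin]
    have h := Finset.sum_le_sum fun v (_ : v ∈ Finset.univ) => hdv v
    rw [Finset.sum_const, Finset.card_univ, Fintype.card_fin, smul_eq_mul, mul_one] at h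
    exact_mod_cast h
  have hmarkov : ∀ g : D.Graph,
      (if ε ≤ (∑ v, if D.TreeLike g J v then (0 : ℝ) else 1) / D.n then (1 : ℝ) else 0) ≤
        (ε * D.n)⁻¹ * ∑ v, if D.TreeLike g J v then (0 : ℝ) else 1 := by
    intro g
    have h0 : (0 : ℝ) ≤ ∑ v, if D.TreeLike g J v then (0 : ℝ) else 1 :=
      Finset.sum_nonneg fun v _ => by split_ifs <;> norm_num
    split_ifs with h
    · rw [← div_eq_inv_mul, le_div_iff₀ (by positivity), one_mul]
      rwa [le_div_iff₀ hn'] at h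
    · positivity
  refine (matchingMean_mono hmarkov).trans ?_
  rw [matchingMean_const_mul, matchingMean_sum]
  have hK := treeConst_nonneg d J
  have hsum : ∑ v, matchingMean (fun g : D.Graph => if D.TreeLike g J v then (0 : ℝ) else 1) ≤
      treeConst d J := by
    refine (Finset.sum_le_sum fun v _ => (matchingMean_not_treeLike_le hd g₀ v).trans
      (div_le_div_of_nonneg_left hK hn' hcard)).trans (le_of_eq ?_)
    rw [Finset.sum_const, Finset.card_univ, Fintype.card_fin, nsmul_eq_mul, mul_div_cancel₀ _ hn'.ne']
  refine (mul_le_mul_of_nonneg_left hsum (by positivity)).trans (le_of_eq ?_)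
  field_simp

open scoped Classical in
theorem one_sub_le_graphProb (hp : 0 ≤ p ∧ p ≤ 1) (hd : D.BoundedBy d) (hdv : ∀ v, 1 ≤ D.dv v)
    (hn : 0 < D.n) {y ε : ℝ} (hy : ∀ e, (D.msgQuery hp J (.inl e)).mean (fun v => v.1.2) = y)
    (hε : 0 < ε) {Q : D.Graph → Prop}
    (hQ : ∀ g : D.Graph, (∑ v, if D.TreeLike g J v then (0 : ℝ) else 1) / D.n < ε →
      (∑ v, D.allUnverified hp J g v) / D.n < y + ε → Q g) :
    1 - (treeConst d J / ε + (3 * treeConst d J + 1) / ε ^ 2) / D.n ≤ graphProb D Q := by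
  obtain ⟨g₀⟩ := D.nonempty_graph
  rw [graphProb_eq_matchingMean, sub_le_iff_le_add, add_div]
  refine le_trans ?_ (add_le_add_right (add_le_add
    (matchingMean_le_not_treeLike_le (J := J) hd hdv hn hε)
    (matchingMean_deviation_le hp hd g₀ hy hdv hn hε)) _)
  rw [← matchingMean_add, ← matchingMean_add]
  refine (matchingMean_const g₀ 1).symm.le.trans (matchingMean_mono fun g => ?_)
  have h01 : ∀ (P : Prop) [Decidable P], (0 : ℝ) ≤ if P then 1 else 0 := fun P _ => by
    split_ifs <;> norm_num
  by_cases h1 : ε ≤ (∑ v, if D.TreeLike g J v then (0 : ℝ) else 1) / D.n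
  · rw [if_pos h1]
    linarith [h01 (Q g), h01 (y + ε ≤ (∑ v, D.allUnverified hp J g v) / D.n)]
  · by_cases h2 : y + ε ≤ (∑ v, D.allUnverified hp J g v) / D.n
    · rw [if_pos h2]
      linarith [h01 (Q g), h01 (ε ≤ (∑ v, if D.TreeLike g J v then (0 : ℝ) else 1) / D.n)]
    · rw [if_pos (c := Q g) (hQ g (not_le.1 h1) (not_le.1 h2))]
      linarith [h01 (ε ≤ (∑ v, if D.TreeLike g J v then (0 : ℝ) else 1) / D.n),
        h01 (y + ε ≤ (∑ v, D.allUnverified hp J g v) / D.n)]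

end NodeDegrees

theorem graphProb_le_one (D : NodeDegrees) (Q : D.Graph → Prop) : graphProb D Q ≤ 1 := by
  classical
  obtain ⟨g₀⟩ := D.nonempty_graph
  rw [graphProb_eq_matchingMean]
  refine (matchingMean_mono fun g => ?_).trans (matchingMean_const g₀ 1).le
  split_ifs <;> norm_num

/-- The property `Q` is left free, required only to follow eventually from a small error rate. The
rate bound of the capacity claim, which holds for every graph, can thus be adjoined. -/
theorem exists_tendsto_graphProb {lam rho : ℝ[X]} {p : ℝ} (hl : IsDegreeDist lam)
    (hr : IsDegreeDist rho) (hp : 0 ≤ p) (h : p < lmpThreshold lam rho) {ε : ℝ} (hε : 0 < ε) :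
    ∃ q₀ ℓ : ℕ, ∀ (F : Type) [Field F] [Fintype F], q₀ ≤ Fintype.card F →
      ∀ sel : Finset F → F, (∀ s : Finset F, s.Nonempty → sel s ∈ s) →
      ∀ D : ℕ → NodeDegrees, IsLongEnsemble lam rho D → ∀ Q : ∀ m, (D m).Graph → Prop,
      (∀ᶠ m in atTop, ∀ g : (D m).Graph, (∀ h : (D m).VSocket → Fˣ, ∀ c ∈ ldpcCode g h,
        symbolErrorRate ⊤ sel ℓ p g h c < ε) → Q m g) →
      Tendsto (fun m => graphProb (D m) (Q m)) atTop (𝓝 1) := by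
  classical
  obtain ⟨p', hpp', hp'1, -⟩ := exists_gt_of_lt_lmpThreshold hp h
  have hp01 : 0 ≤ p ∧ p ≤ 1 := ⟨hp, hpp'.le.trans hp'1⟩
  have hlim : Tendsto (fun i => 1 - rho.eval (1 - (densityEvolution lam rho p i).2)) atTop (𝓝 0) := by
    have h1 := (tendsto_densityEvolution_snd hl hr hp h).const_sub 1
    have h2 := ((rho.continuous.tendsto _).comp h1).const_sub 1
    simpa [hr.eval_one] using h2
  obtain ⟨ℓ, hℓ⟩ := eventually_atTop.1 (hlim.eventually_lt_const (by linarith : (0 : ℝ) < ε / 4))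
  set d := max lam.natDegree rho.natDegree + 1 with hd
  -- With this field size the collision term is at most `ε / 4`. The other three quarters of `ε` go
  -- to nodes without a tree, the deviation from the mean, and the limit of density evolution.
  refine ⟨⌈collisionBound d (ℓ + 1) * 4 / ε⌉₊ + 1, ℓ, ?_⟩
  intro F _ _ hq sel hsel D hD Q hQ
  have h2 : (2 : ℝ) ≤ Fintype.card F := by exact_mod_cast two_le_card_field (F := F)
  have hcoll : (collisionBound d (ℓ + 1) : ℝ) * (1 / (Fintype.card F - 1)) ≤ ε / 4 := by
    have h3 := Nat.le_ceil (collisionBound d (ℓ + 1) * 4 / ε)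
    have h4 : (⌈collisionBound d (ℓ + 1) * 4 / ε⌉₊ : ℝ) + 1 ≤ Fintype.card F := by
      exact_mod_cast hq
    rw [mul_one_div, div_le_iff₀ (by linarith)]
    rw [div_le_iff₀ hε] at h3
    nlinarith
  -- The index is `ℓ + 1` because decoder round `ℓ` corresponds to step `ℓ + 1` of density
  -- evolution.
  set Y : ℕ → ℝ := fun m => 1 - (D m).checkDist.eval
    (1 - (densityEvolution (D m).variableDist (D m).checkDist p (ℓ + 1)).2) with hY
  have hYlim : Tendsto Y atTop (𝓝 (1 - rho.eval (1 - (densityEvolution lam rho p (ℓ + 1)).2))) :=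
    (hD.tendsto_checkDist ((hD.tendsto_densityEvolution p (ℓ + 1)).2.const_sub 1)).const_sub 1
  set K : ℝ := NodeDegrees.treeConst d (2 * ℓ + 3) / (ε / 4) +
    (3 * NodeDegrees.treeConst d (2 * ℓ + 3) + 1) / (ε / 4) ^ 2 with hK
  have hKlim : Tendsto (fun m => 1 - K / (D m).n) atTop (𝓝 1) := by
    have h3 := ((tendsto_natCast_atTop_atTop (R := ℝ)).comp hD.length).const_div_atTop K
    simpa using h3.const_sub 1
  refine tendsto_of_tendsto_of_tendsto_of_le_of_le' hKlim tendsto_const_nhds ?_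
    (Eventually.of_forall fun m => graphProb_le_one _ _)
  filter_upwards [hQ, hD.length.eventually_gt_atTop 0,
    hYlim.eventually_lt_const (hℓ (ℓ + 1) (Nat.le_succ ℓ))] with m hQm hn hYm
  obtain ⟨g₀⟩ := (D m).nonempty_graph
  refine NodeDegrees.one_sub_le_graphProb hp01 (hD.boundedBy m)
    (fun v => one_le_two.trans (hD.two_le_dv hl m v)) hn
    (fun e => NodeDegrees.mean_msgQuery_inl hp01 g₀ (ℓ + 1) e) (by linarith : 0 < ε / 4) fun g h1 h2 =>
      hQm g fun w c hc => ?_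
  have h3 := symbolErrorRate_le hp01 (hD.boundedBy m) (hD.two_le_dc hr m) hsel hc ℓ hn
  have h4 : Y m < ε / 4 := hYm
  have h5 : (∑ v, (D m).allUnverified hp01 (2 * ℓ + 3) g v) / (D m).n < Y m + ε / 4 := h2
  have h6 : (∑ v, if (D m).TreeLike g (2 * ℓ + 3) v then (0 : ℝ) else 1) / (D m).n < ε / 4 := h1
  linarith

theorem theorem1 :
    -- density evolution converges, and long random codes are decoded reliably, below the threshold
    (∀ (lam rho : ℝ[X]) (p : ℝ), IsDegreeDist lam → IsDegreeDist rho →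
      0 ≤ p → p < lmpThreshold lam rho →
      Tendsto (fun i => (densityEvolution lam rho p i).2) atTop (𝓝 0) ∧
      ∀ ε : ℝ, 0 < ε → ∃ q₀ ℓ : ℕ, ∀ (F : Type) [Field F] [Fintype F], q₀ ≤ Fintype.card F →
        ∀ sel : Finset F → F, (∀ s : Finset F, s.Nonempty → sel s ∈ s) →
        ∀ D : ℕ → NodeDegrees, IsLongEnsemble lam rho D →
        Tendsto (fun m => graphProb (D m) fun g =>
          ∀ h : (D m).VSocket → Fˣ, ∀ c ∈ ldpcCode g h,
            symbolErrorRate ⊤ sel ℓ p g h c < ε) atTop (𝓝 1)) ∧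
    -- ensembles that achieve capacity on the erasure channel do so on the `q`-ary channel, large `q`
    (∀ (lam rho : ℕ → ℝ[X]) (δ : ℝ), IsBECCapacityAchieving lam rho δ →
      ∀ p : ℕ → ℝ, (∀ k, 0 ≤ p k) → (∀ k, p k < lmpThreshold (lam k) (rho k)) →
      Tendsto p atTop (𝓝 δ) →
      ∀ ε : ℝ, 0 < ε → ∀ᶠ k in atTop, ∃ q₀ ℓ : ℕ,
        ∀ (F : Type) [Field F] [Fintype F], q₀ ≤ Fintype.card F →
        ∀ sel : Finset F → F, (∀ s : Finset F, s.Nonempty → sel s ∈ s) →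
        ∀ D : ℕ → NodeDegrees, IsLongEnsemble (lam k) (rho k) D →
        Tendsto (fun m => graphProb (D m) fun g =>
          ∀ h : (D m).VSocket → Fˣ, qscCapacity F (p k) - ε < codeRate g h ∧
            ∀ c ∈ ldpcCode g h, symbolErrorRate ⊤ sel ℓ (p k) g h c < ε) atTop (𝓝 1)) := by
  refine ⟨fun lam rho p hl hr hp h => ⟨tendsto_densityEvolution_snd hl hr hp h, fun ε hε => ?_⟩,
    fun lam rho δ hbec p hp h hpδ ε hε => ?_⟩
  · obtain ⟨q₀, ℓ, H⟩ := exists_tendsto_graphProb hl hr hp h hε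
    exact ⟨q₀, ℓ, fun F _ _ hq sel hsel D hD =>
      H F hq sel hsel D hD _ (Eventually.of_forall fun m g hg => hg)⟩
  -- The losses are `ε / 8` in the design rate, `ε / 8` in `p k`, and `ε / 4` in the capacity bound,
  -- in total `ε / 2`.
  · filter_upwards [hbec.rate.eventually_const_lt (by linarith : 1 - δ - ε / 8 < 1 - δ),
      hpδ.eventually_const_lt (by linarith : δ - ε / 8 < δ)] with k hk hpk
    have hl := hbec.lam_dist k
    have hr := hbec.rho_dist k
    obtain ⟨p', hpp', hp'1, -⟩ := exists_gt_of_lt_lmpThreshold (hp k) (h k)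
    obtain ⟨q₀, ℓ, H⟩ := exists_tendsto_graphProb hl hr (hp k) (h k) hε
    -- From `q₁` on the excess `log 2 / log q` in the capacity bound is at most `ε / 4`.
    obtain ⟨q₁, hq₁⟩ := eventually_atTop.1 ((Real.tendsto_log_atTop.comp
      (tendsto_natCast_atTop_atTop (R := ℝ))).eventually_ge_atTop (Real.log 2 / (ε / 4)))
    refine ⟨max q₀ q₁, ℓ, fun F _ _ hq sel hsel D hD =>
      H F (le_of_max_le_left hq) sel hsel D hD _ ?_⟩
    filter_upwards [hD.length.eventually_gt_atTop 0,
      (hD.tendsto_one_sub_checks_div_length hl hr).eventually_const_lt hk] with m hn hrate g hg w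
    refine ⟨?_, hg w⟩
    have h1 := qscCapacity_le (hp k) (hpp'.le.trans hp'1) (two_le_card_field (F := F))
    have h2 := one_sub_checks_div_length_le_codeRate g w hn
    have h3 : Real.log 2 / Real.log (Fintype.card F) ≤ ε / 4 := by
      have h4 : Real.log 2 / (ε / 4) ≤ Real.log (Fintype.card F) :=
        hq₁ _ (le_of_max_le_right hq)
      have h5 : 0 < Real.log (Fintype.card F) := Real.log_pos (by
        exact_mod_cast two_le_card_field (F := F))
      rw [div_le_iff₀ (by linarith)] at h4
      rw [div_le_iff₀ h5]
      linarith
    linarith
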